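/- Notation. For $\lambda\in\mathbb{R}$, $0<\alpha\le 1$ let $L(\lambda,\alpha,s)=\sum_{n\ge0}e^{2\pi i\lambda n}(n+\alpha)^{-s}$ be the Lerch zeta-function, given in $\Re s>0$ by this series if $\lambda\notin\mathbb{Z}$, and for $\lambda\in\mathbb{Z}$ equal to the (analytically continued) Hurwitz zeta-function $\zeta(s,\alpha)$. Let $\mu_k$ be $k$-dimensional Lebesgue measure, and for $T>0$ and $\sigma>1/2$ let $P_{\sigma,T}(\,\cdot\,;\lambda,\alpha)$ be the Borel probability measure on $\mathbb{C}$ $$P_{\sigma,T}(A;\lambda,\alpha)=\frac1T\,\mu_1\{t\in[0,T] : L(\lambda,\alpha,\sigma+it)\in A\}.$$ Let $S$ be the set of all $\alpha\in(0,1]$ such that (1) the numbers $\log(n+\alpha)$, $n\ge0$, are linearly independent over $\mathbb{Q}$; and (2) there are $\Omega(\alpha)>0$ and $X(\alpha)$ such that for all $X\ge X(\alpha)$, all $N$, all integers $0\le n_1,\dots,n_N\le X$ and all $\epsilon_j\in\{1,-1\}$ with $\sum_{j=1}^N\epsilon_j\log(n_j+\alpha)\ne0$, we have $\bigl|\sum_{j=1}^N\epsilon_j\log(n_j+\alpha)\bigr|\ge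 X^{-\Omega(\alpha)N^2}$. Theorem. (a) For all $\lambda\in\mathbb{R}$, $\alpha\in S$ and $\sigma>1/2$, the measures $P_{\sigma,T}(\,\cdot\,;\lambda,\alpha)$ converge weakly, as $T\to\infty$, to a probability measure $P_\sigma(\,\cdot\,;\lambda,\alpha)$ on $\mathbb{C}$. (b) For all $\epsilon>0$ and $\epsilon_1>0$ there is a positive $T_0=T_0(\alpha,\epsilon,\epsilon_1)$, and for all $\lambda,\sigma_1\in\mathbb{R}$ there is a constant $C=C(\lambda,\sigma_1,\epsilon,\epsilon_1)>0$, such that for all $\alpha\in S$, all $1/2+\epsilon_1\le\sigma\le\sigma_1$, all $T\ge T_0(\alpha,\epsilon,\epsilon_1)$, and all rectangles $R=\{x+iy: a\le x\le b,\ c\le y\le d\}$ whose sides $b-a$ and $d-c$ are both greater than $(\log T)^{-1/4+\epsilon}$, $$\bigl|P_{\sigma,T}(R;\lambda,\alpha)-P_\sigma(R;\lambda,\alpha)\bigr|\le C\,(\mu_2(R)+1)(\log T)^{-\frac14+\epsilon}.$$ (c) For every $\alpha\in S$ and $\sigma>1/2$ there is a non-negative continuous function $M_\sigma(z;\alpha)$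 on $\mathbb{C}$, not depending on $\lambda$, such that for every $\lambda\in\mathbb{R}$ and every rectangle $R=\{x+iy: a\le x\le b,\ c\le y\le d\}$, $$P_\sigma(R;\lambda,\alpha)=\int_R M_\sigma(z;\alpha)\,|dz|,\qquad |dz|=(2\pi)^{-1}dx\,dy.$$ -/

import Mathlib

open MeasureTheory Filter Topology Set

noncomputable section

/-- The Lerch zeta-function `L(λ, α, s)` for real `λ`, `0 < α ≤ 1` and `Re s > 0`.
If `λ` is an integer it is the (analytically continued) Hurwitz zeta-function `ζ(s, α)`, whose only
singularity is a simple pole at `s = 1`; otherwise it is the sum of the (conditionally)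
convergent series `∑_{n ≥ 0} e^{2πiλn} (n + α)^{-s}`. -/
def lerchZeta (lam α : ℝ) (s : ℂ) : ℂ :=
  open Classical in
  if ∃ k : ℤ, lam = k then HurwitzZeta.hurwitzZeta (α : UnitAddCircle) s
  else limUnder atTop (fun N : ℕ => ∑ n ∈ Finset.range N,
    Complex.exp (2 * Real.pi * Complex.I * lam * n) / ((n : ℂ) + α) ^ s)

/-- `t ↦ L(λ, α, σ + it)`. -/
def lerchLine (lam α σ t : ℝ) : ℂ := lerchZeta lam α (σ + t * Complex.I)

theorem measurable_lerchLine (lam α σ : ℝ) : Measurable (lerchLine lam α σ) := by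
  have hline : Continuous (fun t : ℝ => (σ : ℂ) + t * Complex.I) := by fun_prop
  unfold lerchLine lerchZeta
  split_ifs
  · refine measurable_of_continuousOn_compl_singleton (0 : ℝ) ?_
    intro t ht
    have hne : (σ : ℂ) + t * Complex.I ≠ 1 := by
      intro h
      have := congrArg Complex.im h
      simp at this
      exact ht this
    exact (ContinuousAt.comp (f := fun t : ℝ => (σ : ℂ) + t * Complex.I)
      (HurwitzZeta.differentiableAt_hurwitzZeta _ hne).continuousAt
      hline.continuousAt).continuousWithinAt
  · refine (StronglyMeasurable.limUnder (fun N => ?_)).measurable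
    refine Measurable.stronglyMeasurable ?_
    refine Finset.measurable_sum _ (fun n _ => ?_)
    exact measurable_const.div (measurable_const.pow hline.measurable)

/-- `P_{σ,T}(A; λ, α) = T⁻¹ μ₁ {t ∈ [0, T] : L(λ, α, σ + it) ∈ A}`, as a measure. -/
def lerchValueMeasure (lam α σ T : ℝ) : Measure ℂ :=
  (ENNReal.ofReal T)⁻¹ • (volume.restrict (Icc 0 T)).map (lerchLine lam α σ)

theorem isProbabilityMeasure_lerchValueMeasure (lam α σ : ℝ) {T : ℝ} (hT : 0 < T) :
    IsProbabilityMeasure (lerchValueMeasure lam α σ T) := by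
  constructor
  rw [lerchValueMeasure, Measure.smul_apply,
    Measure.map_apply (measurable_lerchLine lam α σ) MeasurableSet.univ]
  simp only [preimage_univ, Measure.restrict_apply_univ, Real.volume_Icc, sub_zero, smul_eq_mul]
  exact ENNReal.inv_mul_cancel (by simpa using hT) ENNReal.ofReal_ne_top

/-- `P_{σ,T}( · ; λ, α)` as a probability measure on `ℂ` (for `T ≤ 0`, where the quotient
makes no sense, an arbitrary value). -/
def lerchValueLaw (lam α σ T : ℝ) : ProbabilityMeasure ℂ :=
  if hT : 0 < T then
    ⟨lerchValueMeasure lam α σ T, isProbabilityMeasure_lerchValueMeasure lam α σ hT⟩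
  else default

/-- `P_σ( · ; λ, α)`: the limit of `P_{σ,T}( · ; λ, α)` as `T → ∞` in the topology of weak
convergence of probability measures (an arbitrary value if there is no limit). -/
def lerchLimitLaw (lam α σ : ℝ) : ProbabilityMeasure ℂ :=
  limUnder atTop (lerchValueLaw lam α σ)

/-- The admissible set `S` of parameters `α ∈ (0, 1]`: the numbers `log (n + α)` are linearly
independent over `ℚ`, and nonzero signed sums of `N` of them with `n ≤ X` are at least
`X ^ (-Ω N²)` in absolute value, for all `X` beyond a bound depending only on `α`. -/
def admissibleSet : Set ℝ :=
  {α | 0 < α ∧ α ≤ 1 ∧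
    LinearIndependent ℚ (fun n : ℕ => Real.log (n + α)) ∧
    ∃ Ω : ℝ, 0 < Ω ∧ ∀ᶠ X : ℝ in atTop, ∀ (N : ℕ) (n : Fin N → ℕ) (e : Fin N → ℝ),
      (∀ j, (n j : ℝ) ≤ X) → (∀ j, e j = 1 ∨ e j = -1) →
      ∑ j, e j * Real.log (n j + α) ≠ 0 →
      X ^ (-(Ω * (N : ℝ) ^ 2)) ≤ |∑ j, e j * Real.log (n j + α)|}

/-- The closed rectangle `{x + iy : a ≤ x ≤ b, c ≤ y ≤ d}`. -/
def closedRect (a b c d : ℝ) : Set ℂ := Icc a b ×ℂ Icc c d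

end

/-! Write x = log T. On a line Re s = σ > 1/2 the function t ↦ L(λ, α, σ + it) is, in the mean, a
short Dirichlet polynomial over n < K with frequencies -log(n+α). These are linearly independent
over ℚ, so the values should be distributed like the random series ∑ (n+α)^(-σ) e^{iθₙ} with
independent uniform angles. The phases e^{2πiλn} are absorbed by the angles, which is why the limit
law does not see λ. Its characteristic function is the product of the Bessel factors
J₀(|w|(n+α)^(-σ)). Six factors already make it O((1+|w|)⁻³), so there is a continuous density, and a
strip of width r has mass O(r).

Everything follows from one estimate, `exists_norm_charFun_lerchValueMeasure_sub_le`: for |w| ≤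
x^(1/4-ε/2) the characteristic functions of the value measure and of the limit law differ by at most
1/x. Three approximations give it, assembled in `exists_norm_charFun_sub_charFun_le`. An iterated
comparison of series and integrals replaces L by a sum of length Q ≈ T^(1+δ)
(`exists_norm_lerchZeta_sub_le`). A mean-square bound discards the terms K ≤ n < Q with K ≈ exp(x^κ)
(`integral_norm_sq_sum_lerchTerm_le`). Finally the time average of exp(iY), with Y a real
trigonometric polynomial, is compared with the torus average through the first N moments
(`norm_integral_cexp_torusSum_sub_le`).

The last step fixes the exponent 1/4. Expanding moments produces signed sums of at most N
logarithms, of size at least K^(-ΩN²) unless they vanish. This must be beaten by T, so N² log K =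
o(x) and N is just below √x. The Taylor remainder behaves like 2^(-N) exp(O(|w|²)), up to slowly
growing factors, so |w|² must stay below N and |w| just below x^(1/4).

Closeness of characteristic functions becomes closeness on rectangles through a Berry–Esseen
inequality with Gaussian smoothing (`abs_measureReal_closedRect_sub_le`), where the strip bound
controls boundaries. Weak convergence comes from Lévy's theorem, the density from Fourier inversion.
Uniformity is arranged by letting T₀ absorb all constants attached to α, while C covers bounded
ranges of T by the trivial bound. -/

noncomputable section

/-! ### Gaussian smoothing of measures on the plane -/

/-- The heat kernel on `ℂ` at time `b`. -/
def heatKernel (b : ℝ) (z : ℂ) : ℝ := (4 * Real.pi * b)⁻¹ * Real.exp (-‖z‖ ^ 2 / (4 * b))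

/-- The density of the convolution of `μ` with the heat kernel. -/
def heatSmooth (μ : Measure ℂ) (b : ℝ) (z : ℂ) : ℝ := ∫ x, heatKernel b (z - x) ∂μ

lemma heatKernel_nonneg {b : ℝ} (hb : 0 < b) (z : ℂ) : 0 ≤ heatKernel b z := by
  unfold heatKernel; positivity

lemma heatKernel_le {b : ℝ} (hb : 0 < b) (z : ℂ) : heatKernel b z ≤ (4 * Real.pi * b)⁻¹ := by
  unfold heatKernel
  refine mul_le_of_le_one_right (by positivity) (Real.exp_le_one_iff.2 ?_)
  rw [neg_div]
  exact neg_nonpos.2 (by positivity)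

@[fun_prop]
lemma continuous_heatKernel (b : ℝ) : Continuous (heatKernel b) := by
  unfold heatKernel; fun_prop

lemma integral_exp_neg_mul_norm_sq {b : ℝ} (hb : 0 < b) :
    ∫ w : ℂ, Real.exp (-b * ‖w‖ ^ 2) = Real.pi / b := by
  have h := GaussianFourier.integral_cexp_neg_mul_sq_norm_add (V := ℂ) (b := b) (by simpa) 0 0
  have h2 : ∀ w : ℂ, Complex.exp (-(b : ℂ) * ‖w‖ ^ 2 + 0 * (inner ℝ (0 : ℂ) w : ℝ))
      = ((Real.exp (-b * ‖w‖ ^ 2) : ℝ) : ℂ) := by intro w; push_cast; simp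
  simp only [h2] at h
  rw [integral_complex_ofReal] at h
  simp only [neg_mul] at h ⊢
  simp at h
  exact_mod_cast h

lemma integrable_exp_neg_mul_norm_sq {b : ℝ} (hb : 0 < b) :
    Integrable (fun w : ℂ => Real.exp (-b * ‖w‖ ^ 2)) := by
  by_contra h
  have h1 := integral_exp_neg_mul_norm_sq hb
  rw [integral_undef h] at h1
  have : 0 < Real.pi / b := by positivity
  linarith

lemma heatKernel_eq_exp (b : ℝ) (z : ℂ) :
    heatKernel b z = (4 * Real.pi * b)⁻¹ * Real.exp (-(1 / (4 * b)) * ‖z‖ ^ 2) := by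
  unfold heatKernel; congr 2; ring

lemma integrable_heatKernel {b : ℝ} (hb : 0 < b) : Integrable (heatKernel b) := by
  have : heatKernel b = fun z => (4 * Real.pi * b)⁻¹ * Real.exp (-(1 / (4 * b)) * ‖z‖ ^ 2) :=
    funext (heatKernel_eq_exp b)
  rw [this]
  exact (integrable_exp_neg_mul_norm_sq (by positivity)).const_mul _

lemma integral_heatKernel {b : ℝ} (hb : 0 < b) : ∫ z, heatKernel b z = 1 := by
  simp only [heatKernel_eq_exp]
  rw [integral_const_mul, integral_exp_neg_mul_norm_sq (by positivity)]
  field_simp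

/-- Half of the Gaussian exponent is given up for exp(-r²/(8b)); the remaining half is a Gaussian of
mass 8πb, whence the factor 2. -/
lemma heatKernel_tail {b r : ℝ} (hb : 0 < b) (hr : 0 ≤ r) :
    ∫ z in {z : ℂ | r < ‖z‖}, heatKernel b z ≤ 2 * Real.exp (-r ^ 2 / (8 * b)) := by
  have hm : MeasurableSet {z : ℂ | r < ‖z‖} := measurableSet_lt measurable_const measurable_norm
  have hb2 : 0 < 1 / (8 * b) := by positivity
  have hi : Integrable (fun z : ℂ => (4 * Real.pi * b)⁻¹ * Real.exp (-r ^ 2 / (8 * b)) *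
      Real.exp (-(1 / (8 * b)) * ‖z‖ ^ 2)) := (integrable_exp_neg_mul_norm_sq hb2).const_mul _
  calc ∫ z in {z : ℂ | r < ‖z‖}, heatKernel b z
      ≤ ∫ z in {z : ℂ | r < ‖z‖}, (4 * Real.pi * b)⁻¹ * Real.exp (-r ^ 2 / (8 * b)) *
        Real.exp (-(1 / (8 * b)) * ‖z‖ ^ 2) := by
        refine setIntegral_mono_on (integrable_heatKernel hb).integrableOn hi.integrableOn hm ?_
        intro z hz
        rw [heatKernel, mul_assoc (4 * Real.pi * b)⁻¹, ← Real.exp_add]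
        refine mul_le_mul_of_nonneg_left (Real.exp_le_exp.2 ?_) (by positivity)
        have h1 : r ^ 2 ≤ ‖z‖ ^ 2 := pow_le_pow_left₀ hr (le_of_lt hz) 2
        have h2 : -‖z‖ ^ 2 / (4 * b) = -‖z‖ ^ 2 / (8 * b) + -(1 / (8 * b)) * ‖z‖ ^ 2 := by
          field_simp; ring
        rw [h2]
        gcongr
    _ ≤ ∫ z : ℂ, (4 * Real.pi * b)⁻¹ * Real.exp (-r ^ 2 / (8 * b)) *
        Real.exp (-(1 / (8 * b)) * ‖z‖ ^ 2) :=
        setIntegral_le_integral hi (Eventually.of_forall fun z => by positivity)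
    _ = _ := by
        rw [integral_const_mul, integral_exp_neg_mul_norm_sq hb2]
        field_simp; ring

lemma fourier_heatKernel {b : ℝ} (hb : 0 < b) (z : ℂ) :
    ∫ w : ℂ, Complex.exp (-(inner ℝ w z : ℝ) * Complex.I) * Real.exp (-b * ‖w‖ ^ 2)
      = ((2 * Real.pi) ^ 2 * heatKernel b z : ℝ) := by
  have h := GaussianFourier.integral_cexp_neg_mul_sq_norm_add (V := ℂ) (b := b) (by simpa)
    (-Complex.I) z
  have h2 : ∀ w : ℂ, Complex.exp (-(b : ℂ) * ‖w‖ ^ 2 + -Complex.I * (inner ℝ z w : ℝ))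
      = Complex.exp (-(inner ℝ w z : ℝ) * Complex.I) * Real.exp (-b * ‖w‖ ^ 2) := by
    intro w; push_cast; rw [← Complex.exp_add, real_inner_comm]; congr 1; ring
  simp only [h2] at h
  rw [h, heatKernel]
  simp
  have hb' : (b : ℂ) ≠ 0 := by exact_mod_cast hb.ne'
  field_simp
  ring

lemma integrable_charFun_mul_exp (μ : Measure ℂ) [IsProbabilityMeasure μ] {b : ℝ} (hb : 0 < b)
    (z : ℂ) : Integrable (fun w : ℂ => charFun μ w *
      (Complex.exp (-(inner ℝ w z : ℝ) * Complex.I) * Real.exp (-b * ‖w‖ ^ 2))) := by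
  refine (integrable_exp_neg_mul_norm_sq hb).mono' ?_ (Eventually.of_forall fun w => ?_)
  · exact Continuous.aestronglyMeasurable (by fun_prop)
  · have h1 := norm_charFun_le_one (μ := μ) w
    rw [norm_mul, norm_mul, ← Complex.ofReal_neg, Complex.norm_exp_ofReal_mul_I, one_mul,
      Complex.norm_real, Real.norm_of_nonneg (Real.exp_pos _).le]
    exact mul_le_of_le_one_left (Real.exp_pos _).le h1

/-- Smoothing multiplies the characteristic function by a Gaussian, so Fourier inversion holds for
every probability measure, with no regularity assumed. -/
lemma heatSmooth_eq_fourier (μ : Measure ℂ) [IsProbabilityMeasure μ] {b : ℝ} (hb : 0 < b) (z : ℂ) :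
    (((2 * Real.pi) ^ 2 * heatSmooth μ b z : ℝ) : ℂ) = ∫ w : ℂ, charFun μ w *
      (Complex.exp (-(inner ℝ w z : ℝ) * Complex.I) * Real.exp (-b * ‖w‖ ^ 2)) := by
  have h1 : (((2 * Real.pi) ^ 2 * heatSmooth μ b z : ℝ) : ℂ) = ∫ x, (∫ w : ℂ,
      Complex.exp (-(inner ℝ w (z - x) : ℝ) * Complex.I) * Real.exp (-b * ‖w‖ ^ 2)) ∂μ := by
    rw [heatSmooth, ← integral_const_mul, ← integral_complex_ofReal]
    refine integral_congr_ae (Eventually.of_forall fun x => ?_)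
    exact (fourier_heatKernel hb (z - x)).symm
  have hc : Continuous (fun p : ℂ × ℂ => Complex.exp (-(inner ℝ p.2 (z - p.1) : ℝ) * Complex.I) *
      (Real.exp (-b * ‖p.2‖ ^ 2) : ℂ)) := by fun_prop
  rw [h1, integral_integral_swap]
  · congr 1 with w
    rw [charFun_apply, ← integral_mul_const]
    refine integral_congr_ae (Eventually.of_forall fun x => ?_)
    simp only
    rw [← mul_assoc, ← Complex.exp_add]
    congr 2
    rw [inner_sub_right, real_inner_comm w x]
    push_cast; ring
  · have hi : Integrable (fun p : ℂ × ℂ => Real.exp (-b * ‖p.2‖ ^ 2)) (μ.prod volume) :=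
      (integrable_exp_neg_mul_norm_sq hb).comp_snd μ
    refine hi.mono' hc.aestronglyMeasurable ?_
    refine Eventually.of_forall fun p => ?_
    simp only [Function.uncurry]
    rw [norm_mul, ← Complex.ofReal_neg, Complex.norm_exp_ofReal_mul_I, one_mul,
      Complex.norm_real, Real.norm_of_nonneg (Real.exp_pos _).le]

/-- The inversion integral is split at |w| = W. Inside, the characteristic functions are close;
outside they differ by at most 2 and half of the Gaussian weight supplies exp(-bW²/2). The factors
of π are dropped using π ≤ (2π)². -/
lemma abs_heatSmooth_sub_le (μ ν : Measure ℂ) [IsProbabilityMeasure μ] [IsProbabilityMeasure ν]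
    {b η W : ℝ} (hb : 0 < b) (hW : 0 ≤ W) (hη : 0 ≤ η)
    (h : ∀ w : ℂ, ‖w‖ ≤ W → ‖charFun μ w - charFun ν w‖ ≤ η) (z : ℂ) :
    |heatSmooth μ b z - heatSmooth ν b z| ≤ (η + 4 * Real.exp (-b * W ^ 2 / 2)) / b := by
  have key : ‖(((2 * Real.pi) ^ 2 * (heatSmooth μ b z - heatSmooth ν b z) : ℝ) : ℂ)‖
      ≤ ∫ w : ℂ, (η * Real.exp (-b * ‖w‖ ^ 2) +
        2 * Real.exp (-b * W ^ 2 / 2) * Real.exp (-(b / 2) * ‖w‖ ^ 2)) := by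
    rw [mul_sub, Complex.ofReal_sub, heatSmooth_eq_fourier μ hb, heatSmooth_eq_fourier ν hb,
      ← integral_sub (integrable_charFun_mul_exp μ hb z) (integrable_charFun_mul_exp ν hb z)]
    refine norm_integral_le_of_norm_le (((integrable_exp_neg_mul_norm_sq hb).const_mul _).add
      ((integrable_exp_neg_mul_norm_sq (half_pos hb)).const_mul _))
      (Eventually.of_forall fun w => ?_)
    rw [← sub_mul, norm_mul, norm_mul, ← Complex.ofReal_neg, Complex.norm_exp_ofReal_mul_I, one_mul,
      Complex.norm_real, Real.norm_of_nonneg (Real.exp_pos _).le]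
    rcases le_or_gt ‖w‖ W with hw | hw
    · have := mul_le_mul_of_nonneg_right (h w hw) (Real.exp_pos (-b * ‖w‖ ^ 2)).le
      have h3 : 0 ≤ 2 * Real.exp (-b * W ^ 2 / 2) * Real.exp (-(b / 2) * ‖w‖ ^ 2) := by positivity
      linarith
    · have h2 : ‖charFun μ w - charFun ν w‖ ≤ 2 := by
        have h1 := norm_charFun_le_one (μ := μ) w
        have h2 := norm_charFun_le_one (μ := ν) w
        linarith [norm_sub_le (charFun μ w) (charFun ν w)]
      have h3 : 0 ≤ η * Real.exp (-b * ‖w‖ ^ 2) := by positivity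
      have h4 : Real.exp (-b * ‖w‖ ^ 2)
          ≤ Real.exp (-b * W ^ 2 / 2) * Real.exp (-(b / 2) * ‖w‖ ^ 2) := by
        rw [← Real.exp_add]
        refine Real.exp_le_exp.2 ?_
        have h1 : W ^ 2 ≤ ‖w‖ ^ 2 := pow_le_pow_left₀ hW hw.le 2
        nlinarith
      have := mul_le_mul h2 h4 (Real.exp_pos _).le (by norm_num)
      linarith
  rw [integral_add ((integrable_exp_neg_mul_norm_sq hb).const_mul _)
      ((integrable_exp_neg_mul_norm_sq (half_pos hb)).const_mul _), integral_const_mul,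
      integral_const_mul, integral_exp_neg_mul_norm_sq hb,
      integral_exp_neg_mul_norm_sq (half_pos hb), Complex.norm_real, Real.norm_eq_abs, abs_mul,
      abs_of_nonneg (by positivity : (0 : ℝ) ≤ (2 * Real.pi) ^ 2)] at key
  have hpi := Real.pi_gt_three
  rw [le_div_iff₀ hb]
  have e : η * (Real.pi / b) + 2 * Real.exp (-b * W ^ 2 / 2) * (Real.pi / (b / 2))
      = Real.pi * (η + 4 * Real.exp (-b * W ^ 2 / 2)) / b := by field_simp; ring
  rw [e, le_div_iff₀ hb] at key
  have hnn : 0 ≤ |heatSmooth μ b z - heatSmooth ν b z| * b := by positivity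
  have h5 : Real.pi * (|heatSmooth μ b z - heatSmooth ν b z| * b)
      ≤ Real.pi * (η + 4 * Real.exp (-b * W ^ 2 / 2)) := by
    refine le_trans ?_ key
    rw [mul_assoc]
    refine mul_le_mul_of_nonneg_right ?_ hnn
    nlinarith
  exact le_of_mul_le_mul_left h5 Real.pi_pos

lemma integrable_heatKernel_sub (b : ℝ) (hb : 0 < b) (x : ℂ) :
    Integrable (fun z => heatKernel b (z - x)) :=
  (integrable_heatKernel hb).comp_sub_right x

lemma setIntegral_heatSmooth (μ : Measure ℂ) [IsProbabilityMeasure μ] {b : ℝ} (hb : 0 < b)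
    {A : Set ℂ} (hA' : volume A ≠ ⊤) :
    ∫ z in A, heatSmooth μ b z = ∫ x, (∫ z in A, heatKernel b (z - x)) ∂μ := by
  have : IsFiniteMeasure (volume.restrict A) := ⟨by simpa using hA'.lt_top⟩
  unfold heatSmooth
  rw [integral_integral_swap]
  have hc : Continuous (fun p : ℂ × ℂ => heatKernel b (p.1 - p.2)) := by fun_prop
  refine Integrable.mono' (integrable_const ((4 * Real.pi * b)⁻¹)) hc.aestronglyMeasurable
    (Eventually.of_forall fun p => ?_)
  simp only [Function.uncurry]
  rw [Real.norm_of_nonneg (heatKernel_nonneg hb _)]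
  exact heatKernel_le hb _

lemma setIntegral_heatKernel_sub_le_one {b : ℝ} (hb : 0 < b) (A : Set ℂ) (x : ℂ) :
    ∫ z in A, heatKernel b (z - x) ≤ 1 := by
  refine (setIntegral_le_integral (integrable_heatKernel_sub b hb x)
    (Eventually.of_forall fun z => heatKernel_nonneg hb _)).trans ?_
  rw [integral_sub_right_eq_self (μ := volume) (heatKernel b), integral_heatKernel hb]

lemma setIntegral_heatKernel_sub_le {b r : ℝ} (hb : 0 < b) (hr : 0 ≤ r) {A : Set ℂ}
    (hA : MeasurableSet A) (x : ℂ) (h : ∀ z ∈ A, r < ‖z - x‖) :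
    ∫ z in A, heatKernel b (z - x) ≤ 2 * Real.exp (-r ^ 2 / (8 * b)) := by
  refine le_trans ?_ (heatKernel_tail hb hr)
  have hm : MeasurableSet {z : ℂ | r < ‖z‖} := measurableSet_lt measurable_const measurable_norm
  rw [← integral_indicator hm, ← integral_indicator hA,
    ← integral_sub_right_eq_self ({z : ℂ | r < ‖z‖}.indicator (heatKernel b)) x]
  refine integral_mono ((integrable_heatKernel_sub b hb x).indicator hA)
    (((integrable_heatKernel hb).indicator hm).comp_sub_right x) fun z => ?_
  by_cases hz : z ∈ A
  · rw [indicator_of_mem hz, indicator_of_mem (show z - x ∈ {z : ℂ | r < ‖z‖} from h z hz)]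
  · rw [indicator_of_notMem hz]
    exact indicator_nonneg (fun _ _ => heatKernel_nonneg hb _) _

lemma measurable_setIntegral_heatKernel_sub (b : ℝ) (A : Set ℂ) (hA' : volume A ≠ ⊤) :
    Measurable fun x => ∫ z in A, heatKernel b (z - x) := by
  have : IsFiniteMeasure (volume.restrict A) := ⟨by simpa using hA'.lt_top⟩
  refine StronglyMeasurable.measurable (StronglyMeasurable.integral_prod_right
    (f := fun x z => heatKernel b (z - x)) ?_)
  have hc : Continuous (fun p : ℂ × ℂ => heatKernel b (p.2 - p.1)) := by fun_prop
  exact hc.stronglyMeasurable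

/-- Heat started at a point of A stays in the r-neighbourhood B up to the Gaussian tail, so
smoothing loses no more mass than that. -/
lemma measureReal_le_setIntegral_heatSmooth (μ : Measure ℂ) [IsProbabilityMeasure μ] {b r : ℝ}
    (hb : 0 < b) (hr : 0 ≤ r) {A B : Set ℂ} (hA : MeasurableSet A) (hB : MeasurableSet B)
    (hB' : volume B ≠ ⊤) (h : ∀ x ∈ A, ∀ z, ‖z - x‖ ≤ r → z ∈ B) :
    μ.real A ≤ (∫ z in B, heatSmooth μ b z) + 2 * Real.exp (-r ^ 2 / (8 * b)) := by
  rw [setIntegral_heatSmooth μ hb hB', ← integral_indicator_one hA, ← sub_le_iff_le_add]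
  have hc : ∫ _x : ℂ, 2 * Real.exp (-r ^ 2 / (8 * b)) ∂μ = 2 * Real.exp (-r ^ 2 / (8 * b)) := by
    simp
  have hind : Integrable (A.indicator (1 : ℂ → ℝ)) μ := (integrable_const (1 : ℝ)).indicator hA
  rw [← hc, ← integral_sub hind (integrable_const _)]
  refine integral_mono (f := fun x => A.indicator (1 : ℂ → ℝ) x - 2 * Real.exp (-r ^ 2 / (8 * b)))
    (hind.sub (integrable_const _)) ?_ fun x => ?_
  · refine (integrable_const (1 : ℝ)).mono'
      (measurable_setIntegral_heatKernel_sub b B hB').aestronglyMeasurable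
      (Eventually.of_forall fun x => ?_)
    rw [Real.norm_of_nonneg (setIntegral_nonneg hB fun z _ => heatKernel_nonneg hb _)]
    exact setIntegral_heatKernel_sub_le_one hb B x
  · by_cases hx : x ∈ A
    · simp only [indicator_of_mem hx, Pi.one_apply]
      have h1 := setIntegral_heatKernel_sub_le hb hr hB.compl x (fun z hz => by
        by_contra hcon
        exact hz (h x hx z (not_lt.1 hcon)))
      have h2 := integral_add_compl hB (integrable_heatKernel_sub b hb x)
      rw [integral_sub_right_eq_self (μ := volume) (heatKernel b), integral_heatKernel hb] at h2
      linarith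
    · simp only [indicator_of_notMem hx]
      have := setIntegral_nonneg (μ := volume) hB fun z _ => heatKernel_nonneg hb (z - x)
      have h3 := Real.exp_pos (-r ^ 2 / (8 * b))
      linarith

/-- The companion upper bound: heat found in A can have started outside B only by travelling farther
than r. -/
lemma setIntegral_heatSmooth_le_measureReal (μ : Measure ℂ) [IsProbabilityMeasure μ] {b r : ℝ}
    (hb : 0 < b) (hr : 0 ≤ r) {A B : Set ℂ} (hA : MeasurableSet A) (hB : MeasurableSet B)
    (hA' : volume A ≠ ⊤) (h : ∀ x ∈ A, ∀ z, ‖z - x‖ ≤ r → z ∈ B) :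
    ∫ z in A, heatSmooth μ b z ≤ μ.real B + 2 * Real.exp (-r ^ 2 / (8 * b)) := by
  rw [setIntegral_heatSmooth μ hb hA', ← integral_indicator_one hB]
  have hc : ∫ _x : ℂ, 2 * Real.exp (-r ^ 2 / (8 * b)) ∂μ = 2 * Real.exp (-r ^ 2 / (8 * b)) := by
    simp
  have hind : Integrable (B.indicator (1 : ℂ → ℝ)) μ := (integrable_const (1 : ℝ)).indicator hB
  rw [← hc, ← integral_add hind (integrable_const _)]
  refine integral_mono (g := fun x => B.indicator (1 : ℂ → ℝ) x + 2 * Real.exp (-r ^ 2 / (8 * b)))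
    ?_ (hind.add (integrable_const _)) fun x => ?_
  · refine (integrable_const (1 : ℝ)).mono'
      (measurable_setIntegral_heatKernel_sub b A hA').aestronglyMeasurable
      (Eventually.of_forall fun x => ?_)
    rw [Real.norm_of_nonneg (setIntegral_nonneg hA fun z _ => heatKernel_nonneg hb _)]
    exact setIntegral_heatKernel_sub_le_one hb A x
  · have h3 := Real.exp_pos (-r ^ 2 / (8 * b))
    by_cases hx : x ∈ B
    · simp only [indicator_of_mem hx, Pi.one_apply]
      have := setIntegral_heatKernel_sub_le_one hb A x
      linarith
    · simp only [indicator_of_notMem hx]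
      have := setIntegral_heatKernel_sub_le hb hr hA x (fun z hz => by
        by_contra hcon
        refine hx (h z hz x ?_)
        rw [norm_sub_rev]; exact not_lt.1 hcon)
      linarith

/-! ### A uniform random phase and the Bessel function J₀ -/

/-- The uniform probability measure on the angles `(0, 2π]`. -/
def unifAngle : Measure ℝ :=
  ENNReal.ofReal (2 * Real.pi)⁻¹ • volume.restrict (Ioc 0 (2 * Real.pi))

instance : IsProbabilityMeasure unifAngle := by
  constructor
  rw [unifAngle, Measure.smul_apply, Measure.restrict_apply_univ, Real.volume_Ioc, sub_zero,
    smul_eq_mul, ← ENNReal.ofReal_mul (by positivity), inv_mul_cancel₀ (by positivity)]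
  simp

lemma integral_unifAngle {E : Type*} [NormedAddCommGroup E] [NormedSpace ℝ E] (f : ℝ → E) :
    ∫ θ, f θ ∂unifAngle = (2 * Real.pi)⁻¹ • ∫ θ in (0)..(2 * Real.pi), f θ := by
  rw [unifAngle, integral_smul_measure, ENNReal.toReal_ofReal (by positivity),
    intervalIntegral.integral_of_le (by positivity)]

lemma integral_unifAngle_add {E : Type*} [NormedAddCommGroup E] [NormedSpace ℝ E] {f : ℝ → E}
    (hf : Function.Periodic f (2 * Real.pi)) (a : ℝ) :
    ∫ θ, f (θ + a) ∂unifAngle = ∫ θ, f θ ∂unifAngle := by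
  rw [integral_unifAngle, integral_unifAngle, intervalIntegral.integral_comp_add_right]
  congr 1
  have := hf.intervalIntegral_add_eq (0 + a) 0
  rw [zero_add (2 * Real.pi)] at this
  rw [← this]
  congr 1
  ring

lemma integrable_unifAngle {E : Type*} [NormedAddCommGroup E]
    {f : ℝ → E} (hf : Continuous f) : Integrable f unifAngle := by
  unfold unifAngle
  refine Integrable.smul_measure ?_ ENNReal.ofReal_ne_top
  exact (hf.integrableOn_Icc).mono_set Ioc_subset_Icc_self

lemma integral_unifAngle_cexp (m : ℤ) :
    ∫ θ, Complex.exp (m * θ * Complex.I) ∂unifAngle = if m = 0 then 1 else 0 := by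
  split_ifs with h
  · simp [h]
  · rw [integral_unifAngle]
    have hc : (m * Complex.I : ℂ) ≠ 0 := by simp [h]
    have : ∀ θ : ℝ, Complex.exp (m * θ * Complex.I) = Complex.exp (m * Complex.I * θ) := by
      intro θ; congr 1; ring
    simp only [this]
    rw [integral_exp_mul_complex hc]
    have h1 : Complex.exp (m * Complex.I * ((2 * Real.pi : ℝ) : ℂ)) = 1 := by
      rw [← Complex.exp_int_mul_two_pi_mul_I m]; congr 1; push_cast; ring
    rw [h1]; simp

/-- The characteristic function (in the modulus) of the uniform distribution on the unit circle:
the Bessel function `J₀`. -/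
def circleChar (r : ℝ) : ℝ := ∫ θ, Real.cos (r * Real.cos θ) ∂unifAngle

lemma abs_circleChar_le_one (r : ℝ) : |circleChar r| ≤ 1 := by
  have := norm_integral_le_of_norm_le_const (μ := unifAngle)
    (f := fun θ => Real.cos (r * Real.cos θ)) (C := 1)
    (Eventually.of_forall fun θ => Real.abs_cos_le_one _)
  simpa [circleChar] using this

/-- Quadratic smallness at 0 is what makes the infinite product converge under ∑ rₙ² < ∞. -/
lemma abs_one_sub_circleChar_le (r : ℝ) : |1 - circleChar r| ≤ r ^ 2 / 2 := by
  have h1 : (1 : ℝ) - circleChar r = ∫ θ, (1 - Real.cos (r * Real.cos θ)) ∂unifAngle := by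
    rw [integral_sub (integrable_const _) (integrable_unifAngle (by fun_prop))]
    simp [circleChar]
  rw [h1]
  have := norm_integral_le_of_norm_le_const (μ := unifAngle)
    (f := fun θ => 1 - Real.cos (r * Real.cos θ)) (C := r ^ 2 / 2)
    (Eventually.of_forall fun θ => by
      rw [Real.norm_of_nonneg (by linarith [Real.cos_le_one (r * Real.cos θ)])]
      have h2 := Real.one_sub_sq_div_two_le_cos (x := r * Real.cos θ)
      have h3 : (r * Real.cos θ) ^ 2 ≤ r ^ 2 := by
        rw [mul_pow]
        exact mul_le_of_le_one_right (sq_nonneg _) (Real.cos_sq_le_one θ)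
      linarith)
  simpa using this

lemma re_mul_exp (c : ℂ) (θ : ℝ) :
    (c * Complex.exp (θ * Complex.I)).re = ‖c‖ * Real.cos (θ + c.arg) := by
  conv_lhs => rw [← Complex.norm_mul_exp_arg_mul_I c]
  rw [mul_assoc, ← Complex.exp_add, Complex.re_ofReal_mul, ← add_mul, ← Complex.ofReal_add,
    Complex.exp_ofReal_mul_I_re, add_comm]

lemma integral_cexp_re_mul_exp (c : ℂ) :
    ∫ θ : ℝ, Complex.exp ((c * Complex.exp (θ * Complex.I)).re * Complex.I) ∂unifAngle
      = circleChar ‖c‖ := by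
  simp only [re_mul_exp]
  have hp : Function.Periodic
      (fun θ : ℝ => Complex.exp (((‖c‖ * Real.cos θ : ℝ) : ℂ) * Complex.I)) (2 * Real.pi) := by
    intro θ; simp only [Real.cos_add_two_pi]
  rw [integral_unifAngle_add hp]
  have h1 : ∀ θ : ℝ, Complex.exp (((‖c‖ * Real.cos θ : ℝ) : ℂ) * Complex.I)
      = ((Real.cos (‖c‖ * Real.cos θ) : ℝ) : ℂ)
        + ((Real.sin (‖c‖ * Real.cos θ) : ℝ) : ℂ) * Complex.I := by
    intro θ; rw [Complex.exp_mul_I]; push_cast; rfl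
  simp only [h1]
  rw [integral_add, integral_mul_const, integral_complex_ofReal, integral_complex_ofReal]
  · have h2 : ∫ θ : ℝ, Real.sin (‖c‖ * Real.cos θ) ∂unifAngle = 0 := by
      have h3 := integral_unifAngle_add (f := fun θ : ℝ => Real.sin (‖c‖ * Real.cos θ))
        (fun θ => by simp only [Real.cos_add_two_pi]) Real.pi
      simp only [Real.cos_add_pi, mul_neg, Real.sin_neg, integral_neg] at h3
      linarith
    rw [h2]; simp [circleChar]
  · exact integrable_unifAngle (by fun_prop)
  · exact integrable_unifAngle (by fun_prop)

/-- Averaging over θ and θ + π turns exp into cosh, and cosh y ≤ exp(y²/2): a uniform phase is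
sub-Gaussian. -/
lemma integral_exp_re_mul_exp_le (c : ℂ) :
    ∫ θ : ℝ, Real.exp ((c * Complex.exp (θ * Complex.I)).re) ∂unifAngle
      ≤ Real.exp (‖c‖ ^ 2 / 2) := by
  simp only [re_mul_exp]
  have hp : Function.Periodic
      (fun θ : ℝ => Real.exp (‖c‖ * Real.cos θ)) (2 * Real.pi) := by
    intro θ; simp only [Real.cos_add_two_pi]
  rw [integral_unifAngle_add hp]
  have h3 := integral_unifAngle_add hp Real.pi
  have h4 : ∫ θ : ℝ, Real.cosh (‖c‖ * Real.cos θ) ∂unifAngle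
      = ∫ θ : ℝ, Real.exp (‖c‖ * Real.cos θ) ∂unifAngle := by
    simp only [Real.cosh_eq]
    rw [integral_div, integral_add (integrable_unifAngle (by fun_prop))
      (integrable_unifAngle (by fun_prop))]
    simp only [Real.cos_add_pi, mul_neg] at h3
    rw [h3]; ring
  rw [← h4]
  have h5 : ∫ _θ : ℝ, Real.exp (‖c‖ ^ 2 / 2) ∂unifAngle = Real.exp (‖c‖ ^ 2 / 2) := by simp
  rw [← h5]
  refine integral_mono (integrable_unifAngle (by fun_prop)) (integrable_const _) fun θ => ?_
  refine (Real.cosh_le_exp_half_sq _).trans (Real.exp_le_exp.2 ?_)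
  have : (‖c‖ * Real.cos θ) ^ 2 ≤ ‖c‖ ^ 2 := by
    rw [mul_pow]
    exact mul_le_of_le_one_right (sq_nonneg _) (Real.cos_sq_le_one θ)
  linarith

/-- Integration by parts away from the stationary points 0 and π of the phase r cos θ. The
derivative of -sin(r cos θ)/(r sin θ) is cos(r cos θ) plus the term `h`, which is dominated by 1/(r
sin²θ), the derivative of -cot θ / r. -/
lemma abs_integral_cos_mul_cos_le {r κ : ℝ} (hr : 0 < r) (hκ : 0 < κ) (hκ' : κ ≤ Real.pi / 2) :
    |∫ θ in κ..(Real.pi - κ), Real.cos (r * Real.cos θ)| ≤ 4 / (r * Real.sin κ) := by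
  have hle : κ ≤ Real.pi - κ := by linarith
  have hpos : ∀ θ ∈ Icc κ (Real.pi - κ), 0 < Real.sin θ := fun θ hθ =>
    Real.sin_pos_of_pos_of_lt_pi (by linarith [hθ.1]) (by linarith [hθ.2])
  have hsκ : 0 < Real.sin κ := hpos κ ⟨le_rfl, hle⟩
  have hu : uIcc κ (Real.pi - κ) = Icc κ (Real.pi - κ) := uIcc_of_le hle
  set h : ℝ → ℝ := fun θ => Real.sin (r * Real.cos θ) * Real.cos θ / (r * Real.sin θ ^ 2) with hh
  have hcont : ContinuousOn h (Icc κ (Real.pi - κ)) := by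
    refine ContinuousOn.div (by fun_prop) (by fun_prop) fun θ hθ => ?_
    have := hpos θ hθ
    positivity
  have hcont2 : ContinuousOn (fun θ => 1 / (r * Real.sin θ ^ 2)) (Icc κ (Real.pi - κ)) := by
    refine ContinuousOn.div (by fun_prop) (by fun_prop) fun θ hθ => ?_
    have := hpos θ hθ
    positivity
  have hint : IntervalIntegrable h volume κ (Real.pi - κ) :=
    (hu ▸ hcont : ContinuousOn h (uIcc κ (Real.pi - κ))).intervalIntegrable
  have hint2 : IntervalIntegrable (fun θ => 1 / (r * Real.sin θ ^ 2)) volume κ (Real.pi - κ) :=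
    ContinuousOn.intervalIntegrable (by rw [hu]; exact hcont2)
  have hint3 : IntervalIntegrable (fun θ => Real.cos (r * Real.cos θ)) volume κ (Real.pi - κ) :=
    Continuous.intervalIntegrable (by fun_prop) _ _
  have h1 : ∫ θ in κ..(Real.pi - κ), (Real.cos (r * Real.cos θ) + h θ)
      = -(Real.sin (r * Real.cos (Real.pi - κ)) / (r * Real.sin (Real.pi - κ)))
        - -(Real.sin (r * Real.cos κ) / (r * Real.sin κ)) := by
    refine intervalIntegral.integral_eq_sub_of_hasDerivAt
      (f := fun θ => -(Real.sin (r * Real.cos θ) / (r * Real.sin θ))) (fun θ hθ => ?_)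
      (hint3.add hint)
    rw [hu] at hθ
    have hs := hpos θ hθ
    have hd := ((((Real.hasDerivAt_cos θ).const_mul r).sin).div
      ((Real.hasDerivAt_sin θ).const_mul r) (by positivity)).neg
    refine hd.congr_deriv ?_
    simp only [hh]
    field_simp
    ring
  have h2 : ∫ θ in κ..(Real.pi - κ), 1 / (r * Real.sin θ ^ 2)
      = -(Real.cos (Real.pi - κ) / (r * Real.sin (Real.pi - κ)))
        - -(Real.cos κ / (r * Real.sin κ)) := by
    refine intervalIntegral.integral_eq_sub_of_hasDerivAt
      (f := fun θ => -(Real.cos θ / (r * Real.sin θ))) (fun θ hθ => ?_) hint2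
    rw [hu] at hθ
    have hs := hpos θ hθ
    have hd := ((Real.hasDerivAt_cos θ).div
      ((Real.hasDerivAt_sin θ).const_mul r) (by positivity)).neg
    refine hd.congr_deriv ?_
    field_simp
    linarith [Real.sin_sq_add_cos_sq θ]
  rw [intervalIntegral.integral_add hint3 hint] at h1
  rw [Real.cos_pi_sub, Real.sin_pi_sub] at h1 h2
  have h3 : |∫ θ in κ..(Real.pi - κ), h θ| ≤ 2 / (r * Real.sin κ) := by
    have h4 : ‖∫ θ in κ..(Real.pi - κ), h θ‖ ≤ ∫ θ in κ..(Real.pi - κ), 1 / (r * Real.sin θ ^ 2) := by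
      refine intervalIntegral.norm_integral_le_of_norm_le hle
        (Eventually.of_forall fun θ hθ => ?_) hint2
      have hs := hpos θ (Ioc_subset_Icc_self hθ)
      rw [hh, Real.norm_eq_abs, abs_div, abs_mul, abs_of_pos (by positivity : 0 < r * Real.sin θ ^ 2)]
      refine div_le_div_of_nonneg_right ?_ (by positivity)
      exact mul_le_one₀ (Real.abs_sin_le_one _) (abs_nonneg _) (Real.abs_cos_le_one _)
    rw [h2] at h4
    refine h4.trans ?_
    have : -(-Real.cos κ / (r * Real.sin κ)) - -(Real.cos κ / (r * Real.sin κ))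
        = 2 * Real.cos κ / (r * Real.sin κ) := by ring
    rw [this]
    refine div_le_div_of_nonneg_right ?_ (by positivity)
    linarith [Real.cos_le_one κ]
  have h5 : ∀ y : ℝ, |Real.sin y / (r * Real.sin κ)| ≤ 1 / (r * Real.sin κ) := fun y => by
    rw [abs_div, abs_of_pos (by positivity : 0 < r * Real.sin κ)]
    exact div_le_div_of_nonneg_right (Real.abs_sin_le_one _) (by positivity)
  have h6 := abs_le.1 (h5 (r * -Real.cos κ))
  have h7 := abs_le.1 (h5 (r * Real.cos κ))
  have h8 := abs_le.1 h3
  have e1 : 4 / (r * Real.sin κ) = 4 * (1 / (r * Real.sin κ)) := by ring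
  have e2 : 2 / (r * Real.sin κ) = 2 * (1 / (r * Real.sin κ)) := by ring
  rw [e2] at h8
  rw [e1, abs_le]
  constructor <;> linarith [h6.1, h6.2, h7.1, h7.2, h8.1, h8.2]

lemma abs_circleChar_le {r : ℝ} (hr : 0 < r) : |circleChar r| ≤ 3 / Real.sqrt r := by
  have hsr : 0 < Real.sqrt r := Real.sqrt_pos.2 hr
  rcases le_or_gt r 1 with h1 | h1
  · refine (abs_circleChar_le_one r).trans ?_
    rw [le_div_iff₀ hsr]
    have : Real.sqrt r ≤ 1 := Real.sqrt_le_one.2 h1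
    linarith
  have hpi := Real.pi_gt_three
  -- Arcs of length r^(-1/2) around the stationary points balance the trivial bound there against
  -- the bound for the middle range, since r κ² = 1.
  set κ := 1 / Real.sqrt r with hκ
  have hκ0 : 0 < κ := by positivity
  have hs1 : 1 < Real.sqrt r := by rw [Real.lt_sqrt (by norm_num)]; simpa
  have hκ1 : κ ≤ 1 := by rw [hκ, div_le_one hsr]; exact hs1.le
  have hii : ∀ a b : ℝ, IntervalIntegrable (fun θ => Real.cos (r * Real.cos θ)) volume a b :=
    fun a b => Continuous.intervalIntegrable (by fun_prop) _ _
  have hsmall : ∀ a b : ℝ, |∫ θ in a..b, Real.cos (r * Real.cos θ)| ≤ |b - a| := by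
    intro a b
    have := intervalIntegral.norm_integral_le_of_norm_le_const (a := a) (b := b)
      (f := fun θ => Real.cos (r * Real.cos θ)) (C := 1) (fun θ _ => Real.abs_cos_le_one _)
    simpa using this
  have e1 : ∫ θ in (0)..(2 * Real.pi), Real.cos (r * Real.cos θ)
      = 2 * ∫ θ in (0)..Real.pi, Real.cos (r * Real.cos θ) := by
    rw [← intervalIntegral.integral_add_adjacent_intervals (hii 0 Real.pi) (hii Real.pi _), two_mul]
    have := intervalIntegral.integral_comp_add_right (a := 0) (b := Real.pi)
      (fun θ => Real.cos (r * Real.cos θ)) Real.pi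
    simp only [Real.cos_add_pi, mul_neg, Real.cos_neg, zero_add] at this
    rw [this, two_mul]
  have e2 : ∫ θ in (0)..Real.pi, Real.cos (r * Real.cos θ)
      = (∫ θ in (0)..κ, Real.cos (r * Real.cos θ))
        + (∫ θ in κ..(Real.pi - κ), Real.cos (r * Real.cos θ))
        + ∫ θ in (Real.pi - κ)..Real.pi, Real.cos (r * Real.cos θ) := by
    rw [intervalIntegral.integral_add_adjacent_intervals (hii _ _) (hii _ _),
      intervalIntegral.integral_add_adjacent_intervals (hii _ _) (hii _ _)]
  have b1 := abs_le.1 (hsmall 0 κ)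
  have b3 := abs_le.1 (hsmall (Real.pi - κ) Real.pi)
  have b2 : |∫ θ in κ..(Real.pi - κ), Real.cos (r * Real.cos θ)| ≤ 2 * Real.pi * κ := by
    refine (abs_integral_cos_mul_cos_le hr hκ0 (by linarith)).trans ?_
    have hs := Real.mul_le_sin hκ0.le (by linarith)
    have hrk : r * κ = Real.sqrt r := by
      rw [hκ]; field_simp; rw [Real.sq_sqrt hr.le]
    have hkk : κ * Real.sqrt r = 1 := by rw [hκ]; field_simp
    have h0 : 0 < Real.sin κ := lt_of_lt_of_le (by positivity) hs
    rw [div_le_iff₀ (by positivity)]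
    have h2 : 2 * Real.pi * κ * (r * (2 / Real.pi * κ)) = 4 * (κ * Real.sqrt r) := by
      rw [← hrk]; field_simp; ring
    have h3 : 2 * Real.pi * κ * (r * (2 / Real.pi * κ)) ≤ 2 * Real.pi * κ * (r * Real.sin κ) := by
      gcongr
    rw [h2, hkk] at h3
    linarith
  have b2' := abs_le.1 b2
  rw [sub_zero, abs_of_pos hκ0] at b1
  rw [sub_sub_cancel, abs_of_pos hκ0] at b3
  have e3 : circleChar r = (2 * Real.pi)⁻¹ * (2 * ∫ θ in (0)..Real.pi, Real.cos (r * Real.cos θ)) := by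
    rw [circleChar, integral_unifAngle, e1, smul_eq_mul]
  have b4 : |∫ θ in (0)..Real.pi, Real.cos (r * Real.cos θ)| ≤ 3 * Real.pi * κ := by
    rw [e2, abs_le]
    constructor <;> nlinarith [b1.1, b1.2, b2'.1, b2'.2, b3.1, b3.2]
  rw [e3, abs_mul, abs_mul, abs_of_pos (by positivity : (0 : ℝ) < (2 * Real.pi)⁻¹), abs_two]
  have e4 : 3 / Real.sqrt r = (2 * Real.pi)⁻¹ * (2 * (3 * Real.pi * κ)) := by
    rw [hκ]; field_simp
  rw [e4]
  gcongr

/-! ### Trigonometric sums on the torus -/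

/-- The uniform probability measure on the `K`-dimensional torus of angles. -/
abbrev unifTorus (K : ℕ) : Measure (Fin K → ℝ) := Measure.pi fun _ => unifAngle

lemma integral_unifTorus_character {K : ℕ} (m : Fin K → ℤ) :
    ∫ θ, Complex.exp ((∑ n, (m n : ℂ) * (θ n : ℂ)) * Complex.I) ∂unifTorus K
      = if m = 0 then 1 else 0 := by
  have h1 : ∀ θ : Fin K → ℝ, Complex.exp ((∑ n, (m n : ℂ) * (θ n : ℂ)) * Complex.I)
      = ∏ n, Complex.exp (m n * θ n * Complex.I) := by
    intro θ; rw [Finset.sum_mul, Complex.exp_sum]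
  simp only [h1]
  rw [integral_fintype_prod_eq_prod (fun n (x : ℝ) => Complex.exp (m n * x * Complex.I))]
  simp only [integral_unifAngle_cexp]
  split_ifs with h
  · simp [h]
  · obtain ⟨n, hn⟩ := Function.ne_iff.1 h
    exact Finset.prod_eq_zero (Finset.mem_univ n) (by simpa using hn)

/-- The real random trigonometric sum `∑ Re (cₙ e^{iθₙ})`. -/
def torusSum {K : ℕ} (c : Fin K → ℂ) (θ : Fin K → ℝ) : ℝ :=
  ∑ n, (c n * Complex.exp (θ n * Complex.I)).re

@[fun_prop]
lemma continuous_torusSum {K : ℕ} (c : Fin K → ℂ) : Continuous (torusSum c) := by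
  unfold torusSum
  refine continuous_finsetSum _ fun n _ => Complex.continuous_re.comp ?_
  fun_prop

lemma integral_cexp_torusSum {K : ℕ} (c : Fin K → ℂ) :
    ∫ θ, Complex.exp (torusSum c θ * Complex.I) ∂unifTorus K = ∏ n, (circleChar ‖c n‖ : ℂ) := by
  have h1 : ∀ θ : Fin K → ℝ, Complex.exp (torusSum c θ * Complex.I)
      = ∏ n, Complex.exp ((c n * Complex.exp (θ n * Complex.I)).re * Complex.I) := by
    intro θ; rw [torusSum, Complex.ofReal_sum, Finset.sum_mul, Complex.exp_sum]
  simp only [h1]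
  rw [integral_fintype_prod_eq_prod
    (fun n (x : ℝ) => Complex.exp ((c n * Complex.exp (x * Complex.I)).re * Complex.I))]
  simp only [integral_cexp_re_mul_exp]

lemma integral_exp_torusSum_le {K : ℕ} (c : Fin K → ℂ) :
    ∫ θ, Real.exp (torusSum c θ) ∂unifTorus K ≤ Real.exp ((∑ n, ‖c n‖ ^ 2) / 2) := by
  have h1 : ∀ θ : Fin K → ℝ, Real.exp (torusSum c θ)
      = ∏ n, Real.exp ((c n * Complex.exp (θ n * Complex.I)).re) := by
    intro θ; rw [torusSum, Real.exp_sum]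
  simp only [h1]
  rw [integral_fintype_prod_eq_prod
    (fun n (x : ℝ) => Real.exp ((c n * Complex.exp (x * Complex.I)).re)), Finset.sum_div,
    Real.exp_sum]
  exact Finset.prod_le_prod (fun n _ => integral_nonneg fun _ => (Real.exp_pos _).le)
    fun n _ => integral_exp_re_mul_exp_le _

lemma abs_torusSum_le {K : ℕ} (c : Fin K → ℂ) (θ : Fin K → ℝ) : |torusSum c θ| ≤ ∑ n, ‖c n‖ := by
  unfold torusSum
  refine (Finset.abs_sum_le_sum_abs _ _).trans (Finset.sum_le_sum fun n _ => ?_)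
  refine (Complex.abs_re_le_norm _).trans ?_
  rw [norm_mul, Complex.norm_exp_ofReal_mul_I, mul_one]

lemma integrable_unifTorus {K : ℕ} {E : Type*} [NormedAddCommGroup E] {f : (Fin K → ℝ) → E}
    (hf : AEStronglyMeasurable f (unifTorus K)) {C : ℝ} (h : ∀ θ, ‖f θ‖ ≤ C) :
    Integrable f (unifTorus K) :=
  (integrable_const C).mono' hf (Eventually.of_forall h)

/-- Moments of a torus sum. -/
lemma integral_torusSum_pow_le {K : ℕ} (c : Fin K → ℂ) {N : ℕ} (hN : Even N) {u : ℝ} (hu : 0 < u) :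
    (∫ θ, torusSum c θ ^ N ∂unifTorus K) / N.factorial
      ≤ 2 * u⁻¹ ^ N * Real.exp (u ^ 2 * (∑ n, ‖c n‖ ^ 2) / 2) := by
  have hsm : ∀ (v : ℝ) θ, v * torusSum c θ = torusSum (fun n => (v : ℂ) * c n) θ := by
    intro v θ
    simp only [torusSum, Finset.mul_sum, mul_assoc, Complex.re_ofReal_mul]
  have hexp : ∀ v : ℝ, ∫ θ, Real.exp (v * torusSum c θ) ∂unifTorus K
      ≤ Real.exp (v ^ 2 * (∑ n, ‖c n‖ ^ 2) / 2) := by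
    intro v
    simp only [hsm]
    refine (integral_exp_torusSum_le _).trans (le_of_eq ?_)
    simp only [norm_mul, mul_pow, ← Finset.mul_sum, Complex.norm_real, Real.norm_eq_abs, sq_abs]
  have hi : ∀ v : ℝ, Integrable (fun θ => Real.exp (v * torusSum c θ)) (unifTorus K) := by
    intro v
    refine integrable_unifTorus (Continuous.aestronglyMeasurable (by fun_prop))
      (C := Real.exp (|v| * ∑ n, ‖c n‖)) fun θ => ?_
    rw [Real.norm_of_nonneg (Real.exp_pos _).le]
    refine Real.exp_le_exp.2 ((le_abs_self _).trans ?_)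
    rw [abs_mul]
    exact mul_le_mul_of_nonneg_left (abs_torusSum_le c θ) (abs_nonneg _)
  -- A single term of the exponential series bounds the power; u is a free parameter, so that the
  -- moments inherit the sub-Gaussian bound.
  have hpow : ∀ y : ℝ, y ^ N / N.factorial ≤ u⁻¹ ^ N * (Real.exp (u * y) + Real.exp (-u * y)) := by
    intro y
    have h1 := Real.pow_div_factorial_le_exp (x := |u * y|) (abs_nonneg _) N
    have h2 : Real.exp |u * y| ≤ Real.exp (u * y) + Real.exp (-u * y) := by
      rcases abs_cases (u * y) with ⟨h, _⟩ | ⟨h, _⟩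
      · rw [h]; linarith [Real.exp_pos (-u * y)]
      · rw [h, neg_mul]; linarith [Real.exp_pos (u * y)]
    rw [hN.pow_abs, mul_pow] at h1
    have h3 : y ^ N / N.factorial = u⁻¹ ^ N * (u ^ N * y ^ N / N.factorial) := by
      rw [inv_pow]; field_simp
    rw [h3]
    gcongr
    exact h1.trans h2
  rw [← integral_div]
  calc ∫ θ, torusSum c θ ^ N / N.factorial ∂unifTorus K
      ≤ ∫ θ, u⁻¹ ^ N * (Real.exp (u * torusSum c θ) + Real.exp (-u * torusSum c θ)) ∂unifTorus K := by
        refine integral_mono ?_ (((hi u).add (hi (-u))).const_mul _) fun θ => hpow _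
        refine Integrable.div_const (integrable_unifTorus
          (Continuous.aestronglyMeasurable (by fun_prop)) (C := (∑ n, ‖c n‖) ^ N) fun θ => ?_) _
        rw [norm_pow]
        exact pow_le_pow_left₀ (norm_nonneg _) (abs_torusSum_le c θ) N
    _ ≤ _ := by
        rw [integral_const_mul, integral_add (hi u) (hi (-u))]
        have h1 := hexp u
        have h2 := hexp (-u)
        rw [neg_sq] at h2
        have h3 : 0 < u⁻¹ ^ N := by positivity
        nlinarith

/-! ### Time averages and Taylor expansion of characteristic functions -/

/-- The uniform probability measure on the time interval `[0, T]`. -/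
def unifTime (T : ℝ) : Measure ℝ := (ENNReal.ofReal T)⁻¹ • volume.restrict (Icc 0 T)

lemma isProbabilityMeasure_unifTime {T : ℝ} (hT : 0 < T) : IsProbabilityMeasure (unifTime T) := by
  constructor
  rw [unifTime, Measure.smul_apply, Measure.restrict_apply_univ, Real.volume_Icc, sub_zero,
    smul_eq_mul]
  exact ENNReal.inv_mul_cancel (by simpa using hT) ENNReal.ofReal_ne_top

lemma integral_unifTime {E : Type*} [NormedAddCommGroup E] [NormedSpace ℝ E] {T : ℝ} (hT : 0 < T)
    (f : ℝ → E) : ∫ t, f t ∂unifTime T = T⁻¹ • ∫ t in (0)..T, f t := by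
  rw [unifTime, integral_smul_measure, ENNReal.toReal_inv, ENNReal.toReal_ofReal hT.le,
    intervalIntegral.integral_of_le hT.le, integral_Icc_eq_integral_Ioc]

lemma norm_integral_unifTime_cexp_le {T : ℝ} (hT : 0 < T) {x : ℝ} (hx : x ≠ 0) :
    ‖∫ t : ℝ, Complex.exp (x * t * Complex.I) ∂unifTime T‖ ≤ 2 / (T * |x|) := by
  rw [integral_unifTime hT]
  have hc : (x * Complex.I : ℂ) ≠ 0 := by simp [hx]
  have : ∀ t : ℝ, Complex.exp (x * t * Complex.I) = Complex.exp (x * Complex.I * t) := by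
    intro t; congr 1; ring
  simp only [this]
  rw [integral_exp_mul_complex hc, norm_smul, norm_div, Real.norm_of_nonneg (by positivity)]
  have h1 : ‖(x * Complex.I : ℂ)‖ = |x| := by simp
  have h2 : ∀ t : ℝ, ‖Complex.exp (x * Complex.I * t)‖ = 1 := by
    intro t
    rw [← this, ← Complex.ofReal_mul, Complex.norm_exp_ofReal_mul_I]
  have h3 := norm_sub_le (Complex.exp (x * Complex.I * (T : ℝ))) (Complex.exp (x * Complex.I * (0 : ℝ)))
  rw [h2, h2] at h3
  rw [h1]
  have hx' : 0 < |x| := abs_pos.2 hx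
  calc T⁻¹ * (_ / |x|) ≤ T⁻¹ * ((1 + 1) / |x|) := by gcongr
    _ = _ := by field_simp; norm_num

/-- The derivative of each Taylor remainder is c times the preceding one, so the bound integrates up
by induction. It is used with c = ±i, where no exponential factor is lost. -/
lemma norm_cexp_sub_sum_le {c : ℂ} (hc : c.re ≤ 0) (hc' : ‖c‖ ≤ 1) (N : ℕ) : ∀ {y : ℝ}, 0 ≤ y →
    ‖Complex.exp (c * y) - ∑ k ∈ Finset.range N, (c * y) ^ k / k.factorial‖
      ≤ y ^ N / N.factorial := by
  induction N with
  | zero =>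
    intro y hy
    simp only [Finset.range_zero, Finset.sum_empty, sub_zero, pow_zero, Nat.factorial_zero,
      Nat.cast_one, div_one, Complex.norm_exp, Real.exp_le_one_iff, Complex.re_mul_ofReal]
    exact mul_nonpos_of_nonpos_of_nonneg hc hy
  | succ N ih =>
    intro y hy
    have hder : ∀ x : ℝ, HasDerivAt (fun x : ℝ => Complex.exp (c * x)
        - ∑ k ∈ Finset.range (N + 1), (c * x) ^ k / k.factorial)
        (c * (Complex.exp (c * x) - ∑ k ∈ Finset.range N, (c * x) ^ k / k.factorial)) x := by
      intro x
      have h1 : HasDerivAt (fun x : ℝ => c * (x : ℂ)) c x := by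
        simpa using (Complex.ofRealCLM.hasDerivAt (x := x)).const_mul c
      have h2 : HasDerivAt (fun x : ℝ => ∑ k ∈ Finset.range (N + 1), (c * (x : ℂ)) ^ k / k.factorial)
          (∑ k ∈ Finset.range (N + 1), ((k : ℂ) * (c * x) ^ (k - 1) * c) / k.factorial) x :=
by
        refine HasDerivAt.fun_sum fun k _ => ?_
        exact (h1.pow k).div_const _
      refine (h1.cexp.sub h2).congr_deriv ?_
      rw [Finset.sum_range_succ']
      simp only [Nat.cast_zero, zero_mul, zero_div, add_zero, Nat.add_sub_cancel]
      rw [mul_sub, mul_comm (Complex.exp _) c, Finset.mul_sum, sub_right_inj]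
      refine Finset.sum_congr rfl fun k _ => ?_
      have hk : ((k + 1 : ℕ) : ℂ) ≠ 0 := by exact_mod_cast Nat.succ_ne_zero k
      have hk' : (k.factorial : ℂ) ≠ 0 := by exact_mod_cast k.factorial_ne_zero
      rw [Nat.factorial_succ, Nat.cast_mul]
      field_simp
    have hB : ∀ x : ℝ, HasDerivAt (fun x : ℝ => x ^ (N + 1) / (N + 1).factorial)
        (x ^ N / N.factorial) x := by
      intro x
      refine ((hasDerivAt_pow (N + 1) x).div_const _).congr_deriv ?_
      have hk' : (N.factorial : ℝ) ≠ 0 := by exact_mod_cast N.factorial_ne_zero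
      rw [Nat.factorial_succ, Nat.cast_mul]
      simp only [Nat.add_sub_cancel]
      field_simp
    refine image_norm_le_of_norm_deriv_right_le_deriv_boundary (a := 0) (b := y)
      (fun x _ => (hder x).continuousAt.continuousWithinAt)
      (fun x _ => (hder x).hasDerivWithinAt) ?_ hB (fun x hx => ?_) ⟨hy, le_rfl⟩
    · simp [Finset.sum_range_succ']
    · rw [norm_mul]
      exact (mul_le_of_le_one_left (norm_nonneg _) hc').trans (ih hx.1)

lemma norm_cexp_mul_I_sub_sum_le (N : ℕ) (y : ℝ) :
    ‖Complex.exp (y * Complex.I) - ∑ k ∈ Finset.range N, Complex.I ^ k / k.factorial * (y ^ k : ℝ)‖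
      ≤ |y| ^ N / N.factorial := by
  rcases le_total 0 y with h | h
  · have := norm_cexp_sub_sum_le (c := Complex.I) (by simp) (by simp) N h
    rw [abs_of_nonneg h, mul_comm (y : ℂ)]
    convert this using 5 with k
    push_cast; rw [mul_pow]; ring
  · have := norm_cexp_sub_sum_le (c := -Complex.I) (by simp) (by simp) N (neg_nonneg.2 h)
    have e : -Complex.I * ((-y : ℝ) : ℂ) = Complex.I * y := by push_cast; ring
    rw [e] at this
    rw [abs_of_nonpos h, mul_comm (y : ℂ)]
    convert this using 5 with k
    push_cast; rw [mul_pow]; ring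

/-- For even N the remainder is again a moment, so it can itself be transferred from one measure to
another. -/
lemma norm_integral_cexp_sub_moments_le {Ω : Type*} [MeasurableSpace Ω] (ρ : Measure Ω)
    [IsProbabilityMeasure ρ] {Y : Ω → ℝ} (hY : AEStronglyMeasurable Y ρ) {C : ℝ}
    (hC : ∀ x, |Y x| ≤ C) {N : ℕ} (hN : Even N) :
    ‖∫ x, Complex.exp (Y x * Complex.I) ∂ρ
      - ∑ k ∈ Finset.range N, Complex.I ^ k / k.factorial * ((∫ x, Y x ^ k ∂ρ : ℝ) : ℂ)‖
      ≤ (∫ x, Y x ^ N ∂ρ) / N.factorial := by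
  have hi : ∀ k : ℕ, Integrable (fun x => Y x ^ k) ρ := fun k =>
    (integrable_const (C ^ k)).mono' (hY.pow k) (Eventually.of_forall fun x => by
      rw [norm_pow]; exact pow_le_pow_left₀ (norm_nonneg _) (hC x) k)
  have hi' : ∀ k : ℕ, Integrable (fun x => Complex.I ^ k / k.factorial * ((Y x ^ k : ℝ) : ℂ)) ρ :=
    fun k => ((hi k).ofReal).const_mul _
  have he : Integrable (fun x => Complex.exp (Y x * Complex.I)) ρ := by
    refine (integrable_const (1 : ℝ)).mono' ?_ (Eventually.of_forall fun x => by
      rw [Complex.norm_exp_ofReal_mul_I])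
    exact (by fun_prop : Continuous fun y : ℝ => Complex.exp (y * Complex.I)).comp_aestronglyMeasurable hY
  have e1 : ∑ k ∈ Finset.range N, Complex.I ^ k / k.factorial * ((∫ x, Y x ^ k ∂ρ : ℝ) : ℂ)
      = ∫ x, ∑ k ∈ Finset.range N, Complex.I ^ k / k.factorial * ((Y x ^ k : ℝ) : ℂ) ∂ρ := by
    rw [integral_finsetSum _ fun k _ => hi' k]
    refine Finset.sum_congr rfl fun k _ => ?_
    rw [integral_const_mul, integral_complex_ofReal]
  rw [e1, ← integral_sub he (integrable_finsetSum _ fun k _ => hi' k), ← integral_div]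
  refine norm_integral_le_of_norm_le ((hi N).div_const _) (Eventually.of_forall fun x => ?_)
  have := norm_cexp_mul_I_sub_sum_le N (Y x)
  rwa [hN.pow_abs] at this

/-! ### Comparison of moments in time and on the torus -/

/-- The sign attached to a Boolean. -/
def boolSign (b : Bool) : ℤ := if b then 1 else -1

/-- The exponent vector of a product of coordinates and inverse coordinates on the torus. -/
def exponentVec {K k : ℕ} (q : Fin k → Fin K × Bool) (n : Fin K) : ℤ :=
  ∑ j, if (q j).1 = n then boolSign (q j).2 else 0

lemma sum_exponentVec_mul {K k : ℕ} (q : Fin k → Fin K × Bool) {R : Type*} [CommRing R]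
    (x : Fin K → R) :
    ∑ n, (exponentVec q n : R) * x n = ∑ j, (boolSign (q j).2 : R) * x (q j).1 := by
  simp only [exponentVec, Int.cast_sum, Finset.sum_mul]
  rw [Finset.sum_comm]
  refine Finset.sum_congr rfl fun j _ => ?_
  rw [Finset.sum_eq_single (q j).1]
  · simp
  · intro n _ hn; simp [Ne.symm hn]
  · simp

/-- Fourier coefficients of `torusSum`. -/
def torusCoeff {K : ℕ} (c : Fin K → ℂ) (p : Fin K × Bool) : ℂ :=
  if p.2 then c p.1 / 2 else starRingEnd ℂ (c p.1) / 2

lemma sum_norm_torusCoeff {K : ℕ} (c : Fin K → ℂ) : ∑ p, ‖torusCoeff c p‖ = ∑ n, ‖c n‖ := by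
  rw [Fintype.sum_prod_type]
  refine Finset.sum_congr rfl fun n _ => ?_
  simp [torusCoeff]

lemma torusSum_eq_sum {K : ℕ} (c : Fin K → ℂ) (θ : Fin K → ℝ) :
    (torusSum c θ : ℂ) = ∑ p : Fin K × Bool,
      torusCoeff c p * Complex.exp ((boolSign p.2 : ℂ) * θ p.1 * Complex.I) := by
  rw [Fintype.sum_prod_type, torusSum, Complex.ofReal_sum]
  refine Finset.sum_congr rfl fun n _ => ?_
  rw [Complex.re_eq_add_conj]
  simp only [torusCoeff, boolSign, Fintype.sum_bool, map_mul, ← Complex.exp_conj]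
  simp
  ring

lemma torusSum_pow_eq {K : ℕ} (c : Fin K → ℂ) (θ : Fin K → ℝ) (k : ℕ) :
    ((torusSum c θ ^ k : ℝ) : ℂ) = ∑ q : Fin k → Fin K × Bool, (∏ j, torusCoeff c (q j)) *
      Complex.exp ((∑ n, (exponentVec q n : ℂ) * (θ n : ℂ)) * Complex.I) := by
  push_cast
  rw [torusSum_eq_sum, Fintype.sum_pow]
  refine Finset.sum_congr rfl fun q _ => ?_
  rw [Finset.prod_mul_distrib, sum_exponentVec_mul, Finset.sum_mul, Complex.exp_sum]

/-- The k-th power expands into characters. A trivial character has mean 1 on both sides; a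
nontrivial one has mean 0 on the torus and time mean at most 2/(Tξ), its frequency being at least ξ.
The sum of the absolute coefficients is (∑ ‖cₙ‖)^k. -/
lemma abs_moment_sub_le {K : ℕ} (c : Fin K → ℂ) (f : Fin K → ℝ) {T ξ : ℝ} (hT : 0 < T) (hξ : 0 < ξ)
    {k : ℕ} (hsep : ∀ q : Fin k → Fin K × Bool, exponentVec q = 0 ∨
      ξ ≤ |∑ n, (exponentVec q n : ℝ) * f n|) :
    |∫ t, torusSum c (fun n => t * f n) ^ k ∂unifTime T - ∫ θ, torusSum c θ ^ k ∂unifTorus K|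
      ≤ 2 / (T * ξ) * (∑ n, ‖c n‖) ^ k := by
  have hP := isProbabilityMeasure_unifTime hT
  rw [← Real.norm_eq_abs, ← Complex.norm_real, Complex.ofReal_sub, ← integral_complex_ofReal,
    ← integral_complex_ofReal]
  simp only [torusSum_pow_eq]
  rw [integral_finsetSum, integral_finsetSum,
    ← Finset.sum_sub_distrib, ← sum_norm_torusCoeff, Fintype.sum_pow, Finset.mul_sum]
  · refine norm_sum_le_of_le _ fun q _ => ?_
    rw [integral_const_mul, integral_const_mul, ← mul_sub, norm_mul, norm_prod, mul_comm]
    refine mul_le_mul_of_nonneg_right ?_ (Finset.prod_nonneg fun _ _ => norm_nonneg _)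
    rw [integral_unifTorus_character]
    have he : ∀ t : ℝ, (∑ n, (exponentVec q n : ℂ) * ((t * f n : ℝ) : ℂ))
        = ((∑ n, (exponentVec q n : ℝ) * f n : ℝ) : ℂ) * t := by
      intro t; push_cast; rw [Finset.sum_mul]
      exact Finset.sum_congr rfl fun n _ => by ring
    simp only [he]
    rcases hsep q with h | h
    · simp [h]; positivity
    · have hne : (∑ n, (exponentVec q n : ℝ) * f n) ≠ 0 := fun h0 => by
        rw [h0, abs_zero] at h; linarith
      have hq : exponentVec q ≠ 0 := fun h0 => hne (by simp [h0])
      rw [if_neg hq, sub_zero]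
      refine (norm_integral_unifTime_cexp_le hT hne).trans ?_
      gcongr
  · intro q _
    refine Integrable.const_mul (integrable_unifTorus
      (Continuous.aestronglyMeasurable (by fun_prop)) (C := 1) fun θ => ?_) _
    have : (∑ n, (exponentVec q n : ℂ) * (θ n : ℂ)) = ((∑ n, (exponentVec q n : ℝ) * θ n : ℝ) : ℂ) := by
      push_cast; rfl
    rw [this, Complex.norm_exp_ofReal_mul_I]
  · intro q _
    refine Integrable.const_mul ((integrable_const (1 : ℝ)).mono'
      (Continuous.aestronglyMeasurable (by fun_prop)) (Eventually.of_forall fun t => ?_)) _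
    have : (∑ n, (exponentVec q n : ℂ) * ((t * f n : ℝ) : ℂ))
        = ((∑ n, (exponentVec q n : ℝ) * (t * f n) : ℝ) : ℂ) := by
      push_cast; rfl
    rw [this, Complex.norm_exp_ofReal_mul_I]

/-- Both characteristic functions are expanded to order N. The moments below N cost N of the N + 1
comparison errors, and the two remainders are bounded by N-th moments. -/
theorem norm_integral_cexp_torusSum_sub_le {K : ℕ} (c : Fin K → ℂ) (f : Fin K → ℝ) {T ξ : ℝ}
    (hT : 0 < T) (hξ : 0 < ξ) {N : ℕ} (hN : Even N)
    (hsep : ∀ k ≤ N, ∀ q : Fin k → Fin K × Bool, exponentVec q = 0 ∨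
      ξ ≤ |∑ n, (exponentVec q n : ℝ) * f n|) {u : ℝ} (hu : 0 < u) :
    ‖∫ t : ℝ, Complex.exp (torusSum c (fun n => t * f n) * Complex.I) ∂unifTime T
        - ∏ n, (circleChar ‖c n‖ : ℂ)‖
      ≤ (N + 1) * (2 / (T * ξ) * (1 + ∑ n, ‖c n‖) ^ N)
        + 4 * u⁻¹ ^ N * Real.exp (u ^ 2 * (∑ n, ‖c n‖ ^ 2) / 2) := by
  have hP := isProbabilityMeasure_unifTime hT
  rw [← integral_cexp_torusSum]
  have h1 := norm_integral_cexp_sub_moments_le (unifTime T)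
    (Y := fun t => torusSum c (fun n => t * f n))
    (Continuous.aestronglyMeasurable (by fun_prop)) (fun t => abs_torusSum_le c _) hN
  have h2 := norm_integral_cexp_sub_moments_le (unifTorus K) (Y := torusSum c)
    (Continuous.aestronglyMeasurable (by fun_prop)) (fun t => abs_torusSum_le c _) hN
  have h3 := integral_torusSum_pow_le c hN hu
  set S := ∑ n, ‖c n‖ with hS
  have hS0 : 0 ≤ S := Finset.sum_nonneg fun _ _ => norm_nonneg _
  set A : ℕ → ℝ := fun k => ∫ t, torusSum c (fun n => t * f n) ^ k ∂unifTime T with hA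
  set B : ℕ → ℝ := fun k => ∫ θ, torusSum c θ ^ k ∂unifTorus K with hB
  set D := 2 / (T * ξ) * (1 + S) ^ N with hD
  have h4 : ∀ k ≤ N, |A k - B k| / k.factorial ≤ D := by
    intro k hk
    have h5 := abs_moment_sub_le c f hT hξ (hsep k hk)
    have h6 : (1 : ℝ) ≤ k.factorial := by exact_mod_cast k.factorial_pos
    refine (div_le_self (abs_nonneg _) h6).trans (h5.trans ?_)
    refine mul_le_mul_of_nonneg_left ?_ (by positivity)
    calc S ^ k ≤ (1 + S) ^ k := pow_le_pow_left₀ hS0 (by linarith) k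
      _ ≤ (1 + S) ^ N := pow_le_pow_right₀ (by linarith) hk
  have h7 : ‖∑ k ∈ Finset.range N, Complex.I ^ k / k.factorial * (A k : ℂ)
      - ∑ k ∈ Finset.range N, Complex.I ^ k / k.factorial * (B k : ℂ)‖ ≤ N * D := by
    rw [← Finset.sum_sub_distrib]
    calc _ ≤ ∑ k ∈ Finset.range N, D := by
          refine norm_sum_le_of_le _ fun k hk => ?_
          rw [← mul_sub, norm_mul, norm_div, norm_pow, Complex.norm_I, one_pow, ← Complex.ofReal_sub,
            Complex.norm_real, Real.norm_eq_abs, Complex.norm_natCast, one_div_mul_eq_div]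
          exact h4 k (Finset.mem_range.1 hk).le
      _ = N * D := by simp
  have h8 := h4 N le_rfl
  -- The N-th time moment is bounded through its torus counterpart, where the sub-Gaussian estimate
  -- is available; this costs the extra comparison error.
  have h9 : A N / N.factorial ≤ D + B N / N.factorial := by
    have : A N / N.factorial - B N / N.factorial ≤ |A N - B N| / N.factorial := by
      rw [← sub_div]
      exact div_le_div_of_nonneg_right (le_abs_self _) (by positivity)
    linarith
  set a := ∫ t : ℝ, Complex.exp (torusSum c (fun n => t * f n) * Complex.I) ∂unifTime T
  set b := ∫ θ, Complex.exp (torusSum c θ * Complex.I) ∂unifTorus K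
  set a' := ∑ k ∈ Finset.range N, Complex.I ^ k / k.factorial * (A k : ℂ)
  set b' := ∑ k ∈ Finset.range N, Complex.I ^ k / k.factorial * (B k : ℂ)
  have h10 : ‖a - b‖ ≤ ‖a - a'‖ + ‖a' - b'‖ + ‖b - b'‖ := by
    have e : a - b = (a - a') + (a' - b') - (b - b') := by ring
    rw [e]
    exact (norm_sub_le _ _).trans (add_le_add_left (norm_add_le _ _) _)
  have h1' : ‖a - a'‖ ≤ A N / N.factorial := h1
  have h2' : ‖b - b'‖ ≤ B N / N.factorial := h2
  have h3' : B N / N.factorial ≤ 2 * u⁻¹ ^ N * Real.exp (u ^ 2 * (∑ n, ‖c n‖ ^ 2) / 2) := h3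
  linarith

/-! ### Random sums with independent uniform phases -/

lemma abs_prod_range_sub_prod_range_le {j : ℕ → ℝ} (hj : ∀ n, |j n| ≤ 1) {K K' : ℕ} (h : K ≤ K') :
    |∏ n ∈ Finset.range K', j n - ∏ n ∈ Finset.range K, j n|
      ≤ ∑ n ∈ Finset.Ico K K', |1 - j n| := by
  induction K', h using Nat.le_induction with
  | base => simp
  | succ m hm ih =>
    rw [Finset.prod_range_succ, Finset.sum_Ico_succ_top hm]
    have h1 : |∏ n ∈ Finset.range m, j n| ≤ 1 := by
      rw [Finset.abs_prod]
      exact Finset.prod_le_one (fun _ _ => abs_nonneg _) fun n _ => hj n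
    have h2 : (∏ n ∈ Finset.range m, j n) * j m - ∏ n ∈ Finset.range K, j n
        = (∏ n ∈ Finset.range m, j n - ∏ n ∈ Finset.range K, j n)
          - (∏ n ∈ Finset.range m, j n) * (1 - j m) := by ring
    rw [h2]
    refine (abs_sub _ _).trans (add_le_add ih ?_)
    rw [abs_mul]
    exact mul_le_of_le_one_left (abs_nonneg _) h1

/-- The law of `∑_{n < K} rₙ e^{iθₙ}` with independent uniform angles. -/
def phaseSumLaw (r : ℕ → ℝ) (K : ℕ) : Measure ℂ :=
  (unifTorus K).map fun θ => ∑ n : Fin K, (r n : ℂ) * Complex.exp (θ n * Complex.I)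

lemma continuous_phaseSum (r : ℕ → ℝ) (K : ℕ) : Continuous fun θ : Fin K → ℝ =>
    ∑ n : Fin K, (r n : ℂ) * Complex.exp (θ n * Complex.I) := by fun_prop

instance (r : ℕ → ℝ) (K : ℕ) : IsProbabilityMeasure (phaseSumLaw r K) :=
  Measure.isProbabilityMeasure_map (continuous_phaseSum r K).aemeasurable

lemma charFun_phaseSumLaw {r : ℕ → ℝ} (hr : ∀ n, 0 ≤ r n) (K : ℕ) (w : ℂ) :
    charFun (phaseSumLaw r K) w = ((∏ n ∈ Finset.range K, circleChar (‖w‖ * r n) : ℝ) : ℂ) := by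
  rw [charFun_apply, phaseSumLaw, integral_map (continuous_phaseSum r K).aemeasurable
    (Continuous.aestronglyMeasurable (by fun_prop))]
  have h := integral_cexp_torusSum (K := K) fun n => (starRingEnd ℂ w) * (r n : ℂ)
  have e : ∀ θ : Fin K → ℝ, torusSum (fun n : Fin K => (starRingEnd ℂ w) * (r n : ℂ)) θ
      = inner ℝ (∑ n : Fin K, (r n : ℂ) * Complex.exp (θ n * Complex.I)) w := by
    intro θ
    rw [real_inner_comm, Complex.inner, torusSum, ← Complex.re_sum, Finset.sum_mul]
    congr 1
    exact Finset.sum_congr rfl fun n _ => by ring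
  simp only [e] at h
  rw [h, Finset.prod_range]
  push_cast
  refine Finset.prod_congr rfl fun n _ => ?_
  rw [norm_mul, RCLike.norm_conj, Complex.norm_real, Real.norm_of_nonneg (hr _)]

/-- The limit law is built from characteristic functions alone. The finite products are Cauchy at
rate ∑_{n≥K} rₙ², their limit is continuous at 0, hence the finite laws are tight and a limit point
exists. The explicit rate determines the law and is the only property used later. -/
theorem exists_phaseSeriesLaw {r : ℕ → ℝ} (hr : ∀ n, 0 ≤ r n) (hs : Summable fun n => r n ^ 2) :
    ∃ P : ProbabilityMeasure ℂ, ∀ (w : ℂ) (K : ℕ),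
      ‖charFun (P : Measure ℂ) w - ((∏ n ∈ Finset.range K, circleChar (‖w‖ * r n) : ℝ) : ℂ)‖
        ≤ ‖w‖ ^ 2 / 2 * ∑' n, r (n + K) ^ 2 := by
  have hfin : ∀ (w : ℂ) (K K' : ℕ), K ≤ K' →
      |∏ n ∈ Finset.range K', circleChar (‖w‖ * r n) - ∏ n ∈ Finset.range K, circleChar (‖w‖ * r n)|
        ≤ ‖w‖ ^ 2 / 2 * ∑' n, r (n + K) ^ 2 := by
    intro w K K' h
    refine (abs_prod_range_sub_prod_range_le (fun n => abs_circleChar_le_one _) h).trans ?_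
    calc ∑ n ∈ Finset.Ico K K', |1 - circleChar (‖w‖ * r n)|
        ≤ ∑ n ∈ Finset.Ico K K', ‖w‖ ^ 2 / 2 * r n ^ 2 := by
          refine Finset.sum_le_sum fun n _ => (abs_one_sub_circleChar_le _).trans (le_of_eq ?_)
          ring
      _ ≤ _ := by
          rw [← Finset.mul_sum, Finset.sum_Ico_eq_sum_range]
          refine mul_le_mul_of_nonneg_left ?_ (by positivity)
          simp only [add_comm K]
          exact ((summable_nat_add_iff K).2 hs).sum_le_tsum _ fun _ _ => sq_nonneg _
  have htail := tendsto_sum_nat_add fun n => r n ^ 2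
  have hlim : ∀ w : ℂ, ∃ l : ℝ,
      Tendsto (fun K => ∏ n ∈ Finset.range K, circleChar (‖w‖ * r n)) atTop (𝓝 l) := by
    intro w
    refine cauchySeq_tendsto_of_complete (cauchySeq_of_le_tendsto_0'
      (fun K => ‖w‖ ^ 2 / 2 * ∑' n, r (n + K) ^ 2) (fun K K' h => ?_) ?_)
    · rw [dist_comm, Real.dist_eq]; exact hfin w K K' h
    · simpa using htail.const_mul (‖w‖ ^ 2 / 2)
  choose f hf using hlim
  have hfK : ∀ (w : ℂ) (K : ℕ), |f w - ∏ n ∈ Finset.range K, circleChar (‖w‖ * r n)|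
      ≤ ‖w‖ ^ 2 / 2 * ∑' n, r (n + K) ^ 2 := by
    intro w K
    refine le_of_tendsto (((hf w).sub_const _).abs) ?_
    filter_upwards [eventually_ge_atTop K] with K' hK'
    exact hfin w K K' hK'
  have hf1 : ∀ w : ℂ, |f w - 1| ≤ ‖w‖ ^ 2 / 2 * ∑' n, r n ^ 2 := by
    intro w; simpa using hfK w 0
  have hf0 : f 0 = 1 := by
    have := hf1 0
    simp at this
    linarith
  -- The rate at K = 0, where the empty product is 1, gives continuity at the origin, which yields
  -- tightness.
  have hcont : ContinuousAt (fun w => (f w : ℂ)) 0 := by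
    refine Complex.continuous_ofReal.continuousAt.comp ?_
    rw [ContinuousAt, hf0, tendsto_iff_norm_sub_tendsto_zero]
    refine squeeze_zero (fun _ => norm_nonneg _) hf1 ?_
    have : Continuous fun w : ℂ => ‖w‖ ^ 2 / 2 * ∑' n, r n ^ 2 := by fun_prop
    simpa using this.tendsto 0
  have hchar : ∀ w, Tendsto (fun K => charFun (phaseSumLaw r K) w) atTop (𝓝 (f w : ℂ)) := by
    intro w
    simp only [charFun_phaseSumLaw hr]
    exact (Complex.continuous_ofReal.tendsto _).comp (hf w)
  have htight := isTightMeasureSet_of_tendsto_charFun hcont hchar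
  let μ : ℕ → ProbabilityMeasure ℂ := fun K => ⟨phaseSumLaw r K, inferInstance⟩
  have hcompact : IsCompact (closure (range μ)) := by
    refine isCompact_closure_of_isTightMeasureSet ?_
    convert htight
    ext m
    constructor
    · rintro ⟨_, ⟨K, rfl⟩, rfl⟩; exact ⟨K, rfl⟩
    · rintro ⟨K, rfl⟩; exact ⟨_, ⟨K, rfl⟩, rfl⟩
  -- A limit along a nonprincipal ultrafilter replaces the extraction of a subsequence; it refines
  -- `atTop`, so the characteristic functions keep their limits.
  obtain ⟨P, -, hP : Tendsto _ _ _⟩ := hcompact.ultrafilter_le_nhds ((hyperfilter ℕ).map μ)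
    (.trans (by simp) (monotone_principal subset_closure))
  have hP' : Tendsto μ (hyperfilter ℕ) (𝓝 P) := hP
  refine ⟨P, fun w K => ?_⟩
  have hPf : charFun (P : Measure ℂ) w = (f w : ℂ) := by
    rw [ProbabilityMeasure.tendsto_iff_forall_integral_rclike_tendsto ℂ] at hP'
    have h1 := hP' (BoundedContinuousFunction.innerProbChar w)
    simp_rw [← charFun_eq_integral_innerProbChar] at h1
    exact tendsto_nhds_unique h1 ((hchar w).mono_left Nat.hyperfilter_le_atTop)
  rw [hPf, ← Complex.ofReal_sub, Complex.norm_real]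
  exact hfK w K

/-- Each J₀ factor decays like |w|^(-1/2), so six of them give |w|⁻³, which is integrable over the
plane as well as along lines. The others are at most 1 in absolute value. Here 729 = 3⁶, and 8 = 2³
comes from 1 + |w| ≤ 2|w| for |w| > 1 or 1 + |w| ≤ 2 otherwise. -/
lemma norm_charFun_le_of_phaseSeries {r : ℕ → ℝ} {P : Measure ℂ} [IsProbabilityMeasure P]
    (hP : ∀ (w : ℂ) (K : ℕ),
      ‖charFun P w - ((∏ n ∈ Finset.range K, circleChar (‖w‖ * r n) : ℝ) : ℂ)‖
        ≤ ‖w‖ ^ 2 / 2 * ∑' n, r (n + K) ^ 2)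
    {ρ : ℝ} (hρ : 0 < ρ) (hρr : ∀ n < 6, ρ ≤ r n) (w : ℂ) :
    ‖charFun P w‖ ≤ 8 * (1 + 729 / ρ ^ 3) * (1 + ‖w‖) ^ (-3 : ℝ) := by
  have hpow : (1 + ‖w‖) ^ (-3 : ℝ) = ((1 + ‖w‖) ^ 3)⁻¹ := by
    rw [Real.rpow_neg (by positivity)]; norm_cast
  rw [hpow, ← div_eq_mul_inv, le_div_iff₀ (by positivity)]
  have hone := norm_charFun_le_one (μ := P) w
  have hq : 0 ≤ 729 / ρ ^ 3 := by positivity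
  rcases le_or_gt ‖w‖ 1 with hw | hw
  · have : (1 + ‖w‖) ^ 3 ≤ (1 + 1) ^ 3 := by gcongr
    nlinarith [norm_nonneg (charFun P w)]
  · have hw0 : 0 < ‖w‖ := by linarith
    have hprod : ∀ K : ℕ, |∏ n ∈ Finset.range (K + 6), circleChar (‖w‖ * r n)|
        ≤ 729 / (‖w‖ * ρ) ^ 3 := by
      intro K
      rw [Finset.abs_prod, add_comm, Finset.prod_range_add]
      have h1 : ∏ n ∈ Finset.range 6, |circleChar (‖w‖ * r n)|
          ≤ ∏ n ∈ Finset.range 6, 3 / Real.sqrt (‖w‖ * ρ) := by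
        refine Finset.prod_le_prod (fun _ _ => abs_nonneg _) fun n hn => ?_
        have h2 := hρr n (Finset.mem_range.1 hn)
        have h3 : 0 < r n := lt_of_lt_of_le hρ h2
        refine (abs_circleChar_le (by positivity)).trans ?_
        gcongr
      have h4 : ∏ n ∈ Finset.range 6, 3 / Real.sqrt (‖w‖ * ρ) = 729 / (‖w‖ * ρ) ^ 3 := by
        rw [Finset.prod_const, Finset.card_range, div_pow]
        have : Real.sqrt (‖w‖ * ρ) ^ 6 = (Real.sqrt (‖w‖ * ρ) ^ 2) ^ 3 := by ring
        rw [this, Real.sq_sqrt (by positivity)]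
        norm_num
      rw [h4] at h1
      refine (mul_le_of_le_one_right (Finset.prod_nonneg fun _ _ => abs_nonneg _) ?_).trans h1
      exact Finset.prod_le_one (fun _ _ => abs_nonneg _) fun n _ => abs_circleChar_le_one _
    have htail := (tendsto_sum_nat_add fun n => r n ^ 2).comp (tendsto_add_atTop_nat 6)
    have hlim : ‖charFun P w‖ ≤ 729 / (‖w‖ * ρ) ^ 3 := by
      have h5 : Tendsto (fun K : ℕ => 729 / (‖w‖ * ρ) ^ 3
          + ‖w‖ ^ 2 / 2 * ∑' n, r (n + (K + 6)) ^ 2) atTop (𝓝 (729 / (‖w‖ * ρ) ^ 3)) := by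
        simpa using (htail.const_mul (‖w‖ ^ 2 / 2)).const_add (729 / (‖w‖ * ρ) ^ 3)
      refine ge_of_tendsto h5 (Eventually.of_forall fun K => ?_)
      have h6 := hP w (K + 6)
      have h7 := hprod K
      rw [← Real.norm_eq_abs, ← Complex.norm_real] at h7
      have h8 := norm_add_le (charFun P w
        - ((∏ n ∈ Finset.range (K + 6), circleChar (‖w‖ * r n) : ℝ) : ℂ))
        ((∏ n ∈ Finset.range (K + 6), circleChar (‖w‖ * r n) : ℝ) : ℂ)
      rw [sub_add_cancel] at h8
      linarith
    have h9 : (1 + ‖w‖) ^ 3 ≤ (2 * ‖w‖) ^ 3 := by gcongr; linarith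
    calc ‖charFun P w‖ * (1 + ‖w‖) ^ 3 ≤ 729 / (‖w‖ * ρ) ^ 3 * (2 * ‖w‖) ^ 3 := by gcongr
      _ = 8 * (729 / ρ ^ 3) := by field_simp; norm_num
      _ ≤ _ := by linarith

/-! ### Measures whose characteristic function decays -/

/-- `∫ (1 + |u|)⁻³ du`. -/
def decayIntegral : ℝ := ∫ u : ℝ, (1 + ‖u‖) ^ (-3 : ℝ)

lemma integrable_decay_real : Integrable fun u : ℝ => (1 + ‖u‖) ^ (-3 : ℝ) :=
  integrable_one_add_norm (by simp)

lemma integrable_decay_complex : Integrable fun w : ℂ => (1 + ‖w‖) ^ (-3 : ℝ) :=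
  integrable_one_add_norm (by rw [Complex.finrank_real_complex]; norm_num)

lemma decayIntegral_nonneg : 0 ≤ decayIntegral := integral_nonneg fun u => by positivity

lemma exp_neg_sq_eq_integral {r : ℝ} (hr : 0 < r) (y : ℝ) :
    ((Real.exp (-(y / r) ^ 2) : ℝ) : ℂ) = (r / (2 * Real.sqrt Real.pi) : ℝ) *
      ∫ u : ℝ, Complex.exp ((u * y : ℝ) * Complex.I) * Real.exp (-(r ^ 2 / 4) * u ^ 2) := by
  have h := fourierIntegral_gaussian (b := ((r ^ 2 / 4 : ℝ) : ℂ))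
    (by rw [Complex.ofReal_re]; positivity) (y : ℂ)
  have e : ∀ u : ℝ, Complex.exp ((u * y : ℝ) * Complex.I) * Real.exp (-(r ^ 2 / 4) * u ^ 2)
      = Complex.exp (Complex.I * y * u) * Complex.exp (-((r ^ 2 / 4 : ℝ) : ℂ) * u ^ 2) := by
    intro u; push_cast; congr 2; ring
  simp only [e]
  rw [h]
  have e2 : ((Real.pi : ℂ) / ((r ^ 2 / 4 : ℝ) : ℂ)) ^ (1 / 2 : ℂ)
      = ((2 * Real.sqrt Real.pi / r : ℝ) : ℂ) := by
    rw [← Complex.ofReal_div, show (1 / 2 : ℂ) = ((1 / 2 : ℝ) : ℂ) by norm_num,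
      ← Complex.ofReal_cpow (by positivity), ← Real.sqrt_eq_rpow]
    congr 1
    have : Real.pi / (r ^ 2 / 4) = Real.pi * (2 / r) ^ 2 := by field_simp; ring
    rw [this, Real.sqrt_mul Real.pi_pos.le, Real.sqrt_sq (by positivity)]
    ring
  rw [e2, ← mul_assoc, ← Complex.ofReal_mul]
  have e3 : r / (2 * Real.sqrt Real.pi) * (2 * Real.sqrt Real.pi / r) = 1 := by
    have := Real.sqrt_pos.2 Real.pi_pos
    field_simp
  rw [e3, Complex.ofReal_one, one_mul, Complex.ofReal_exp]
  congr 1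
  push_cast
  field_simp

/-- Strips orthogonal to a unit vector have measure proportional to their width. -/
lemma measureReal_strip_le (ν : Measure ℂ) [IsProbabilityMeasure ν] {D : ℝ}
    (hD : ∀ w, ‖charFun ν w‖ ≤ D * (1 + ‖w‖) ^ (-3 : ℝ)) {e : ℂ} (he : ‖e‖ = 1) (a : ℝ) {r : ℝ}
    (hr : 0 < r) : ν.real {z : ℂ | |inner ℝ z e - a| ≤ r} ≤ 3 * D * decayIntegral * r := by
  have hm : MeasurableSet {z : ℂ | |inner ℝ z e - a| ≤ r} :=
    measurableSet_le (Continuous.measurable (by fun_prop)) measurable_const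
  have hexp1 : (1 : ℝ) ≤ 3 * Real.exp (-1) := by
    rw [Real.exp_neg, ← div_eq_mul_inv, one_le_div (Real.exp_pos _)]
    linarith [Real.exp_one_lt_d9]
  -- A Gaussian majorant (up to the factor 3 > e) of the indicator of the strip. It depends on one
  -- coordinate, so only the characteristic function along the line ℝe enters, and its decay is
  -- integrable there.
  set g : ℂ → ℝ := fun z => Real.exp (-((inner ℝ z e - a) / r) ^ 2) with hg
  have hgi : Integrable g ν := by
    refine (integrable_const (1 : ℝ)).mono' (Continuous.aestronglyMeasurable (by fun_prop))
      (Eventually.of_forall fun z => ?_)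
    rw [Real.norm_of_nonneg (Real.exp_pos _).le, Real.exp_le_one_iff]
    exact neg_nonpos.2 (sq_nonneg _)
  have h1 : ν.real {z : ℂ | |inner ℝ z e - a| ≤ r} ≤ 3 * ∫ z, g z ∂ν := by
    rw [← integral_indicator_one hm, ← integral_const_mul]
    refine integral_mono ((integrable_const (1 : ℝ)).indicator hm) (hgi.const_mul 3) fun z => ?_
    by_cases hz : z ∈ {z : ℂ | |inner ℝ z e - a| ≤ r}
    · rw [indicator_of_mem hz]
      refine hexp1.trans ?_
      simp only [hg]
      gcongr
      rw [div_pow, div_le_one (by positivity), ← sq_abs]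
      exact pow_le_pow_left₀ (abs_nonneg _) hz 2
    · rw [indicator_of_notMem hz]
      positivity
  have h2 : ((∫ z, g z ∂ν : ℝ) : ℂ) = (r / (2 * Real.sqrt Real.pi) : ℝ) *
      ∫ u : ℝ, (charFun ν ((u : ℂ) * e) * Complex.exp ((-(u * a) : ℝ) * Complex.I)) *
        Real.exp (-(r ^ 2 / 4) * u ^ 2) := by
    rw [← integral_complex_ofReal]
    simp only [hg, exp_neg_sq_eq_integral hr]
    rw [integral_const_mul, integral_integral_swap]
    · congr 1
      refine integral_congr_ae (Eventually.of_forall fun u => ?_)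
      simp only
      rw [integral_mul_const]
      refine congrArg (· * _) ?_
      rw [charFun_apply, ← integral_mul_const]
      refine integral_congr_ae (Eventually.of_forall fun z => ?_)
      simp only
      rw [← Complex.exp_add]
      congr 1
      have : inner ℝ z ((u : ℂ) * e) = u * inner ℝ z e := by
        rw [← Complex.real_smul, inner_smul_right]
      rw [this]
      push_cast
      ring
    · have hc : Continuous (fun p : ℂ × ℝ => Complex.exp ((p.2 * (inner ℝ p.1 e - a) : ℝ) * Complex.I)
          * (Real.exp (-(r ^ 2 / 4) * p.2 ^ 2) : ℂ)) := by fun_prop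
      have hi : Integrable (fun p : ℂ × ℝ => Real.exp (-(r ^ 2 / 4) * p.2 ^ 2)) (ν.prod volume) :=
        (integrable_exp_neg_mul_sq (by positivity : 0 < r ^ 2 / 4)).comp_snd ν
      refine hi.mono' hc.aestronglyMeasurable (Eventually.of_forall fun p => ?_)
      simp only [Function.uncurry]
      rw [norm_mul, Complex.norm_exp_ofReal_mul_I, one_mul, Complex.norm_real,
        Real.norm_of_nonneg (Real.exp_pos _).le]
  have h3 : ‖∫ u : ℝ, (charFun ν ((u : ℂ) * e) * Complex.exp ((-(u * a) : ℝ) * Complex.I)) *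
        Real.exp (-(r ^ 2 / 4) * u ^ 2)‖ ≤ D * decayIntegral := by
    rw [decayIntegral, ← integral_const_mul]
    refine norm_integral_le_of_norm_le (integrable_decay_real.const_mul D)
      (Eventually.of_forall fun u => ?_)
    rw [norm_mul, norm_mul, Complex.norm_exp_ofReal_mul_I, mul_one, Complex.norm_real,
      Real.norm_of_nonneg (Real.exp_pos _).le]
    have h4 := hD ((u : ℂ) * e)
    rw [norm_mul, he, mul_one, Complex.norm_real] at h4
    refine (mul_le_of_le_one_right (norm_nonneg _) ?_).trans h4
    rw [Real.exp_le_one_iff]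
    nlinarith [sq_nonneg u, sq_nonneg r, mul_nonneg (sq_nonneg u) (sq_nonneg r)]
  have h5 : ∫ z, g z ∂ν ≤ r * (D * decayIntegral) := by
    have h6 := congrArg norm h2
    rw [norm_mul, Complex.norm_real, Complex.norm_real] at h6
    refine (le_abs_self _).trans ?_
    rw [← Real.norm_eq_abs, h6]
    refine mul_le_mul ?_ h3 (norm_nonneg _) hr.le
    rw [Real.norm_of_nonneg (by positivity)]
    refine div_le_self hr.le ?_
    have : 1 ≤ Real.sqrt Real.pi := Real.one_le_sqrt.2 (by linarith [Real.pi_gt_three])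
    linarith
  linarith

/-! ### Rectangles -/

lemma mem_closedRect {a b c d : ℝ} {z : ℂ} :
    z ∈ closedRect a b c d ↔ (a ≤ z.re ∧ z.re ≤ b) ∧ (c ≤ z.im ∧ z.im ≤ d) := Iff.rfl

lemma measurableSet_closedRect (a b c d : ℝ) : MeasurableSet (closedRect a b c d) :=
  (measurableSet_Icc.preimage Complex.measurable_re).inter
    (measurableSet_Icc.preimage Complex.measurable_im)

lemma volume_closedRect (a b c d : ℝ) :
    volume (closedRect a b c d) = ENNReal.ofReal (b - a) * ENNReal.ofReal (d - c) := by
  have : closedRect a b c d = Complex.measurableEquivRealProd ⁻¹' (Icc a b ×ˢ Icc c d) := rfl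
  rw [this, Complex.volume_preserving_equiv_real_prod.measure_preimage
    (measurableSet_Icc.prod measurableSet_Icc).nullMeasurableSet]
  rw [Measure.volume_eq_prod, Measure.prod_prod, Real.volume_Icc, Real.volume_Icc]

lemma volume_closedRect_ne_top (a b c d : ℝ) : volume (closedRect a b c d) ≠ ⊤ := by
  rw [volume_closedRect]
  exact ENNReal.mul_ne_top ENNReal.ofReal_ne_top ENNReal.ofReal_ne_top

lemma volume_real_closedRect {a b c d : ℝ} (h : a ≤ b) (h' : c ≤ d) :
    (volume : Measure ℂ).real (closedRect a b c d) = (b - a) * (d - c) := by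
  rw [measureReal_def, volume_closedRect, ENNReal.toReal_mul,
    ENNReal.toReal_ofReal (by linarith), ENNReal.toReal_ofReal (by linarith)]

lemma closedRect_thicken {a b c d r : ℝ} {x z : ℂ} (hx : x ∈ closedRect a b c d)
    (hz : ‖z - x‖ ≤ r) : z ∈ closedRect (a - r) (b + r) (c - r) (d + r) := by
  rw [mem_closedRect] at hx ⊢
  have h1 := abs_le.1 ((Complex.abs_re_le_norm (z - x)).trans hz)
  have h2 := abs_le.1 ((Complex.abs_im_le_norm (z - x)).trans hz)
  rw [Complex.sub_re] at h1
  rw [Complex.sub_im] at h2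
  obtain ⟨⟨_, _⟩, _, _⟩ := hx
  refine ⟨⟨?_, ?_⟩, ?_, ?_⟩ <;> linarith [h1.1, h1.2, h2.1, h2.2]

/-- The added frame lies in four strips, one along each side. No order between a, b or c, d is
required, so the bound also applies to rectangles that have shrunk to nothing. -/
lemma measureReal_closedRect_thicken_le (ν : Measure ℂ) [IsProbabilityMeasure ν] {E : ℝ}
    (hE : ∀ (e : ℂ), ‖e‖ = 1 → ∀ (x r : ℝ), 0 < r → ν.real {z : ℂ | |inner ℝ z e - x| ≤ r} ≤ E * r)
    (a b c d : ℝ) {r : ℝ} (hr : 0 < r) :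
    ν.real (closedRect (a - r) (b + r) (c - r) (d + r))
      ≤ ν.real (closedRect a b c d) + 4 * E * r := by
  have hsub : closedRect (a - r) (b + r) (c - r) (d + r) ⊆ closedRect a b c d ∪
      (({z : ℂ | |inner ℝ z 1 - a| ≤ r} ∪ {z : ℂ | |inner ℝ z 1 - b| ≤ r}) ∪
      ({z : ℂ | |inner ℝ z Complex.I - c| ≤ r} ∪ {z : ℂ | |inner ℝ z Complex.I - d| ≤ r})) := by
    intro z hz
    have e1 : inner ℝ z 1 = z.re := by simp [Complex.inner]
    have e2 : inner ℝ z Complex.I = z.im := by simp [Complex.inner]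
    simp only [mem_union, mem_ofPred_eq, e1, e2, mem_closedRect, abs_le] at hz ⊢
    obtain ⟨⟨_, _⟩, _, _⟩ := hz
    by_cases h1 : a ≤ z.re
    · by_cases h2 : z.re ≤ b
      · by_cases h3 : c ≤ z.im
        · by_cases h4 : z.im ≤ d
          · exact Or.inl ⟨⟨h1, h2⟩, h3, h4⟩
          · exact Or.inr (Or.inr (Or.inr ⟨by linarith, by linarith⟩))
        · exact Or.inr (Or.inr (Or.inl ⟨by linarith, by linarith⟩))
      · exact Or.inr (Or.inl (Or.inr ⟨by linarith, by linarith⟩))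
    · exact Or.inr (Or.inl (Or.inl ⟨by linarith, by linarith⟩))
  have h1 := hE 1 (by simp) a r hr
  have h2 := hE 1 (by simp) b r hr
  have h3 := hE Complex.I (by simp) c r hr
  have h4 := hE Complex.I (by simp) d r hr
  have h5 := measureReal_mono (μ := ν) hsub
  have h6 := measureReal_union_le (μ := ν) (closedRect a b c d)
    (({z : ℂ | |inner ℝ z 1 - a| ≤ r} ∪ {z : ℂ | |inner ℝ z 1 - b| ≤ r}) ∪
      ({z : ℂ | |inner ℝ z Complex.I - c| ≤ r} ∪ {z : ℂ | |inner ℝ z Complex.I - d| ≤ r}))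
  have h7 := measureReal_union_le (μ := ν)
    ({z : ℂ | |inner ℝ z 1 - a| ≤ r} ∪ {z : ℂ | |inner ℝ z 1 - b| ≤ r})
    ({z : ℂ | |inner ℝ z Complex.I - c| ≤ r} ∪ {z : ℂ | |inner ℝ z Complex.I - d| ≤ r})
  have h8 := measureReal_union_le (μ := ν) {z : ℂ | |inner ℝ z 1 - a| ≤ r} {z : ℂ | |inner ℝ z 1 - b| ≤ r}
  have h9 := measureReal_union_le (μ := ν) {z : ℂ | |inner ℝ z Complex.I - c| ≤ r}
    {z : ℂ | |inner ℝ z Complex.I - d| ≤ r}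
  linarith

@[fun_prop]
lemma continuous_heatSmooth (μ : Measure ℂ) [IsProbabilityMeasure μ] {b : ℝ} (hb : 0 < b) :
    Continuous (heatSmooth μ b) := by
  refine continuous_of_dominated (bound := fun _ => (4 * Real.pi * b)⁻¹)
    (fun z => Continuous.aestronglyMeasurable (by fun_prop)) (fun z => Eventually.of_forall fun x => ?_)
    (integrable_const _) (Eventually.of_forall fun x => by fun_prop)
  rw [Real.norm_of_nonneg (heatKernel_nonneg hb _)]
  exact heatKernel_le hb _

lemma integrableOn_closedRect {f : ℂ → ℝ} (hf : Continuous f) (a b c d : ℝ) :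
    IntegrableOn f (closedRect a b c d) := by
  have : IsCompact (closedRect a b c d) := isCompact_Icc.reProdIm isCompact_Icc
  exact hf.continuousOn.integrableOn_compact this

lemma abs_setIntegral_sub_le {f g : ℂ → ℝ} (hf : Continuous f) (hg : Continuous g) {Δ : ℝ}
    (h : ∀ z, |f z - g z| ≤ Δ) (a b c d : ℝ) :
    |(∫ z in closedRect a b c d, f z) - ∫ z in closedRect a b c d, g z|
      ≤ Δ * (volume : Measure ℂ).real (closedRect a b c d) := by
  rw [← integral_sub (integrableOn_closedRect hf a b c d) (integrableOn_closedRect hg a b c d)]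
  exact norm_setIntegral_le_of_norm_le_const (f := fun z => f z - g z)
    (volume_closedRect_ne_top a b c d).lt_top fun z _ => h z

/-- A Berry–Esseen type inequality for rectangles. -/
theorem abs_measureReal_closedRect_sub_le (μ ν : Measure ℂ) [IsProbabilityMeasure μ]
    [IsProbabilityMeasure ν] {E : ℝ}
    (hE : ∀ (e : ℂ), ‖e‖ = 1 → ∀ (x r : ℝ), 0 < r → ν.real {z : ℂ | |inner ℝ z e - x| ≤ r} ≤ E * r)
    {t η W r : ℝ} (ht : 0 < t) (hW : 0 ≤ W) (hη : 0 ≤ η)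
    (h : ∀ w : ℂ, ‖w‖ ≤ W → ‖charFun μ w - charFun ν w‖ ≤ η)
    {a b c d : ℝ} (hr : 0 < r) (hab : r < b - a) (hcd : r < d - c) :
    |μ.real (closedRect a b c d) - ν.real (closedRect a b c d)|
      ≤ 8 * E * r + 4 * Real.exp (-r ^ 2 / (8 * t))
        + 9 * ((η + 4 * Real.exp (-t * W ^ 2 / 2)) / t)
          * (volume : Measure ℂ).real (closedRect a b c d) := by
  set Δ := (η + 4 * Real.exp (-t * W ^ 2 / 2)) / t with hΔ
  have hΔ0 : 0 ≤ Δ := by positivity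
  have hD := abs_heatSmooth_sub_le μ ν ht hW hη h
  have hcμ := continuous_heatSmooth μ ht
  have hcν := continuous_heatSmooth ν ht
  have hm := measurableSet_closedRect
  have hv := volume_closedRect_ne_top
  have hvol : (volume : Measure ℂ).real (closedRect a b c d) = (b - a) * (d - c) :=
    volume_real_closedRect (by linarith) (by linarith)
  -- Since r is below both side lengths, thickening at most triples each side.
  have hvol1 : (volume : Measure ℂ).real (closedRect (a - r) (b + r) (c - r) (d + r))
      ≤ 9 * (volume : Measure ℂ).real (closedRect a b c d) := by
    rw [hvol, volume_real_closedRect (by linarith) (by linarith)]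
    nlinarith [mul_pos (sub_pos.2 hab) (sub_pos.2 hcd), mul_pos hr (sub_pos.2 hab),
      mul_pos hr (sub_pos.2 hcd)]
  have hvol2 : (volume : Measure ℂ).real (closedRect (a + r) (b - r) (c + r) (d - r))
      ≤ 9 * (volume : Measure ℂ).real (closedRect a b c d) := by
    have hsub : closedRect (a + r) (b - r) (c + r) (d - r) ⊆ closedRect a b c d := by
      intro z hz
      rw [mem_closedRect] at hz ⊢
      obtain ⟨⟨_, _⟩, _, _⟩ := hz
      refine ⟨⟨?_, ?_⟩, ?_, ?_⟩ <;> linarith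
    have := measureReal_mono hsub (hv a b c d)
    have h0 : 0 ≤ (volume : Measure ℂ).real (closedRect a b c d) := measureReal_nonneg
    linarith
  rw [abs_le]
  constructor
  -- Lower bound: the rectangle is shrunk by 2r, of which one r is used in passing from ν to its
  -- smoothing and one in returning from the smoothing to μ. The upper bound is the mirror image,
  -- with thickening.
  · have s1 := measureReal_closedRect_thicken_le ν hE (a + 2 * r) (b - 2 * r) (c + 2 * r) (d - 2 * r)
      (r := 2 * r) (by linarith)
    simp only [add_sub_cancel_right, sub_add_cancel] at s1
    have s2 := measureReal_le_setIntegral_heatSmooth ν ht hr.le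
      (hm (a + 2 * r) (b - 2 * r) (c + 2 * r) (d - 2 * r)) (hm (a + r) (b - r) (c + r) (d - r))
      (hv _ _ _ _) (fun x hx z hz => by
        have := closedRect_thicken hx hz
        convert this using 2 <;> ring)
    have s3 := abs_le.1 (abs_setIntegral_sub_le hcμ hcν hD (a + r) (b - r) (c + r) (d - r))
    have s4 := setIntegral_heatSmooth_le_measureReal μ ht hr.le
      (hm (a + r) (b - r) (c + r) (d - r)) (hm a b c d) (hv _ _ _ _) (fun x hx z hz => by
        have := closedRect_thicken hx hz
        convert this using 2 <;> ring)
    have s5 := mul_le_mul_of_nonneg_left hvol2 hΔ0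
    linarith [s3.1]
  · have s1 := measureReal_closedRect_thicken_le ν hE a b c d (r := 2 * r) (by linarith)
    have s2 := measureReal_le_setIntegral_heatSmooth μ ht hr.le (hm a b c d)
      (hm (a - r) (b + r) (c - r) (d + r)) (hv _ _ _ _) (fun x hx z hz => closedRect_thicken hx hz)
    have s3 := abs_le.1 (abs_setIntegral_sub_le hcμ hcν hD (a - r) (b + r) (c - r) (d + r))
    have s4 := setIntegral_heatSmooth_le_measureReal ν ht hr.le
      (hm (a - r) (b + r) (c - r) (d + r)) (hm (a - 2 * r) (b + 2 * r) (c - 2 * r) (d + 2 * r))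
      (hv _ _ _ _) (fun x hx z hz => by
        have := closedRect_thicken hx hz
        convert this using 2 <;> ring)
    have s5 := mul_le_mul_of_nonneg_left hvol1 hΔ0
    linarith [s3.2]

/-! ### The density -/

/-- The density with respect to `(2π)⁻¹ dx dy` of a measure with integrable characteristic
function. -/
def fourierDensity (ν : Measure ℂ) (z : ℂ) : ℝ :=
  (2 * Real.pi)⁻¹ * (∫ w : ℂ, charFun ν w * Complex.exp (-(inner ℝ w z : ℝ) * Complex.I)).re

lemma continuous_fourierDensity (ν : Measure ℂ) [IsProbabilityMeasure ν]
    (hi : Integrable (charFun ν)) : Continuous (fourierDensity ν) := by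
  refine continuous_const.mul (Complex.continuous_re.comp ?_)
  refine continuous_of_dominated (bound := fun w => ‖charFun ν w‖)
    (fun z => Continuous.aestronglyMeasurable (by fun_prop)) (fun z => Eventually.of_forall fun w => ?_)
    hi.norm (Eventually.of_forall fun w => by fun_prop)
  rw [norm_mul, ← Complex.ofReal_neg, Complex.norm_exp_ofReal_mul_I, mul_one]

/-- The error is ∫ |φ|(1 - exp(-t|w|²)), uniform in z, and tends to 0 by dominated convergence. The
factor (2π)⁻¹ appears because the density is taken with respect to (2π)⁻¹ dx dy. -/
lemma exists_abs_heatSmooth_sub_fourierDensity_le (ν : Measure ℂ) [IsProbabilityMeasure ν]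
    (hi : Integrable (charFun ν)) : ∃ δ : ℝ → ℝ, Tendsto δ (𝓝[>] 0) (𝓝 0) ∧
      ∀ t, 0 < t → ∀ z, |heatSmooth ν t z - (2 * Real.pi)⁻¹ * fourierDensity ν z| ≤ δ t := by
  refine ⟨fun t => ∫ w, ‖charFun ν w‖ * (1 - Real.exp (-t * ‖w‖ ^ 2)), ?_, fun t ht z => ?_⟩
  · have h0 : (0 : ℝ) = ∫ w : ℂ, ‖charFun ν w‖ * (1 - Real.exp (-(0 : ℝ) * ‖w‖ ^ 2)) := by simp
    conv => rhs; rw [h0]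
    refine tendsto_integral_filter_of_dominated_convergence (fun w => ‖charFun ν w‖)
      (Eventually.of_forall fun t => Continuous.aestronglyMeasurable (by fun_prop)) ?_ hi.norm
      (Eventually.of_forall fun w => ?_)
    · filter_upwards [self_mem_nhdsWithin] with t ht
      refine Eventually.of_forall fun w => ?_
      have h1 := Real.exp_pos (-t * ‖w‖ ^ 2)
      have h2 : Real.exp (-t * ‖w‖ ^ 2) ≤ 1 := by
        rw [Real.exp_le_one_iff, neg_mul, neg_nonpos]
        have : 0 < t := ht
        positivity
      rw [norm_mul, norm_norm, Real.norm_of_nonneg (by linarith)]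
      exact mul_le_of_le_one_right (norm_nonneg _) (by linarith)
    · refine Tendsto.mono_left ?_ nhdsWithin_le_nhds
      exact Continuous.tendsto (by fun_prop :
        Continuous fun t : ℝ => ‖charFun ν w‖ * (1 - Real.exp (-t * ‖w‖ ^ 2))) 0
  · have hz : ∀ w : ℂ, ‖Complex.exp (-(inner ℝ w z : ℝ) * Complex.I)‖ = 1 := fun w => by
      rw [← Complex.ofReal_neg, Complex.norm_exp_ofReal_mul_I]
    have hi1 : Integrable fun w : ℂ =>
        charFun ν w * Complex.exp (-(inner ℝ w z : ℝ) * Complex.I) :=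
      hi.norm.mono' (Continuous.aestronglyMeasurable (by fun_prop)) (Eventually.of_forall fun w => by
        rw [norm_mul, hz, mul_one])
    have h1 : (2 * Real.pi) ^ 2 * heatSmooth ν t z - 2 * Real.pi * fourierDensity ν z
        = (∫ w : ℂ, (charFun ν w * (Complex.exp (-(inner ℝ w z : ℝ) * Complex.I)
          * Real.exp (-t * ‖w‖ ^ 2)) - charFun ν w * Complex.exp (-(inner ℝ w z : ℝ) * Complex.I))).re := by
      rw [integral_sub (integrable_charFun_mul_exp ν ht z) hi1, ← heatSmooth_eq_fourier ν ht,
        Complex.sub_re, Complex.ofReal_re, fourierDensity]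
      congr 1
      exact mul_inv_cancel_left₀ (by positivity) _
    have h2 : |(2 * Real.pi) ^ 2 * heatSmooth ν t z - 2 * Real.pi * fourierDensity ν z|
        ≤ ∫ w, ‖charFun ν w‖ * (1 - Real.exp (-t * ‖w‖ ^ 2)) := by
      rw [h1]
      refine (Complex.abs_re_le_norm _).trans (norm_integral_le_of_norm_le ?_
        (Eventually.of_forall fun w => ?_))
      · refine hi.norm.mono' (Continuous.aestronglyMeasurable (by fun_prop))
          (Eventually.of_forall fun w => ?_)
        have h1 := Real.exp_pos (-t * ‖w‖ ^ 2)
        have h2 : Real.exp (-t * ‖w‖ ^ 2) ≤ 1 := by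
          rw [Real.exp_le_one_iff, neg_mul, neg_nonpos]
          positivity
        rw [norm_mul, norm_norm, Real.norm_of_nonneg (by linarith)]
        exact mul_le_of_le_one_right (norm_nonneg _) (by linarith)
      · rw [← mul_assoc, ← mul_sub_one, norm_mul, norm_mul, hz, mul_one]
        have h2 : Real.exp (-t * ‖w‖ ^ 2) ≤ 1 := by
          rw [Real.exp_le_one_iff, neg_mul, neg_nonpos]
          positivity
        rw [← Complex.ofReal_one, ← Complex.ofReal_sub, Complex.norm_real, norm_sub_rev,
          Real.norm_of_nonneg (by linarith)]
    have h3 : heatSmooth ν t z - (2 * Real.pi)⁻¹ * fourierDensity ν z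
        = ((2 * Real.pi) ^ 2)⁻¹ *
          ((2 * Real.pi) ^ 2 * heatSmooth ν t z - 2 * Real.pi * fourierDensity ν z) := by
      field_simp
    rw [h3, abs_mul, abs_of_pos (by positivity)]
    refine le_trans (mul_le_of_le_one_left (abs_nonneg _) ?_) h2
    refine inv_le_one_of_one_le₀ (one_le_pow₀ ?_)
    linarith [Real.pi_gt_three]

lemma fourierDensity_nonneg (ν : Measure ℂ) [IsProbabilityMeasure ν]
    (hi : Integrable (charFun ν)) (z : ℂ) : 0 ≤ fourierDensity ν z := by
  obtain ⟨δ, hδ, h⟩ := exists_abs_heatSmooth_sub_fourierDensity_le ν hi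
  have h1 : ∀ᶠ t in 𝓝[>] (0 : ℝ), -δ t ≤ (2 * Real.pi)⁻¹ * fourierDensity ν z := by
    filter_upwards [self_mem_nhdsWithin] with t ht
    have h2 := (abs_le.1 (h t ht z)).2
    have h3 : 0 ≤ heatSmooth ν t z := integral_nonneg fun x => heatKernel_nonneg ht _
    linarith
  have h4 : (0 : ℝ) ≤ (2 * Real.pi)⁻¹ * fourierDensity ν z := by
    refine le_of_tendsto ?_ h1
    simpa using hδ.neg
  have hp : (0 : ℝ) < (2 * Real.pi)⁻¹ := by positivity
  exact nonneg_of_mul_nonneg_right h4 hp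

/-- The rectangle is compared with its smoothed version at collar width r; t → 0 comes first with r
fixed, and then r → 0, with the strip bound controlling the collar. -/
theorem measureReal_closedRect_eq_integral_fourierDensity (ν : Measure ℂ) [IsProbabilityMeasure ν]
    (hi : Integrable (charFun ν)) {E : ℝ}
    (hE : ∀ (e : ℂ), ‖e‖ = 1 → ∀ (x r : ℝ), 0 < r → ν.real {z : ℂ | |inner ℝ z e - x| ≤ r} ≤ E * r)
    (a b c d : ℝ) : ν.real (closedRect a b c d)
      = (2 * Real.pi)⁻¹ * ∫ z in closedRect a b c d, fourierDensity ν z := by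
  obtain ⟨δ, hδ, h⟩ := exists_abs_heatSmooth_sub_fourierDensity_le ν hi
  have hm := measurableSet_closedRect
  have hv := volume_closedRect_ne_top
  have hcM := (continuous_fourierDensity ν hi).const_mul (2 * Real.pi)⁻¹
  set V := (volume : Measure ℂ).real (closedRect a b c d)
  have key : ∀ r, 0 < r → |ν.real (closedRect a b c d)
      - (2 * Real.pi)⁻¹ * ∫ z in closedRect a b c d, fourierDensity ν z| ≤ 4 * E * r := by
    intro r hr
    have htend : Tendsto (fun t : ℝ => 4 * E * r + 2 * Real.exp (-r ^ 2 / (8 * t)) + δ t * V)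
        (𝓝[>] 0) (𝓝 (4 * E * r + 2 * 0 + 0 * V)) := by
      refine ((Tendsto.const_mul 2 (Real.tendsto_exp_atBot.comp ?_)).const_add _).add
        (hδ.mul_const V)
      have h1 : Tendsto (fun t : ℝ => (-r ^ 2 / 8) * t⁻¹) (𝓝[>] 0) atBot :=
        (tendsto_inv_nhdsGT_zero).const_mul_atTop_of_neg (by
          have : 0 < r ^ 2 := by positivity
          linarith)
      refine h1.congr fun t => ?_
      rw [div_mul_eq_div_div, div_eq_mul_inv (-r ^ 2 / 8)]
    rw [mul_zero, zero_mul, add_zero, add_zero] at htend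
    refine ge_of_tendsto htend ?_
    filter_upwards [self_mem_nhdsWithin] with t ht
    have ht' : 0 < t := ht
    have hcν := continuous_heatSmooth ν ht'
    have s3 := abs_le.1 (abs_setIntegral_sub_le hcν hcM (h t ht) a b c d)
    rw [integral_const_mul] at s3
    have s1 := measureReal_closedRect_thicken_le ν hE (a + r) (b - r) (c + r) (d - r) hr
    simp only [add_sub_cancel_right, sub_add_cancel] at s1
    have s2 := measureReal_le_setIntegral_heatSmooth ν ht' hr.le
      (hm (a + r) (b - r) (c + r) (d - r)) (hm a b c d) (hv _ _ _ _) (fun x hx z hz => by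
        have := closedRect_thicken hx hz
        convert this using 2 <;> ring)
    have s4 := measureReal_closedRect_thicken_le ν hE a b c d hr
    have s5 := setIntegral_heatSmooth_le_measureReal ν ht' hr.le (hm a b c d)
      (hm (a - r) (b + r) (c - r) (d + r)) (hv _ _ _ _) (fun x hx z hz => closedRect_thicken hx hz)
    rw [abs_le]
    constructor <;> linarith [s3.1, s3.2]
  have hlim : Tendsto (fun r : ℝ => 4 * E * r) (𝓝[>] 0) (𝓝 0) := by
    refine Tendsto.mono_left ?_ nhdsWithin_le_nhds
    have : Continuous fun r : ℝ => 4 * E * r := by fun_prop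
    simpa using this.tendsto 0
  have h0 : |ν.real (closedRect a b c d)
      - (2 * Real.pi)⁻¹ * ∫ z in closedRect a b c d, fourierDensity ν z| ≤ 0 := by
    refine ge_of_tendsto hlim ?_
    filter_upwards [self_mem_nhdsWithin] with r hr using key r hr
  exact sub_eq_zero.1 (abs_eq_zero.1 (le_antisymm h0 (abs_nonneg _)))

/-! ### Approximation of the Lerch zeta-function by partial sums -/

/-- `e^{2πiλn} (n + y)^{-s}`. -/
def lerchTerm (lam y : ℝ) (s : ℂ) (n : ℕ) : ℂ :=
  Complex.exp (2 * Real.pi * Complex.I * lam * n) * ((n + y : ℝ) : ℂ) ^ (-s)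

/-- `∑_{n ≥ 0} e^{2πiλn} (n + y)^{-s}` for `Re s > 1`. -/
def lerchSeries (lam y : ℝ) (s : ℂ) : ℂ := ∑' n, lerchTerm lam y s n

lemma norm_phase (lam : ℝ) (n : ℕ) : ‖Complex.exp (2 * Real.pi * Complex.I * lam * n)‖ = 1 := by
  have : (2 * Real.pi * Complex.I * lam * n : ℂ) = ((2 * Real.pi * lam * n : ℝ) : ℂ) * Complex.I := by
    push_cast; ring
  rw [this, Complex.norm_exp_ofReal_mul_I]

lemma phase_add (lam : ℝ) (m n : ℕ) : Complex.exp (2 * Real.pi * Complex.I * lam * (m + n : ℕ))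
    = Complex.exp (2 * Real.pi * Complex.I * lam * m)
      * Complex.exp (2 * Real.pi * Complex.I * lam * n) := by
  rw [← Complex.exp_add]; congr 1; push_cast; ring

lemma norm_ofReal_cpow_neg {y : ℝ} (hy : 0 < y) (s : ℂ) : ‖(y : ℂ) ^ (-s)‖ = y ^ (-s.re) := by
  rw [Complex.norm_cpow_eq_rpow_re_of_pos hy, Complex.neg_re]

lemma norm_lerchTerm {y : ℝ} (hy : 0 < y) (lam : ℝ) (s : ℂ) (n : ℕ) :
    ‖lerchTerm lam y s n‖ = (n + y) ^ (-s.re) := by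
  rw [lerchTerm, norm_mul, norm_phase, one_mul, norm_ofReal_cpow_neg (by positivity)]

lemma lerchTerm_eq_div (lam y : ℝ) (s : ℂ) (n : ℕ) :
    Complex.exp (2 * Real.pi * Complex.I * lam * n) / ((n : ℂ) + y) ^ s = lerchTerm lam y s n := by
  rw [lerchTerm, Complex.cpow_neg, div_eq_mul_inv]; push_cast; rfl

lemma lerchTerm_add (lam y : ℝ) (s : ℂ) (m n : ℕ) :
    lerchTerm lam y s (m + n)
      = Complex.exp (2 * Real.pi * Complex.I * lam * m) * lerchTerm lam (m + y) s n := by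
  rw [lerchTerm, lerchTerm, phase_add, mul_assoc]
  congr 3
  push_cast; ring

lemma summable_nat_add_rpow_neg {y a : ℝ} (hy : 0 < y) (ha : 1 < a) :
    Summable fun n : ℕ => ((n : ℝ) + y) ^ (-a) := by
  refine ((Real.summable_one_div_nat_add_rpow y a).2 ha).congr fun n => ?_
  have : 0 < (n : ℝ) + y := by positivity
  rw [abs_of_pos this, Real.rpow_neg this.le, one_div]

lemma summable_lerchTerm {y : ℝ} (hy : 0 < y) (lam : ℝ) {s : ℂ} (hs : 1 < s.re) :
    Summable (lerchTerm lam y s) := by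
  refine Summable.of_norm ((summable_nat_add_rpow_neg hy hs).congr fun n => ?_)
  rw [norm_lerchTerm hy]

lemma norm_lerchSeries_le {y : ℝ} (hy : 1 ≤ y) (lam : ℝ) {s : ℂ} (hs : 2 ≤ s.re) :
    ‖lerchSeries lam y s‖ ≤ 2 * y ^ (1 - s.re) := by
  have hy0 : 0 < y := by linarith
  refine tsum_of_norm_bounded (g := fun n : ℕ => ((n : ℝ) + y) ^ (-s.re))
    (summable_nat_add_rpow_neg hy0 (by linarith)).hasSum (fun n => (norm_lerchTerm hy0 lam s n).le)
    |>.trans ?_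
  refine (summable_nat_add_rpow_neg hy0 (by linarith)).tsum_le_of_sum_range_le fun m => ?_
  -- Telescoping against 1/(n-1+y) - 1/(n+y). The `if` accounts for the empty sum, from which
  -- nothing has been subtracted.
  have h1 : ∀ m : ℕ, ∑ n ∈ Finset.range m, ((n + y) ^ 2)⁻¹ ≤ 2 / y - if m = 0 then 0 else 1 / (m - 1 + y) := by
    intro m
    rcases m with _ | m
    · simp; positivity
    · induction m with
      | zero =>
        simp only [zero_add, Finset.range_one, Finset.sum_singleton, Nat.cast_zero, one_ne_zero,
          if_false, Nat.cast_one, sub_self]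
        have : (y ^ 2)⁻¹ ≤ 1 / y := by
          rw [one_div]; exact inv_anti₀ hy0 (by nlinarith)
        have e : 2 / y - 1 / y = 1 / y := by ring
        linarith
      | succ m ih =>
        rw [Finset.sum_range_succ]
        simp only [Nat.succ_ne_zero, if_false, Nat.cast_succ, add_sub_cancel_right] at ih ⊢
        have hp : 0 < (m : ℝ) + y := by positivity
        have : (((m : ℝ) + 1 + y) ^ 2)⁻¹ ≤ 1 / (m + y) - 1 / (m + 1 + y) := by
          rw [div_sub_div _ _ hp.ne' (by positivity), ← one_div]
          have : 1 * ((m : ℝ) + 1 + y) - (m + y) * 1 = 1 := by ring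
          rw [this]
          exact one_div_le_one_div_of_le (by positivity) (by nlinarith)
        linarith
  calc ∑ n ∈ Finset.range m, ((n : ℝ) + y) ^ (-s.re)
      ≤ ∑ n ∈ Finset.range m, y ^ (2 - s.re) * ((n + y) ^ 2)⁻¹ := by
        refine Finset.sum_le_sum fun n _ => ?_
        have hp : 0 < (n : ℝ) + y := by positivity
        have e : ((n : ℝ) + y) ^ (-s.re) = (n + y) ^ (2 - s.re) * ((n + y) ^ 2)⁻¹ := by
          rw [← Real.rpow_natCast, ← Real.rpow_neg hp.le, ← Real.rpow_add hp]
          congr 1; push_cast; ring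
        rw [e]
        refine mul_le_mul_of_nonneg_right ?_ (by positivity)
        exact Real.rpow_le_rpow_of_nonpos hy0 (by linarith [(Nat.cast_nonneg n : (0 : ℝ) ≤ n)])
          (by linarith)
    _ ≤ y ^ (2 - s.re) * (2 / y) := by
        rw [← Finset.mul_sum]
        refine mul_le_mul_of_nonneg_left ((h1 m).trans ?_) (by positivity)
        split_ifs with h
        · simp
        · have : (1 : ℝ) ≤ m := by exact_mod_cast Nat.one_le_iff_ne_zero.2 h
          have : 0 ≤ 1 / ((m : ℝ) - 1 + y) := by
            apply div_nonneg zero_le_one; linarith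
          linarith
    _ = 2 * y ^ (1 - s.re) := by
        have e : (2 : ℝ) - s.re = (1 - s.re) + 1 := by ring
        rw [e, Real.rpow_add hy0, Real.rpow_one]; field_simp

lemma hasDerivAt_lerchTerm {y : ℝ} (hy : 0 < y) (lam : ℝ) {s : ℂ} (hs : s ≠ 0) (n : ℕ) {u : ℝ}
    (hu : 0 ≤ u) : HasDerivAt (fun u : ℝ => lerchTerm lam (y + u) s n)
      (-s * lerchTerm lam (y + u) (s + 1) n) u := by
  have hp : (n + y) + u ≠ 0 := by positivity
  have h1 := (HasDerivAt.comp_const_add (n + y) u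
    (hasDerivAt_ofReal_cpow_const hp (neg_ne_zero.2 hs))).const_mul
      (Complex.exp (2 * Real.pi * Complex.I * lam * n))
  simp only [lerchTerm, ← add_assoc]
  refine h1.congr_deriv ?_
  rw [show -s - 1 = -(s + 1) by ring]
  ring

/-- The tail `∑_{n ≥ m} (n + y)^{-a}`. -/
def rpowTail (y a : ℝ) (m : ℕ) : ℝ := ∑' n : ℕ, ((n + m : ℕ) + y : ℝ) ^ (-a)

lemma tendsto_rpowTail (y a : ℝ) : Tendsto (rpowTail y a) atTop (𝓝 0) :=
  tendsto_sum_nat_add fun n : ℕ => ((n : ℝ) + y) ^ (-a)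

lemma norm_sum_lerchTerm_le {y : ℝ} (hy : 0 < y) (lam : ℝ) {s : ℂ} (hs : 1 < s.re) {u : ℝ}
    (hu : 0 ≤ u) (m : ℕ) : ‖∑ n ∈ Finset.range m, lerchTerm lam (y + u) s n‖
      ≤ ‖lerchSeries lam (y + u) s‖ + rpowTail y s.re m := by
  have hyu : 0 < y + u := by linarith
  have h1 := (summable_lerchTerm hyu lam hs).sum_add_tsum_nat_add m
  have h2 : ‖∑' n, lerchTerm lam (y + u) s (n + m)‖ ≤ rpowTail y s.re m := by
    refine tsum_of_norm_bounded ((summable_nat_add_iff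
      (f := fun n : ℕ => ((n : ℝ) + y) ^ (-s.re)) m).2 (summable_nat_add_rpow_neg hy hs)).hasSum
      fun n => ?_
    rw [norm_lerchTerm hyu]
    exact Real.rpow_le_rpow_of_nonpos (by positivity) (by linarith) (by linarith)
  have h3 : ∑ n ∈ Finset.range m, lerchTerm lam (y + u) s n
      = lerchSeries lam (y + u) s - ∑' n, lerchTerm lam (y + u) s (n + m) := by
    rw [lerchSeries, ← h1]; ring
  rw [h3]
  exact (norm_sub_le _ _).trans (by linarith)

/-- Differentiating in y replaces s by s + 1 at the cost of a factor s, so a unit shift of y is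
controlled by the series at s + 1. This mechanism drives the whole recursion. -/
lemma norm_sum_lerchTerm_add_sub_le {y : ℝ} (hy : 0 < y) (lam : ℝ) {s : ℂ} (hs : 0 < s.re) {M : ℝ}
    (hM : ∀ u ∈ Icc (0 : ℝ) 1, ‖lerchSeries lam (y + u) (s + 1)‖ ≤ M) (m : ℕ) {u : ℝ}
    (hu : u ∈ Icc (0 : ℝ) 1) :
    ‖∑ n ∈ Finset.range m, lerchTerm lam (y + u) s n - ∑ n ∈ Finset.range m, lerchTerm lam y s n‖
      ≤ ‖s‖ * (M + rpowTail y (s.re + 1) m) := by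
  have hs0 : s ≠ 0 := fun h => by rw [h] at hs; simp at hs
  have hd : ∀ x ∈ Icc (0 : ℝ) 1, HasDerivWithinAt
      (fun u : ℝ => ∑ n ∈ Finset.range m, lerchTerm lam (y + u) s n)
      (∑ n ∈ Finset.range m, -s * lerchTerm lam (y + x) (s + 1) n) (Icc 0 1) x := fun x hx =>
    (HasDerivAt.fun_sum fun n _ => hasDerivAt_lerchTerm hy lam hs0 n hx.1).hasDerivWithinAt
  have hb : ∀ x ∈ Icc (0 : ℝ) 1, ‖∑ n ∈ Finset.range m, -s * lerchTerm lam (y + x) (s + 1) n‖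
      ≤ ‖s‖ * (M + rpowTail y (s.re + 1) m) := fun x hx => by
    rw [← Finset.mul_sum, norm_mul, norm_neg]
    refine mul_le_mul_of_nonneg_left ?_ (norm_nonneg _)
    have := norm_sum_lerchTerm_le hy lam (s := s + 1) (by simp [hs]) hx.1 m
    rw [Complex.add_re, Complex.one_re] at this
    linarith [hM x hx]
  have h0 : (0 : ℝ) ∈ Icc (0 : ℝ) 1 := ⟨le_rfl, zero_le_one⟩
  have h1 := Convex.norm_image_sub_le_of_norm_hasDerivWithin_le hd hb (convex_Icc 0 1) h0 hu
  simp only [add_zero, sub_zero] at h1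
  refine h1.trans (mul_le_of_le_one_right ((norm_nonneg _).trans (hb 0 h0)) ?_)
  rw [Real.norm_of_nonneg hu.1]; exact hu.2

/-! #### Non-integral `λ` -/

lemma sum_range_lerchTerm_add_one (lam y : ℝ) (s : ℂ) (m : ℕ) :
    Complex.exp (2 * Real.pi * Complex.I * lam) * ∑ n ∈ Finset.range m, lerchTerm lam (y + 1) s n
      = ∑ n ∈ Finset.range m, lerchTerm lam y s n + lerchTerm lam y s m - lerchTerm lam y s 0 := by
  rw [← Finset.sum_range_succ, Finset.sum_range_succ', Finset.mul_sum, add_sub_cancel_right]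
  refine Finset.sum_congr rfl fun n _ => ?_
  rw [add_comm n 1, lerchTerm_add]
  push_cast
  rw [mul_one, add_comm y 1]

lemma tendsto_rpow_nat_add_neg {y a : ℝ} (ha : 0 < a) :
    Tendsto (fun m : ℕ => ((m : ℝ) + y) ^ (-a)) atTop (𝓝 0) :=
  (tendsto_rpow_neg_atTop ha).comp (tendsto_atTop_add_const_right _ y tendsto_natCast_atTop_atTop)

/-- With ω = e^{2πiλ} and S the sum, (1-ω)S(y) = y^(-s) + ω(S(y+1) - S(y)), and the difference is
governed by s + 1. For ω ≠ 1 this bounds S. -/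
lemma norm_mul_le_of_tendsto_sum_lerchTerm {y : ℝ} (hy : 0 < y) (lam : ℝ) {s : ℂ} (hs : 0 < s.re)
    {M : ℝ} (hM : ∀ u ∈ Icc (0 : ℝ) 1, ‖lerchSeries lam (y + u) (s + 1)‖ ≤ M) {l : ℂ}
    (hl : Tendsto (fun m => ∑ n ∈ Finset.range m, lerchTerm lam y s n) atTop (𝓝 l)) :
    ‖1 - Complex.exp (2 * Real.pi * Complex.I * lam)‖ * ‖l‖ ≤ y ^ (-s.re) + ‖s‖ * M := by
  set ω := Complex.exp (2 * Real.pi * Complex.I * lam) with hω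
  have hω1 : ‖ω‖ = 1 := by simpa using norm_phase lam 1
  have h1 : ∀ m : ℕ, ‖(1 - ω) * ∑ n ∈ Finset.range m, lerchTerm lam y s n‖
      ≤ ‖s‖ * (M + rpowTail y (s.re + 1) m) + (m + y) ^ (-s.re) + y ^ (-s.re) := by
    intro m
    have h2 := norm_sum_lerchTerm_add_sub_le hy lam hs hM m (u := 1) ⟨zero_le_one, le_rfl⟩
    have h3 := sum_range_lerchTerm_add_one lam y s m
    rw [← hω] at h3
    have h4 : (1 - ω) * ∑ n ∈ Finset.range m, lerchTerm lam y s n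
        = ω * (∑ n ∈ Finset.range m, lerchTerm lam (y + 1) s n
          - ∑ n ∈ Finset.range m, lerchTerm lam y s n) - lerchTerm lam y s m + lerchTerm lam y s 0 := by
      rw [mul_sub, h3]; ring
    rw [h4]
    refine (norm_add_le _ _).trans (add_le_add ((norm_sub_le _ _).trans (add_le_add ?_ ?_)) ?_)
    · rwa [norm_mul, hω1, one_mul]
    · rw [norm_lerchTerm hy]
    · rw [norm_lerchTerm hy]; simp
  have h5 : Tendsto (fun m : ℕ => ‖s‖ * (M + rpowTail y (s.re + 1) m) + ((m : ℝ) + y) ^ (-s.re)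
      + y ^ (-s.re)) atTop (𝓝 (‖s‖ * (M + 0) + 0 + y ^ (-s.re))) :=
    ((((tendsto_rpowTail y (s.re + 1)).const_add M).const_mul ‖s‖).add
      (tendsto_rpow_nat_add_neg hs)).add_const _
  have h6 := le_of_tendsto_of_tendsto' (hl.const_mul (1 - ω)).norm h5 h1
  rw [norm_mul] at h6
  linarith

/-- The shift identity expresses (1-ω) times a partial sum through the series of differences between
y + 1 and y, which converges absolutely for Re s > 0. -/
lemma exists_tendsto_sum_lerchTerm {y : ℝ} (hy : 0 < y) {lam : ℝ}
    (hlam : Complex.exp (2 * Real.pi * Complex.I * lam) ≠ 1) {s : ℂ} (hs : 0 < s.re) :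
    ∃ l, Tendsto (fun m => ∑ n ∈ Finset.range m, lerchTerm lam y s n) atTop (𝓝 l) := by
  set ω := Complex.exp (2 * Real.pi * Complex.I * lam) with hω
  have hs0 : s ≠ 0 := fun h => by rw [h] at hs; simp at hs
  have hsum : Summable fun n => lerchTerm lam (y + 1) s n - lerchTerm lam y s n := by
    refine Summable.of_norm_bounded (g := fun n : ℕ => ‖s‖ * ((n : ℝ) + y) ^ (-(s.re + 1)))
      ((summable_nat_add_rpow_neg hy (by linarith)).mul_left _) fun n => ?_
    have hd : ∀ x ∈ Icc (0 : ℝ) 1, HasDerivWithinAt (fun u : ℝ => lerchTerm lam (y + u) s n)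
        (-s * lerchTerm lam (y + x) (s + 1) n) (Icc 0 1) x := fun x hx =>
      (hasDerivAt_lerchTerm hy lam hs0 n hx.1).hasDerivWithinAt
    have h1 := Convex.norm_image_sub_le_of_norm_hasDerivWithin_le
      (C := ‖s‖ * ((n : ℝ) + y) ^ (-(s.re + 1))) hd (fun x hx => ?_)
      (convex_Icc 0 1) (show (0 : ℝ) ∈ Icc (0 : ℝ) 1 from ⟨le_rfl, zero_le_one⟩)
      (show (1 : ℝ) ∈ Icc (0 : ℝ) 1 from ⟨zero_le_one, le_rfl⟩)
    · simpa using h1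
    · have hx0 := hx.1
      rw [norm_mul, norm_neg, norm_lerchTerm (by positivity), Complex.add_re, Complex.one_re]
      refine mul_le_mul_of_nonneg_left ?_ (norm_nonneg _)
      exact Real.rpow_le_rpow_of_nonpos (by positivity) (by linarith) (by linarith)
  have h2 := hsum.hasSum.tendsto_sum_nat
  have h3 : Tendsto (fun m => lerchTerm lam y s m) atTop (𝓝 0) := by
    rw [tendsto_zero_iff_norm_tendsto_zero]
    simp only [norm_lerchTerm hy]
    exact tendsto_rpow_nat_add_neg hs
  refine ⟨_, (((h2.const_mul ω).sub h3).add_const (lerchTerm lam y s 0)).const_mul (1 - ω)⁻¹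
    |>.congr fun m => ?_⟩
  have h4 := sum_range_lerchTerm_add_one lam y s m
  rw [← hω] at h4
  have hne : 1 - ω ≠ 0 := sub_ne_zero.2 (Ne.symm hlam)
  rw [Finset.sum_sub_distrib, mul_sub, h4, inv_mul_eq_iff_eq_mul₀ hne]
  ring

/-! #### Integral `λ` -/

lemma hasDerivAt_cpow_one_sub {y : ℝ} {s : ℂ} (hs : s ≠ 1) {u : ℝ} (h : y + u ≠ 0) :
    HasDerivAt (fun u : ℝ => ((y + u : ℝ) : ℂ) ^ (1 - s) / (1 - s)) (((y + u : ℝ) : ℂ) ^ (-s)) u := by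
  have hne : 1 - s ≠ 0 := sub_ne_zero.2 (Ne.symm hs)
  have h1 := (HasDerivAt.comp_const_add y u (hasDerivAt_ofReal_cpow_const h hne)).div_const (1 - s)
  refine h1.congr_deriv ?_
  rw [show 1 - s - 1 = -s by ring]
  field_simp

/-- The mean value inequality applied to H(u) - uF(0): the value F(0) against the integral of F over
[0, 1]. -/
lemma norm_sub_sub_le_of_hasDerivAt {H F : ℝ → ℂ} {B : ℝ}
    (hd : ∀ u ∈ Icc (0 : ℝ) 1, HasDerivAt H (F u) u) (hB : ∀ u ∈ Icc (0 : ℝ) 1, ‖F u - F 0‖ ≤ B) :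
    ‖F 0 - (H 1 - H 0)‖ ≤ B := by
  have hd' : ∀ x ∈ Icc (0 : ℝ) 1, HasDerivWithinAt (fun u : ℝ => H u - u * F 0) (F x - F 0)
      (Icc 0 1) x := fun x hx => by
    have h1 : HasDerivAt (fun u : ℝ => (u : ℂ) * F 0) (F 0) x := by
      simpa using (Complex.ofRealCLM.hasDerivAt (x := x)).mul_const (F 0)
    exact ((hd x hx).sub h1).hasDerivWithinAt
  have := Convex.norm_image_sub_le_of_norm_hasDerivWithin_le hd' hB
    (convex_Icc 0 1) (show (0 : ℝ) ∈ Icc (0 : ℝ) 1 from ⟨le_rfl, zero_le_one⟩)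
    (show (1 : ℝ) ∈ Icc (0 : ℝ) 1 from ⟨zero_le_one, le_rfl⟩)
  simp only [Complex.ofReal_one, one_mul, Complex.ofReal_zero, zero_mul, sub_zero, norm_one,
    mul_one] at this
  rwa [norm_sub_rev, sub_right_comm]

/-- For λ = 0 the sum is compared with its integral; the increments of the primitive from y to y + 1
telescope over n, leaving only the two ends. -/
lemma norm_sum_lerchTerm_zero_sub_le {y : ℝ} (hy : 0 < y) {s : ℂ} (hs : 0 < s.re) (hs1 : s ≠ 1)
    {M : ℝ} (hM : ∀ u ∈ Icc (0 : ℝ) 1, ‖lerchSeries 0 (y + u) (s + 1)‖ ≤ M) (m : ℕ) :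
    ‖∑ n ∈ Finset.range m, lerchTerm 0 y s n
      - (((m + y : ℝ) : ℂ) ^ (1 - s) / (1 - s) - (y : ℂ) ^ (1 - s) / (1 - s))‖
      ≤ ‖s‖ * (M + rpowTail y (s.re + 1) m) := by
  have hterm : ∀ (x : ℝ) (n : ℕ), lerchTerm 0 x s n = ((n + x : ℝ) : ℂ) ^ (-s) := by
    intro x n; simp [lerchTerm]
  have h := norm_sub_sub_le_of_hasDerivAt
    (H := fun u : ℝ => ∑ n ∈ Finset.range m, ((n + y + u : ℝ) : ℂ) ^ (1 - s) / (1 - s))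
    (F := fun u : ℝ => ∑ n ∈ Finset.range m, lerchTerm 0 (y + u) s n)
    (B := ‖s‖ * (M + rpowTail y (s.re + 1) m)) (fun u hu => ?_) (fun u hu => ?_)
  · simp only [add_zero] at h
    rw [← Finset.sum_sub_distrib] at h
    have e : ∑ n ∈ Finset.range m, (((n + y + 1 : ℝ) : ℂ) ^ (1 - s) / (1 - s)
        - ((n + y : ℝ) : ℂ) ^ (1 - s) / (1 - s))
        = ((m + y : ℝ) : ℂ) ^ (1 - s) / (1 - s) - (y : ℂ) ^ (1 - s) / (1 - s) := by
      have := Finset.sum_range_sub (fun n : ℕ => ((n + y : ℝ) : ℂ) ^ (1 - s) / (1 - s)) m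
      simp only [Nat.cast_zero, zero_add] at this
      rw [← this]
      refine Finset.sum_congr rfl fun n _ => ?_
      congr 4
      push_cast; ring
    rwa [e] at h
  · simp only [hterm, ← add_assoc]
    have hu0 := hu.1
    exact HasDerivAt.fun_sum fun n _ => hasDerivAt_cpow_one_sub hs1 (by positivity)
  · simpa only [add_zero] using norm_sum_lerchTerm_add_sub_le hy 0 hs hM m hu

lemma norm_le_of_tendsto_sum_lerchTerm_zero {y : ℝ} (hy : 0 < y) {s : ℂ} (hs : 0 < s.re)
    (hs1 : 0 < s.im) {M : ℝ} (hM : ∀ u ∈ Icc (0 : ℝ) 1, ‖lerchSeries 0 (y + u) (s + 1)‖ ≤ M) {l : ℂ}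
    (hl : Tendsto (fun m : ℕ => ∑ n ∈ Finset.range m, lerchTerm 0 y s n
      - ((m + y : ℝ) : ℂ) ^ (1 - s) / (1 - s)) atTop (𝓝 l)) :
    ‖l‖ ≤ y ^ (1 - s.re) / s.im + ‖s‖ * M := by
  have hne : s ≠ 1 := fun h => by rw [h] at hs1; simp at hs1
  have h1 := norm_sum_lerchTerm_zero_sub_le hy hs hne hM
  have h5 : Tendsto (fun m : ℕ => ‖s‖ * (M + rpowTail y (s.re + 1) m)) atTop
      (𝓝 (‖s‖ * (M + 0))) := ((tendsto_rpowTail y (s.re + 1)).const_add M).const_mul ‖s‖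
  have h6 := le_of_tendsto_of_tendsto' (hl.add_const ((y : ℂ) ^ (1 - s) / (1 - s))).norm h5
    (fun m => by
      refine le_trans (le_of_eq ?_) (h1 m)
      congr 1; ring)
  rw [add_zero] at h6
  have h7 : ‖(y : ℂ) ^ (1 - s) / (1 - s)‖ ≤ y ^ (1 - s.re) / s.im := by
    rw [norm_div, Complex.norm_cpow_eq_rpow_re_of_pos hy, Complex.sub_re, Complex.one_re]
    refine div_le_div_of_nonneg_left (by positivity) hs1 ?_
    have := Complex.abs_im_le_norm (1 - s)
    rw [Complex.sub_im, Complex.one_im, zero_sub, abs_neg] at this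
    exact (le_abs_self _).trans this
  have h8 := norm_sub_le (l + (y : ℂ) ^ (1 - s) / (1 - s)) ((y : ℂ) ^ (1 - s) / (1 - s))
  rw [add_sub_cancel_right] at h8
  linarith

/-- The difference between a term of the Hurwitz series and the corresponding integral. -/
def hurwitzStep (α : ℝ) (s : ℂ) (n : ℕ) : ℂ :=
  ((n + α : ℝ) : ℂ) ^ (-s)
    - (((n + 1 + α : ℝ) : ℂ) ^ (1 - s) / (1 - s) - ((n + α : ℝ) : ℂ) ^ (1 - s) / (1 - s))

/-- The gain of one power makes the corrected series converge for all Re s > 0, which yields the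
continuation of the Hurwitz zeta-function in a form close to partial sums. -/
lemma norm_hurwitzStep_le {α : ℝ} (hα : 0 < α) {s : ℂ} (hs : 0 < s.re) (hs1 : s ≠ 1) (n : ℕ) :
    ‖hurwitzStep α s n‖ ≤ ‖s‖ * ((n : ℝ) + α) ^ (-(s.re + 1)) := by
  have hs0 : s ≠ 0 := fun h => by rw [h] at hs; simp at hs
  have h := norm_sub_sub_le_of_hasDerivAt
    (H := fun u : ℝ => ((n + α + u : ℝ) : ℂ) ^ (1 - s) / (1 - s))
    (F := fun u : ℝ => ((n + α + u : ℝ) : ℂ) ^ (-s))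
    (B := ‖s‖ * ((n : ℝ) + α) ^ (-(s.re + 1))) (fun u hu => ?_) (fun u hu => ?_)
  · simp only [add_zero] at h
    rw [hurwitzStep, add_right_comm]
    exact h
  · have hu0 := hu.1
    exact hasDerivAt_cpow_one_sub hs1 (by positivity)
  · have hd : ∀ x ∈ Icc (0 : ℝ) 1, HasDerivWithinAt (fun u : ℝ => ((n + α + u : ℝ) : ℂ) ^ (-s))
        (-s * ((n + α + x : ℝ) : ℂ) ^ (-s - 1)) (Icc 0 1) x := fun x hx => by
      have hx0 := hx.1
      exact (HasDerivAt.comp_const_add (n + α) x (hasDerivAt_ofReal_cpow_const (by positivity)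
        (neg_ne_zero.2 hs0))).hasDerivWithinAt
    have h0 : (0 : ℝ) ∈ Icc (0 : ℝ) 1 := ⟨le_rfl, zero_le_one⟩
    have h1 := Convex.norm_image_sub_le_of_norm_hasDerivWithin_le
      (C := ‖s‖ * ((n : ℝ) + α) ^ (-(s.re + 1))) hd (fun x hx => ?_) (convex_Icc 0 1) h0 hu
    · refine h1.trans (mul_le_of_le_one_right (by positivity) ?_)
      rw [sub_zero, Real.norm_of_nonneg hu.1]; exact hu.2
    · have hx0 := hx.1
      rw [norm_mul, norm_neg, Complex.norm_cpow_eq_rpow_re_of_pos (by positivity)]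
      refine mul_le_mul_of_nonneg_left ?_ (norm_nonneg _)
      have : (-s - 1).re = -(s.re + 1) := by
        rw [Complex.sub_re, Complex.neg_re, Complex.one_re]; ring
      rw [this]
      exact Real.rpow_le_rpow_of_nonpos (by positivity) (by linarith) (by linarith)

lemma sum_hurwitzStep {α : ℝ} (s : ℂ) (m : ℕ) :
    -((α : ℂ) ^ (1 - s) / (1 - s)) + ∑ n ∈ Finset.range m, hurwitzStep α s n
      = ∑ n ∈ Finset.range m, lerchTerm 0 α s n - ((m + α : ℝ) : ℂ) ^ (1 - s) / (1 - s) := by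
  have := Finset.sum_range_sub (fun n : ℕ => ((n + α : ℝ) : ℂ) ^ (1 - s) / (1 - s)) m
  simp only [Nat.cast_zero, zero_add, Nat.cast_succ] at this
  simp only [hurwitzStep, Finset.sum_sub_distrib] at this ⊢
  rw [this]
  have e : ∀ n : ℕ, lerchTerm 0 α s n = ((n + α : ℝ) : ℂ) ^ (-s) := by
    intro n; simp [lerchTerm]
  simp only [e]
  ring

/-- The open first quadrant. -/
def quadrant : Set ℂ := {s | 0 < s.re ∧ 0 < s.im}

lemma isOpen_quadrant : IsOpen quadrant :=
  (isOpen_lt continuous_const Complex.continuous_re).inter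
    (isOpen_lt continuous_const Complex.continuous_im)

lemma ne_one_of_mem_quadrant {s : ℂ} (hs : s ∈ quadrant) : s ≠ 1 := fun h => by
  have := hs.2
  rw [h] at this
  simp at this

lemma isPreconnected_quadrant : IsPreconnected quadrant := by
  refine Convex.isPreconnected ?_
  exact (convex_halfSpace_re_gt 0).inter (convex_halfSpace_im_gt 0)

lemma differentiableOn_hurwitzStep {α : ℝ} (hα : 0 < α) (n : ℕ) :
    DifferentiableOn ℂ (fun s => hurwitzStep α s n) quadrant := by
  intro s hs
  have hne : 1 - s ≠ 0 := sub_ne_zero.2 (Ne.symm (ne_one_of_mem_quadrant hs))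
  have h1 : ((n + α : ℝ) : ℂ) ≠ 0 := by exact_mod_cast (by positivity : (n : ℝ) + α ≠ 0)
  have h2 : ((n + 1 + α : ℝ) : ℂ) ≠ 0 := by exact_mod_cast (by positivity : (n : ℝ) + 1 + α ≠ 0)
  refine DifferentiableAt.differentiableWithinAt ?_
  unfold hurwitzStep
  refine DifferentiableAt.sub ?_ (DifferentiableAt.sub ?_ ?_)
  · exact DifferentiableAt.const_cpow (by fun_prop) (Or.inl h1)
  · exact (DifferentiableAt.const_cpow (by fun_prop) (Or.inl h2)).div (by fun_prop) hne
  · exact (DifferentiableAt.const_cpow (by fun_prop) (Or.inl h1)).div (by fun_prop) hne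

lemma summable_hurwitzStep {α : ℝ} (hα : 0 < α) {s : ℂ} (hs : s ∈ quadrant) :
    Summable (hurwitzStep α s) :=
  Summable.of_norm_bounded ((summable_nat_add_rpow_neg hα (by linarith [hs.1])).mul_left ‖s‖)
    fun n => norm_hurwitzStep_le hα hs.1 (ne_one_of_mem_quadrant hs) n

lemma differentiableOn_tsum_hurwitzStep {α : ℝ} (hα : 0 < α) :
    DifferentiableOn ℂ (fun s => ∑' n, hurwitzStep α s n) quadrant := by
  intro s₀ hs₀
  set c := s₀.re / 2 with hc
  have hc0 : 0 < c := half_pos hs₀.1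
  set R := ‖s₀‖ + 1 with hR
  set U : Set ℂ := quadrant ∩ ({s | c < s.re} ∩ {s | ‖s‖ < R}) with hU
  have hUo : IsOpen U := isOpen_quadrant.inter
    ((isOpen_lt continuous_const Complex.continuous_re).inter
      (isOpen_lt continuous_norm continuous_const))
  have hs₀U : s₀ ∈ U := ⟨hs₀, by
    change s₀.re / 2 < s₀.re
    linarith [hs₀.1], by
    change ‖s₀‖ < ‖s₀‖ + 1
    linarith⟩
  have hd : DifferentiableOn ℂ (fun s => ∑' n, hurwitzStep α s n) U := by
    refine Complex.differentiableOn_tsum_of_summable_norm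
      -- Two exponents are needed because n + α may be below 1 (at n = 0), where the power grows as
      -- Re s increases.
      (u := fun n : ℕ => R * (((n : ℝ) + α) ^ (-(c + 1)) + ((n : ℝ) + α) ^ (-(R + 1))))
      (((summable_nat_add_rpow_neg hα (by linarith)).add (summable_nat_add_rpow_neg hα
        (by linarith [norm_nonneg s₀]))).mul_left R)
      (fun n => (differentiableOn_hurwitzStep hα n).mono inter_subset_left) hUo fun n s hs => ?_
    obtain ⟨hq, hsc, hsR⟩ := hs
    have hsc' : c < s.re := hsc
    have hsR' : ‖s‖ < R := hsR
    refine (norm_hurwitzStep_le hα hq.1 (ne_one_of_mem_quadrant hq) n).trans ?_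
    have hp : 0 < (n : ℝ) + α := by positivity
    refine mul_le_mul hsR'.le ?_ (by positivity) (by positivity)
    rcases le_total 1 ((n : ℝ) + α) with h1 | h1
    · have := Real.rpow_le_rpow_of_exponent_le h1 (by linarith : -(s.re + 1) ≤ -(c + 1))
      have h2 : 0 ≤ ((n : ℝ) + α) ^ (-(R + 1)) := by positivity
      linarith
    · have h3 : s.re ≤ R := (Complex.re_le_norm s).trans hsR'.le
      have := Real.rpow_le_rpow_of_exponent_ge hp h1 (by linarith : -(R + 1) ≤ -(s.re + 1))
      have h2 : 0 ≤ ((n : ℝ) + α) ^ (-(c + 1)) := by positivity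
      linarith
  exact ((hd s₀ hs₀U).differentiableAt (hUo.mem_nhds hs₀U)).differentiableWithinAt

lemma tendsto_sum_lerchTerm_sub_of_one_lt {y : ℝ} (hy : 0 < y) {s : ℂ} (hs : 1 < s.re) :
    Tendsto (fun m : ℕ => ∑ n ∈ Finset.range m, lerchTerm 0 y s n
      - ((m + y : ℝ) : ℂ) ^ (1 - s) / (1 - s)) atTop (𝓝 (lerchSeries 0 y s)) := by
  have h1 := (summable_lerchTerm hy 0 hs).hasSum.tendsto_sum_nat
  have h2 : Tendsto (fun m : ℕ => ((m + y : ℝ) : ℂ) ^ (1 - s) / (1 - s)) atTop (𝓝 0) := by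
    have h3 : Tendsto (fun m : ℕ => ((m + y : ℝ) : ℂ) ^ (1 - s)) atTop (𝓝 0) := by
      rw [tendsto_zero_iff_norm_tendsto_zero]
      refine (tendsto_rpow_nat_add_neg (y := y) (sub_pos.2 hs)).congr fun m => ?_
      rw [Complex.norm_cpow_eq_rpow_re_of_pos (by positivity), Complex.sub_re, Complex.one_re,
        neg_sub]
    simpa using h3.div_const (1 - s)
  simpa [lerchSeries] using h1.sub h2

/-- Identity theorem from Re s > 1. The open quadrant is convex and avoids the pole at 1, and it
contains all the points needed, since only t > 0 matters. -/
lemma hurwitzZeta_eq_of_mem_quadrant {α : ℝ} (hα : 0 < α) (hα1 : α ≤ 1) {s : ℂ}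
    (hs : s ∈ quadrant) : HurwitzZeta.hurwitzZeta (α : UnitAddCircle) s
      = -((α : ℂ) ^ (1 - s) / (1 - s)) + ∑' n, hurwitzStep α s n := by
  have hα0 : (α : ℂ) ≠ 0 := by exact_mod_cast hα.ne'
  have hf : DifferentiableOn ℂ (fun s => HurwitzZeta.hurwitzZeta (α : UnitAddCircle) s) quadrant :=
    fun s hs => (HurwitzZeta.differentiableAt_hurwitzZeta _
      (ne_one_of_mem_quadrant hs)).differentiableWithinAt
  have hg : DifferentiableOn ℂ
      (fun s => -((α : ℂ) ^ (1 - s) / (1 - s)) + ∑' n, hurwitzStep α s n) quadrant := by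
    refine DifferentiableOn.add (fun s hs => ?_) (differentiableOn_tsum_hurwitzStep hα)
    have hne : 1 - s ≠ 0 := sub_ne_zero.2 (Ne.symm (ne_one_of_mem_quadrant hs))
    exact (((DifferentiableAt.const_cpow (by fun_prop) (Or.inl hα0)).div
      (by fun_prop) hne).neg).differentiableWithinAt
  have hz : (2 + Complex.I : ℂ) ∈ quadrant := by constructor <;> simp
  refine AnalyticOnNhd.eqOn_of_preconnected_of_eventuallyEq (hf.analyticOnNhd isOpen_quadrant)
    (hg.analyticOnNhd isOpen_quadrant) isPreconnected_quadrant hz ?_ hs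
  have hU : IsOpen (quadrant ∩ {s : ℂ | 1 < s.re}) :=
    isOpen_quadrant.inter (isOpen_lt continuous_const Complex.continuous_re)
  filter_upwards [hU.mem_nhds ⟨hz, by simp⟩] with s hs
  have hs1 : 1 < s.re := hs.2
  have h1 := tendsto_sum_lerchTerm_sub_of_one_lt hα hs1
  have h2 := ((summable_hurwitzStep hα hs.1).hasSum.tendsto_sum_nat).const_add
    (-((α : ℂ) ^ (1 - s) / (1 - s)))
  simp only [sum_hurwitzStep] at h2
  rw [← tendsto_nhds_unique h1 h2, lerchSeries,
    ← (HurwitzZeta.hasSum_hurwitzZeta_of_one_lt_re ⟨hα.le, hα1⟩ hs1).tsum_eq]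
  refine tsum_congr fun n => ?_
  rw [← lerchTerm_eq_div]; simp

/-! #### The two cases together -/

lemma phase_eq_one_iff (lam : ℝ) :
    Complex.exp (2 * Real.pi * Complex.I * lam) = 1 ↔ ∃ k : ℤ, lam = k := by
  rw [Complex.exp_eq_one_iff]
  refine exists_congr fun k => ?_
  have hne : (2 * Real.pi * Complex.I : ℂ) ≠ 0 := Complex.two_pi_I_ne_zero
  constructor
  · intro h
    have : (lam : ℂ) = k := mul_left_cancel₀ hne (by rw [h]; ring)
    exact_mod_cast this
  · intro h
    rw [h]; push_cast; ring

lemma lerchTerm_eq_zero_of_phase {lam : ℝ} (h : Complex.exp (2 * Real.pi * Complex.I * lam) = 1)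
    (y : ℝ) (s : ℂ) (n : ℕ) : lerchTerm lam y s n = lerchTerm 0 y s n := by
  have : Complex.exp (2 * Real.pi * Complex.I * lam * n) = 1 := by
    rw [mul_comm _ (n : ℂ), Complex.exp_nat_mul, h, one_pow]
  simp [lerchTerm, this]

/-- One step of the recursion for the tails of the Lerch series. -/
lemma exists_lerch_step (lam : ℝ) : ∃ c : ℝ, 2 ≤ c ∧
    (∀ (s : ℂ) (y M : ℝ), 1 < s.re → 0 < s.im → 0 < y → s.im ≤ y →
      (∀ u ∈ Icc (0 : ℝ) 1, ‖lerchSeries lam (y + u) (s + 1)‖ ≤ M) →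
      ‖lerchSeries lam y s‖ ≤ c * (y ^ (1 - s.re) * (1 / s.im) + ‖s‖ * M)) ∧
    ∀ (s : ℂ) (α M : ℝ) (Q : ℕ), 0 < α → α ≤ 1 → 0 < s.re → 0 < s.im → s.im ≤ Q + α →
      (∀ u ∈ Icc (0 : ℝ) 1, ‖lerchSeries lam (Q + α + u) (s + 1)‖ ≤ M) →
      ‖lerchZeta lam α s - ∑ n ∈ Finset.range Q, lerchTerm lam α s n‖
        ≤ c * ((Q + α) ^ (1 - s.re) * (1 / s.im) + ‖s‖ * M) := by
  set ω := Complex.exp (2 * Real.pi * Complex.I * lam) with hω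
  by_cases h1 : ω = 1
  · have hS : ∀ y s, lerchSeries lam y s = lerchSeries 0 y s := fun y s =>
      tsum_congr fun n => lerchTerm_eq_zero_of_phase h1 y s n
    -- For integral λ the constant 1 would do; 2 is taken only to meet the normalisation 2 ≤ c,
    -- which the base case of the recursion uses.
    have hup : ∀ {x A : ℝ}, x ≤ A → 0 ≤ x → x ≤ 2 * A := fun h h' => by linarith
    refine ⟨2, le_rfl, fun s y M hs him hy _ hM => ?_, fun s α M Q hα hα1 hs him _ hM => ?_⟩
    · simp only [hS] at hM ⊢
      refine hup ?_ (norm_nonneg _)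
      rw [mul_one_div]
      exact norm_le_of_tendsto_sum_lerchTerm_zero hy (by linarith) him hM
        (tendsto_sum_lerchTerm_sub_of_one_lt hy hs)
    · simp only [hS] at hM
      refine hup ?_ (norm_nonneg _)
      rw [mul_one_div]
      refine norm_le_of_tendsto_sum_lerchTerm_zero (by positivity) hs him hM ?_
      have hq : s ∈ quadrant := ⟨hs, him⟩
      have hL : lerchZeta lam α s = -((α : ℂ) ^ (1 - s) / (1 - s)) + ∑' n, hurwitzStep α s n := by
        rw [lerchZeta, if_pos ((phase_eq_one_iff lam).1 h1), hurwitzZeta_eq_of_mem_quadrant hα hα1 hq]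
      have h2 := ((summable_hurwitzStep hα hq).hasSum.tendsto_sum_nat).const_add
        (-((α : ℂ) ^ (1 - s) / (1 - s)))
      simp only [sum_hurwitzStep] at h2
      rw [← hL] at h2
      refine ((h2.comp (tendsto_add_atTop_nat Q)).sub_const
        (∑ n ∈ Finset.range Q, lerchTerm lam α s n)).congr fun m => ?_
      simp only [Function.comp, lerchTerm_eq_zero_of_phase h1]
      rw [add_comm m Q, Finset.sum_range_add, Nat.cast_add]
      have e : ∀ n, lerchTerm 0 α s (Q + n) = lerchTerm 0 (Q + α) s n := by
        intro n; rw [lerchTerm_add]; simp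
      simp only [e]
      rw [show (Q : ℝ) + m + α = m + (Q + α) by ring]
      ring
  · have hne : 0 < ‖1 - ω‖ := norm_pos_iff.2 (sub_ne_zero.2 (Ne.symm h1))
    -- The hypothesis Im s ≤ y turns y^(-σ) into y^(1-σ)/Im s, so both cases share one form of the
    -- bound.
    have key : ∀ (s : ℂ) (y M : ℝ) (l : ℂ), 0 < s.re → 0 < s.im → 0 < y → s.im ≤ y →
        ‖1 - ω‖ * ‖l‖ ≤ y ^ (-s.re) + ‖s‖ * M → 0 ≤ M →
        ‖l‖ ≤ (2 + ‖1 - ω‖⁻¹) * (y ^ (1 - s.re) * (1 / s.im) + ‖s‖ * M) := by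
      intro s y M l hs him hy hy' h hM
      have h2 : y ^ (-s.re) ≤ y ^ (1 - s.re) * (1 / s.im) := by
        rw [mul_one_div, le_div_iff₀ him, show 1 - s.re = -s.re + 1 by ring, Real.rpow_add hy,
          Real.rpow_one]
        gcongr
      have h3 : ‖l‖ ≤ ‖1 - ω‖⁻¹ * (y ^ (1 - s.re) * (1 / s.im) + ‖s‖ * M) := by
        rw [← div_eq_inv_mul, le_div_iff₀ hne, mul_comm]
        linarith
      have h4 : 0 ≤ y ^ (1 - s.re) * (1 / s.im) + ‖s‖ * M := by positivity
      rw [add_mul]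
      linarith
    refine ⟨2 + ‖1 - ω‖⁻¹, by linarith [inv_pos.2 hne], fun s y M hs him hy hy' hM => ?_,
      fun s α M Q hα hα1 hs him hy' hM => ?_⟩
    · refine key s y M _ (by linarith) him hy hy' ?_
        ((norm_nonneg _).trans (hM 0 ⟨le_rfl, zero_le_one⟩))
      exact norm_mul_le_of_tendsto_sum_lerchTerm hy lam (by linarith) hM
        (summable_lerchTerm hy lam hs).hasSum.tendsto_sum_nat
    · obtain ⟨l, hl⟩ := exists_tendsto_sum_lerchTerm (y := Q + α) (by positivity) h1 hs
      have h5 : lerchZeta lam α s = ∑ n ∈ Finset.range Q, lerchTerm lam α s n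
          + Complex.exp (2 * Real.pi * Complex.I * lam * Q) * l := by
        rw [lerchZeta, if_neg (fun h => h1 ((phase_eq_one_iff lam).2 h))]
        refine Tendsto.limUnder_eq ?_
        simp only [lerchTerm_eq_div]
        rw [← tendsto_add_atTop_iff_nat Q]
        refine ((hl.const_mul (Complex.exp (2 * Real.pi * Complex.I * lam * Q))).const_add
          (∑ n ∈ Finset.range Q, lerchTerm lam α s n)).congr fun m => ?_
        rw [add_comm m Q, Finset.sum_range_add, Finset.mul_sum]
        simp only [lerchTerm_add]
      rw [h5, add_sub_cancel_left, norm_mul, norm_phase, one_mul]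
      refine key s _ M _ hs him (by positivity) hy' ?_
        ((norm_nonneg _).trans (hM 0 ⟨le_rfl, zero_le_one⟩))
      exact norm_mul_le_of_tendsto_sum_lerchTerm (by positivity) lam hs hM hl

/-- Each step passes from s + 1 back to s at the price of ‖s‖/y ≤ ρ/x, while the main error
y^(1-σ)/Im s keeps its shape. After k steps the trivial bound for Re s ≥ 2 is damped by (ρ/x)^k. -/
lemma lerchSeries_recursion (lam : ℝ) {c : ℝ} (hc : 2 ≤ c)
    (hstep : ∀ (s : ℂ) (y M : ℝ), 1 < s.re → 0 < s.im → 0 < y → s.im ≤ y →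
      (∀ u ∈ Icc (0 : ℝ) 1, ‖lerchSeries lam (y + u) (s + 1)‖ ≤ M) →
      ‖lerchSeries lam y s‖ ≤ c * (y ^ (1 - s.re) * (1 / s.im) + ‖s‖ * M)) {x ρ : ℝ} (hx : 1 ≤ x)
    (hρ : ρ ≤ x) (k : ℕ) : ∀ (s : ℂ), 1 < s.re → 2 ≤ s.re + k → 0 < s.im → ‖s‖ + k ≤ ρ →
      ∀ y, x ≤ y → ‖lerchSeries lam y s‖
        ≤ c * (2 * c) ^ k * (y ^ (1 - s.re) * (1 / s.im + (ρ / x) ^ k)) := by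
  induction k with
  | zero =>
    intro s hs hs2 him _ y hy
    have hy1 : 1 ≤ y := hx.trans hy
    refine (norm_lerchSeries_le hy1 lam (by simpa using hs2)).trans ?_
    have h1 : 0 ≤ y ^ (1 - s.re) := by positivity
    have h2 : 0 ≤ 1 / s.im := by positivity
    simp only [pow_zero, mul_one]
    refine mul_le_mul hc ?_ h1 (by linarith)
    nlinarith
  | succ k ih =>
    intro s hs hs2 him hsρ y hy
    have hy0 : 0 < y := by linarith
    have hsn := norm_nonneg s
    push_cast at hs2 hsρ
    have hk0 : (0 : ℝ) ≤ k := Nat.cast_nonneg k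
    have hρ0 : 0 ≤ ρ := by linarith
    have him' : s.im ≤ ‖s‖ := (le_abs_self _).trans (Complex.abs_im_le_norm s)
    set β := 1 / s.im with hβ
    have hβ0 : 0 ≤ β := by positivity
    set C := c * (2 * c) ^ k with hC
    have hC1 : 1 ≤ C := by
      have : (1 : ℝ) ≤ (2 * c) ^ k := one_le_pow₀ (by linarith)
      nlinarith
    have hM : ∀ u ∈ Icc (0 : ℝ) 1, ‖lerchSeries lam (y + u) (s + 1)‖
        ≤ C * (y ^ (-s.re) * (β + (ρ / x) ^ k)) := by
      intro u hu
      have hns : ‖s + 1‖ ≤ ‖s‖ + 1 := (norm_add_le _ _).trans (by simp)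
      have h1 := ih (s + 1) (by simp; linarith) (by simp; linarith) (by simpa using him)
        (by linarith) (y + u) (by linarith [hu.1])
      have e1 : (s + 1).im = s.im := by simp
      have e2 : 1 - (s + 1).re = -s.re := by simp
      rw [e1, e2] at h1
      refine h1.trans ?_
      refine mul_le_mul_of_nonneg_left (mul_le_mul_of_nonneg_right ?_ (by positivity)) (by positivity)
      exact Real.rpow_le_rpow_of_nonpos hy0 (by linarith [hu.1]) (by linarith)
    refine (hstep s y _ hs him hy0 (by linarith) hM).trans ?_
    have e3 : y ^ (1 - s.re) = y ^ (-s.re) * y := by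
      rw [show 1 - s.re = -s.re + 1 by ring, Real.rpow_add hy0, Real.rpow_one]
    rw [e3]
    set P := y ^ (-s.re)
    have hP : 0 ≤ P := by positivity
    have hq : ρ / x * x = ρ := by field_simp
    have hq0 : 0 ≤ ρ / x := by positivity
    have hq1 : ρ / x ≤ 1 := (div_le_one (by linarith)).2 hρ
    set q := ρ / x
    have h2 : ‖s‖ ≤ q * y := by nlinarith
    have h4 : ‖s‖ * (β + q ^ k) ≤ y * (β + q ^ (k + 1)) := by
      have h5 : ‖s‖ * (β + q ^ k) ≤ (q * y) * (β + q ^ k) :=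
        mul_le_mul_of_nonneg_right h2 (by positivity)
      have h6 : q * β ≤ β := mul_le_of_le_one_left hβ0 hq1
      calc _ ≤ (q * y) * (β + q ^ k) := h5
        _ = y * (q * β + q ^ (k + 1)) := by ring
        _ ≤ _ := by gcongr
    have h7 : P * y * β + ‖s‖ * (C * (P * (β + q ^ k))) ≤ 2 * C * (P * y * (β + q ^ (k + 1))) := by
      have h8 : ‖s‖ * (C * (P * (β + q ^ k))) = C * P * (‖s‖ * (β + q ^ k)) := by ring
      have h9 := mul_le_mul_of_nonneg_left h4 (by positivity : 0 ≤ C * P)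
      have h10 : P * y * β ≤ C * (P * y * (β + q ^ (k + 1))) := by
        have h11 : P * y * β ≤ P * y * (β + q ^ (k + 1)) :=
          mul_le_mul_of_nonneg_left (by have : 0 ≤ q ^ (k + 1) := by positivity
                                        linarith) (by positivity)
        have h12 : 0 ≤ P * y * (β + q ^ (k + 1)) := by positivity
        nlinarith
      rw [h8]
      linarith
    calc c * (P * y * β + ‖s‖ * (C * (P * (β + q ^ k))))
        ≤ c * (2 * C * (P * y * (β + q ^ (k + 1)))) :=
          mul_le_mul_of_nonneg_left h7 (by linarith)
      _ = _ := by rw [hC]; ring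

/-- Partial sums slightly longer than |s| approximate L: when Q exceeds a power of |s| with exponent
above 1, the term (ρ/Q)^(k+1) is as small as desired for large k, leaving the Q^(1-σ)/t of the
integral's end point. -/
theorem exists_norm_lerchZeta_sub_le (lam : ℝ) (k : ℕ) : ∃ C : ℝ, 0 < C ∧
    ∀ (s : ℂ) (α ρ : ℝ) (Q : ℕ), 0 < α → α ≤ 1 → 0 < s.re → 0 < s.im → 1 ≤ Q →
      ‖s‖ + k + 2 ≤ ρ → ρ ≤ Q →
      ‖lerchZeta lam α s - ∑ n ∈ Finset.range Q, lerchTerm lam α s n‖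
        ≤ C * ((Q + α) ^ (1 - s.re) * (1 / s.im + (ρ / Q) ^ (k + 1))) := by
  obtain ⟨c, hc, h1, h2⟩ := exists_lerch_step lam
  refine ⟨c * (1 + c * (2 * c) ^ (k + 1)), by positivity, fun s α ρ Q hα hα1 hs him hQ hρ hρQ => ?_⟩
  have hQ1 : (1 : ℝ) ≤ Q := by exact_mod_cast hQ
  have hsn := norm_nonneg s
  have hk0 : (0 : ℝ) ≤ k := Nat.cast_nonneg k
  have him' : s.im ≤ ‖s‖ := (le_abs_self _).trans (Complex.abs_im_le_norm s)
  have hx0 : 0 < (Q : ℝ) + α := by positivity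
  set C := c * (2 * c) ^ (k + 1) with hC
  have hC0 : 0 ≤ C := by positivity
  set q := ρ / Q with hq
  have hq0 : 0 ≤ q := div_nonneg (by linarith) (by linarith)
  have hq1 : q ≤ 1 := (div_le_one (by linarith)).2 hρQ
  set β := 1 / s.im with hβ
  have hβ0 : 0 ≤ β := by positivity
  have hM : ∀ u ∈ Icc (0 : ℝ) 1, ‖lerchSeries lam (Q + α + u) (s + 1)‖
      ≤ C * ((Q + α) ^ (-s.re) * (β + q ^ (k + 1))) := by
    intro u hu
    have hns : ‖s + 1‖ ≤ ‖s‖ + 1 := (norm_add_le _ _).trans (by simp)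
    have h3 := lerchSeries_recursion lam hc h1 hQ1 hρQ (k + 1) (s + 1) (by simp; linarith)
      (by simp; linarith) (by simpa using him) (by push_cast; linarith) (Q + α + u)
      (by linarith [hu.1])
    have e1 : (s + 1).im = s.im := by simp
    have e2 : 1 - (s + 1).re = -s.re := by simp
    rw [e1, e2] at h3
    refine h3.trans ?_
    refine mul_le_mul_of_nonneg_left (mul_le_mul_of_nonneg_right ?_ (by positivity)) (by positivity)
    exact Real.rpow_le_rpow_of_nonpos hx0 (by linarith [hu.1]) (by linarith)
  refine (h2 s α _ Q hα hα1 hs him (by linarith) hM).trans ?_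
  have e3 : ((Q : ℝ) + α) ^ (1 - s.re) = (Q + α) ^ (-s.re) * (Q + α) := by
    rw [show 1 - s.re = -s.re + 1 by ring, Real.rpow_add hx0, Real.rpow_one]
  have hc0 : 0 ≤ c := by linarith
  rw [e3, mul_assoc c (1 + C)]
  refine mul_le_mul_of_nonneg_left ?_ hc0
  set P := ((Q : ℝ) + α) ^ (-s.re)
  have hP : 0 ≤ P := by positivity
  have hB : 0 ≤ β + q ^ (k + 1) := by positivity
  have h4 : P * (Q + α) * β ≤ P * (Q + α) * (β + q ^ (k + 1)) :=
    mul_le_mul_of_nonneg_left (by have : 0 ≤ q ^ (k + 1) := by positivity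
                                  linarith) (by positivity)
  have h5 : ‖s‖ * (C * (P * (β + q ^ (k + 1)))) ≤ C * (P * (Q + α) * (β + q ^ (k + 1))) := by
    calc ‖s‖ * (C * (P * (β + q ^ (k + 1)))) ≤ (Q + α) * (C * (P * (β + q ^ (k + 1)))) := by
          refine mul_le_mul_of_nonneg_right (by linarith) (by positivity)
      _ = _ := by ring
  linarith

/-! ### Mean squares of Dirichlet polynomials -/

/-- Expanding the square, the diagonal gives the first sum and each off-diagonal pair is an
oscillating integral; `G` is any convenient majorant indexed by pairs with m < n. -/
lemma integral_norm_sq_sum_le {T : ℝ} (hT : 0 < T) (s : Finset ℕ) (a : ℕ → ℂ) (f : ℕ → ℝ)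
    (G : ℕ → ℕ → ℝ) (hG : ∀ m n, 0 ≤ G m n)
    (h : ∀ m ∈ s, ∀ n ∈ s, m < n → f n ≠ f m ∧ ‖a m‖ * ‖a n‖ * (2 / (T * |f n - f m|)) ≤ G m n) :
    ∫ t : ℝ, ‖∑ n ∈ s, a n * Complex.exp (f n * t * Complex.I)‖ ^ 2 ∂unifTime T
      ≤ ∑ n ∈ s, ‖a n‖ ^ 2 + 2 * ∑ n ∈ s, ∑ m ∈ s, G m n := by
  have hP := isProbabilityMeasure_unifTime hT
  have e1 : ∀ t : ℝ, ((‖∑ n ∈ s, a n * Complex.exp (f n * t * Complex.I)‖ ^ 2 : ℝ) : ℂ)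
      = ∑ n ∈ s, ∑ m ∈ s, (a n * starRingEnd ℂ (a m)) *
        Complex.exp ((f n - f m : ℝ) * t * Complex.I) := by
    intro t
    rw [Complex.ofReal_pow, ← Complex.mul_conj', map_sum, Finset.sum_mul_sum]
    refine Finset.sum_congr rfl fun n _ => Finset.sum_congr rfl fun m _ => ?_
    rw [map_mul, ← Complex.exp_conj, mul_mul_mul_comm, ← Complex.exp_add]
    congr 2
    simp only [map_mul, Complex.conj_ofReal, Complex.conj_I]
    push_cast
    ring
  have hi : ∀ x : ℝ, Integrable (fun t : ℝ => Complex.exp (x * t * Complex.I)) (unifTime T) := by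
    intro x
    refine (integrable_const (1 : ℝ)).mono' (Continuous.aestronglyMeasurable (by fun_prop))
      (Eventually.of_forall fun t => ?_)
    rw [← Complex.ofReal_mul, Complex.norm_exp_ofReal_mul_I]
  have e2 : ((∫ t : ℝ, ‖∑ n ∈ s, a n * Complex.exp (f n * t * Complex.I)‖ ^ 2 ∂unifTime T : ℝ) : ℂ)
      = ∑ n ∈ s, ∑ m ∈ s, (a n * starRingEnd ℂ (a m)) *
        ∫ t : ℝ, Complex.exp ((f n - f m : ℝ) * t * Complex.I) ∂unifTime T := by
    rw [← integral_complex_ofReal]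
    simp only [e1]
    rw [integral_finsetSum _ fun n _ => integrable_finsetSum _ fun m _ => (hi _).const_mul _]
    refine Finset.sum_congr rfl fun n _ => ?_
    rw [integral_finsetSum _ fun m _ => (hi _).const_mul _]
    exact Finset.sum_congr rfl fun m _ => integral_const_mul _ _
  have h1 : ∫ t : ℝ, ‖∑ n ∈ s, a n * Complex.exp (f n * t * Complex.I)‖ ^ 2 ∂unifTime T
      ≤ ‖((∫ t : ℝ, ‖∑ n ∈ s, a n * Complex.exp (f n * t * Complex.I)‖ ^ 2 ∂unifTime T : ℝ) : ℂ)‖ := by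
    rw [Complex.norm_real]; exact le_abs_self _
  refine h1.trans ?_
  rw [e2]
  have h2 : ∀ n ∈ s, ∀ m ∈ s, ‖(a n * starRingEnd ℂ (a m)) *
        ∫ t : ℝ, Complex.exp ((f n - f m : ℝ) * t * Complex.I) ∂unifTime T‖
      ≤ (if n = m then ‖a n‖ ^ 2 else 0) + G m n + G n m := by
    intro n hn m hm
    rw [norm_mul, norm_mul, RCLike.norm_conj]
    rcases lt_trichotomy n m with hnm | hnm | hnm
    · obtain ⟨h3, h4⟩ := h n hn m hm hnm
      have h5 := norm_integral_unifTime_cexp_le hT (sub_ne_zero.2 h3.symm)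
      rw [if_neg hnm.ne, zero_add]
      rw [abs_sub_comm] at h4
      have h6 := mul_le_mul_of_nonneg_left h5 (by positivity : 0 ≤ ‖a n‖ * ‖a m‖)
      linarith [hG m n]
    · subst hnm
      have h5 : ‖∫ t : ℝ, Complex.exp ((f n - f n : ℝ) * t * Complex.I) ∂unifTime T‖ = 1 := by simp
      rw [h5, if_pos rfl]
      nlinarith [hG n n]
    · obtain ⟨h3, h4⟩ := h m hm n hn hnm
      have h5 := norm_integral_unifTime_cexp_le hT (sub_ne_zero.2 h3)
      rw [if_neg hnm.ne', zero_add]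
      have h6 := mul_le_mul_of_nonneg_left h5 (by positivity : 0 ≤ ‖a n‖ * ‖a m‖)
      rw [mul_comm ‖a m‖] at h4
      linarith [hG n m]
  refine (norm_sum_le_of_le _ fun n hn => norm_sum_le_of_le _ fun m hm => h2 n hn m hm).trans ?_
  simp only [Finset.sum_add_distrib, Finset.sum_ite_eq]
  rw [Finset.sum_comm (f := fun n m => G n m), two_mul]
  have : ∑ n ∈ s, (if n ∈ s then ‖a n‖ ^ 2 else 0) = ∑ n ∈ s, ‖a n‖ ^ 2 :=
    Finset.sum_congr rfl fun n hn => if_pos hn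
  rw [this]
  linarith

/-- `∑_{n ≥ 1} n^{-1-δ}`. -/
def zetaSum (δ : ℝ) : ℝ := ∑' n : ℕ, (n : ℝ) ^ (-(1 + δ))

lemma summable_zetaSum {δ : ℝ} (hδ : 0 < δ) : Summable fun n : ℕ => (n : ℝ) ^ (-(1 + δ)) :=
  Real.summable_nat_rpow.2 (by linarith)

lemma zetaSum_nonneg (δ : ℝ) : 0 ≤ zetaSum δ := tsum_nonneg fun n => by positivity

lemma sum_le_zetaSum {δ : ℝ} (hδ : 0 < δ) (s : Finset ℕ) :
    ∑ n ∈ s, (n : ℝ) ^ (-(1 + δ)) ≤ zetaSum δ :=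
  (summable_zetaSum hδ).sum_le_tsum s fun n _ => by positivity

lemma sum_inv_Ico_le {K Q : ℕ} (hK : 1 ≤ K) {n : ℕ} (hn : n ≤ Q) :
    ∑ m ∈ Finset.Ico K n, (1 : ℝ) / m ≤ 1 + Real.log Q := by
  have h1 := harmonic_le_one_add_log Q
  have h2 : ∑ m ∈ Finset.Ico K n, (1 : ℝ) / m ≤ ∑ m ∈ Finset.Icc 1 Q, (1 : ℝ) / m := by
    refine Finset.sum_le_sum_of_subset_of_nonneg (fun m hm => ?_) fun m _ _ => by positivity
    rw [Finset.mem_Ico] at hm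
    rw [Finset.mem_Icc]; omega
  rw [harmonic_eq_sum_Icc] at h1
  push_cast at h1
  simp only [one_div] at h2 ⊢
  linarith

lemma sum_inv_sub_Ico_le {K Q : ℕ} (hK : 1 ≤ K) (hQ : 1 ≤ Q) {n : ℕ} (hn : n ≤ Q) :
    ∑ m ∈ Finset.Ico K n, (1 : ℝ) / (n - m : ℝ) ≤ 1 + Real.log Q := by
  refine le_trans (le_of_eq ?_) (sum_inv_Ico_le (K := 1) le_rfl (n := n - K + 1) ?_)
  · rcases le_or_gt n K with h | h
    · rw [Finset.Ico_eq_empty (by omega), Finset.Ico_eq_empty (by omega)]; simp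
    · refine Finset.sum_bij' (fun m _ => n - m) (fun m _ => n - m) ?_ ?_ ?_ ?_ ?_
      · intro m hm; rw [Finset.mem_Ico] at hm ⊢; omega
      · intro m hm; rw [Finset.mem_Ico] at hm ⊢; omega
      · intro m hm; rw [Finset.mem_Ico] at hm; omega
      · intro m hm; rw [Finset.mem_Ico] at hm; omega
      · intro m hm
        rw [Finset.mem_Ico] at hm
        rw [Nat.cast_sub hm.2.le]
  · omega

lemma lerchTerm_eq_mul_exp {α : ℝ} (hα : 0 < α) (lam σ t : ℝ) (n : ℕ) :
    lerchTerm lam α (σ + t * Complex.I) n = lerchTerm lam α σ n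
      * Complex.exp ((-Real.log (n + α) : ℝ) * t * Complex.I) := by
  have hp : ((n + α : ℝ) : ℂ) ≠ 0 := by exact_mod_cast (by positivity : (n : ℝ) + α ≠ 0)
  have h : ((n + α : ℝ) : ℂ) ^ (-(t * Complex.I))
      = Complex.exp ((-Real.log (n + α) : ℝ) * t * Complex.I) := by
    rw [Complex.cpow_def_of_ne_zero hp, ← Complex.ofReal_log (by positivity), Complex.ofReal_neg]
    congr 1
    ring
  rw [lerchTerm, lerchTerm, neg_add, Complex.cpow_add _ _ hp, h, mul_assoc (Complex.exp _)]

lemma log_sub_log_ge {α : ℝ} (hα : 0 < α) (hα1 : α ≤ 1) {m n : ℕ} (hm : 1 ≤ m) (hmn : m < n) :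
    ((n : ℝ) - m) / (2 * n) ≤ Real.log (n + α) - Real.log (m + α) := by
  have hm1 : (1 : ℝ) ≤ m := by exact_mod_cast hm
  have hmn' : (m : ℝ) < n := by exact_mod_cast hmn
  have h1 := Real.one_sub_inv_le_log_of_pos (x := ((n : ℝ) + α) / (m + α)) (by positivity)
  rw [Real.log_div (by positivity) (by positivity), inv_div] at h1
  refine le_trans ?_ h1
  rw [one_sub_div (by positivity), div_le_div_iff₀ (by linarith) (by positivity)]
  have : (n : ℝ) + α ≤ 2 * n := by linarith
  have e : (n : ℝ) + α - (m + α) = n - m := by ring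
  rw [e]
  exact mul_le_mul_of_nonneg_left this (by linarith)

/-- The diagonal gains K^(-δ) from the tail of a convergent series. Off the diagonal, log(n+α) -
log(m+α) is at least (n-m)/(2n), and summing over m < n costs only a logarithm. For Q ≈ T^(1+δ) the
off-diagonal part is about T^(-δ²), because (1+δ)(1-δ) < 1. -/
theorem integral_norm_sq_sum_lerchTerm_le {α σ δ T : ℝ} (hα : 0 < α) (hα1 : α ≤ 1) (hδ : 0 < δ)
    (hδ1 : δ ≤ 1 / 2) (hσ : 1 / 2 + δ ≤ σ) (hT : 0 < T) (lam : ℝ) {K Q : ℕ} (hK : 1 ≤ K)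
    (hQ : 1 ≤ Q) :
    ∫ t : ℝ, ‖∑ n ∈ Finset.Ico K Q, lerchTerm lam α (σ + t * Complex.I) n‖ ^ 2 ∂unifTime T
      ≤ zetaSum δ * (K : ℝ) ^ (-δ)
        + 16 * zetaSum δ * (1 + Real.log Q) * (Q : ℝ) ^ (1 - δ) / T := by
  have hlogQ : 0 ≤ Real.log Q := Real.log_natCast_nonneg Q
  set G : ℕ → ℕ → ℝ := fun m n => if m < n then
    4 / T * ((n : ℝ) ^ (-(2 * δ)) * (1 / m + 1 / (n - m : ℝ))) else 0 with hGdef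
  have hnorm : ∀ n ∈ Finset.Ico K Q, ‖lerchTerm lam α σ n‖ ≤ (n : ℝ) ^ (-(1 / 2 + δ)) := by
    intro n hn
    have hn1 : 1 ≤ n := hK.trans (Finset.mem_Ico.1 hn).1
    have hn1' : (1 : ℝ) ≤ n := by exact_mod_cast hn1
    rw [norm_lerchTerm hα, Complex.ofReal_re]
    calc ((n : ℝ) + α) ^ (-σ) ≤ (n : ℝ) ^ (-σ) :=
          Real.rpow_le_rpow_of_nonpos (by linarith) (by linarith) (by linarith)
      _ ≤ _ := Real.rpow_le_rpow_of_exponent_le hn1' (by linarith)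
  have h := integral_norm_sq_sum_le hT (Finset.Ico K Q) (lerchTerm lam α σ)
    (fun n => -Real.log (n + α)) G (fun m n => ?_) (fun m hm n hn hmn => ?_)
  · simp only [lerchTerm_eq_mul_exp hα]
    refine h.trans (add_le_add ?_ ?_)
    · calc ∑ n ∈ Finset.Ico K Q, ‖lerchTerm lam α σ n‖ ^ 2
          ≤ ∑ n ∈ Finset.Ico K Q, (K : ℝ) ^ (-δ) * (n : ℝ) ^ (-(1 + δ)) := by
            refine Finset.sum_le_sum fun n hn => ?_
            have hKn : (K : ℝ) ≤ n := by exact_mod_cast (Finset.mem_Ico.1 hn).1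
            have hK1 : (1 : ℝ) ≤ K := by exact_mod_cast hK
            have hn0 : (0 : ℝ) < n := by linarith
            have h1 := pow_le_pow_left₀ (norm_nonneg _) (hnorm n hn) 2
            have h2 : ((n : ℝ) ^ (-(1 / 2 + δ))) ^ 2 = (n : ℝ) ^ (-δ) * (n : ℝ) ^ (-(1 + δ)) := by
              rw [← Real.rpow_natCast, ← Real.rpow_mul hn0.le, ← Real.rpow_add hn0]
              congr 1; push_cast; ring
            rw [h2] at h1
            refine h1.trans (mul_le_mul_of_nonneg_right ?_ (by positivity))
            exact Real.rpow_le_rpow_of_nonpos (by linarith) hKn (by linarith)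
        _ ≤ zetaSum δ * (K : ℝ) ^ (-δ) := by
            rw [← Finset.mul_sum, mul_comm]
            exact mul_le_mul_of_nonneg_right (sum_le_zetaSum hδ _) (by positivity)
    · have h1 : ∀ n ∈ Finset.Ico K Q, ∑ m ∈ Finset.Ico K Q, G m n
          ≤ 8 / T * (1 + Real.log Q) * ((Q : ℝ) ^ (1 - δ) * (n : ℝ) ^ (-(1 + δ))) := by
        intro n hn
        have hn' := Finset.mem_Ico.1 hn
        have hn1 : (1 : ℝ) ≤ n := by exact_mod_cast hK.trans hn'.1
        have hnQ : (n : ℝ) ≤ Q := by exact_mod_cast hn'.2.le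
        have h2 : ∑ m ∈ Finset.Ico K Q, G m n = ∑ m ∈ Finset.Ico K n,
            4 / T * ((n : ℝ) ^ (-(2 * δ)) * (1 / m + 1 / (n - m : ℝ))) := by
          simp only [hGdef]
          rw [← Finset.sum_filter]
          refine Finset.sum_congr ?_ fun _ _ => rfl
          ext m
          simp only [Finset.mem_filter, Finset.mem_Ico]
          omega
        rw [h2, ← Finset.mul_sum, ← Finset.mul_sum, Finset.sum_add_distrib]
        have h3 := sum_inv_Ico_le hK hn'.2.le
        have h4 := sum_inv_sub_Ico_le hK hQ hn'.2.le
        have h5 : (n : ℝ) ^ (-(2 * δ)) ≤ (Q : ℝ) ^ (1 - δ) * (n : ℝ) ^ (-(1 + δ)) := by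
          have e : (n : ℝ) ^ (-(2 * δ)) = (n : ℝ) ^ (1 - δ) * (n : ℝ) ^ (-(1 + δ)) := by
            rw [← Real.rpow_add (by linarith)]; congr 1; ring
          rw [e]
          refine mul_le_mul_of_nonneg_right ?_ (by positivity)
          exact Real.rpow_le_rpow (by linarith) hnQ (by linarith)
        have h6 : ∑ m ∈ Finset.Ico K n, (1 : ℝ) / m + ∑ m ∈ Finset.Ico K n, (1 : ℝ) / (n - m : ℝ)
            ≤ 2 * (1 + Real.log Q) := by linarith
        calc _ ≤ 4 / T * (((Q : ℝ) ^ (1 - δ) * (n : ℝ) ^ (-(1 + δ))) * (2 * (1 + Real.log Q))) := by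
              refine mul_le_mul_of_nonneg_left ?_ (by positivity)
              refine (mul_le_mul_of_nonneg_left h6 (by positivity)).trans ?_
              exact mul_le_mul_of_nonneg_right h5 (by positivity)
          _ = _ := by ring
      calc 2 * ∑ n ∈ Finset.Ico K Q, ∑ m ∈ Finset.Ico K Q, G m n
          ≤ 2 * ∑ n ∈ Finset.Ico K Q,
            8 / T * (1 + Real.log Q) * ((Q : ℝ) ^ (1 - δ) * (n : ℝ) ^ (-(1 + δ))) := by
            gcongr with n hn
            exact h1 n hn
        _ = 16 * (1 + Real.log Q) * (Q : ℝ) ^ (1 - δ) / T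
            * ∑ n ∈ Finset.Ico K Q, (n : ℝ) ^ (-(1 + δ)) := by
            rw [← Finset.mul_sum, ← Finset.mul_sum]; ring
        _ ≤ 16 * (1 + Real.log Q) * (Q : ℝ) ^ (1 - δ) / T * zetaSum δ := by
            gcongr
            exact sum_le_zetaSum hδ _
        _ = _ := by ring
  · simp only [hGdef]
    split_ifs with hmn
    · have : (m : ℝ) < n := by exact_mod_cast hmn
      have : 0 < (n : ℝ) - m := by linarith
      positivity
    · exact le_rfl
  · have hm1 : 1 ≤ m := hK.trans (Finset.mem_Ico.1 hm).1
    have hm1' : (1 : ℝ) ≤ m := by exact_mod_cast hm1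
    have hmn' : (m : ℝ) < n := by exact_mod_cast hmn
    have hn0 : (0 : ℝ) < n := by linarith
    have hd : 0 < (n : ℝ) - m := by linarith
    have hl := log_sub_log_ge hα hα1 hm1 hmn
    have hl0 : 0 < Real.log (n + α) - Real.log (m + α) := lt_of_lt_of_le (by positivity) hl
    refine ⟨fun h => by linarith, ?_⟩
    have e : |-Real.log (n + α) - -Real.log (m + α)| = Real.log (n + α) - Real.log (m + α) := by
      rw [abs_of_neg (by linarith)]; ring
    rw [e, hGdef]
    simp only [if_pos hmn]
    have h1 : 2 / (T * (Real.log (n + α) - Real.log (m + α))) ≤ 4 / T * (n / (n - m)) := by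
      calc 2 / (T * (Real.log (n + α) - Real.log (m + α))) ≤ 2 / (T * ((n - m) / (2 * n))) := by
            gcongr
        _ = _ := by field_simp; norm_num
    have h2 : ‖lerchTerm lam α σ m‖ * ‖lerchTerm lam α σ n‖
        ≤ (m : ℝ) ^ (-(1 / 2 + δ)) * (n : ℝ) ^ (-(1 / 2 + δ)) :=
      mul_le_mul (hnorm m hm) (hnorm n hn) (norm_nonneg _) (by positivity)
    have h3 : (m : ℝ) ^ (-(1 / 2 + δ)) * (n : ℝ) ^ (-(1 / 2 + δ))
        ≤ (n : ℝ) ^ (-(2 * δ)) * (1 / m) := by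
      have e1 : (m : ℝ) ^ (-(1 / 2 + δ)) = (m : ℝ) ^ (1 / 2 - δ) * (1 / m) := by
        rw [show -(1 / 2 + δ) = (1 / 2 - δ) + -1 by ring, Real.rpow_add (by linarith),
          Real.rpow_neg_one, one_div (m : ℝ)]
      have e2 : (n : ℝ) ^ (-(2 * δ)) = (n : ℝ) ^ (1 / 2 - δ) * (n : ℝ) ^ (-(1 / 2 + δ)) := by
        rw [← Real.rpow_add hn0]; congr 1; ring
      rw [e1, e2]
      have h4 : (m : ℝ) ^ (1 / 2 - δ) ≤ (n : ℝ) ^ (1 / 2 - δ) :=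
        Real.rpow_le_rpow (by linarith) hmn'.le (by linarith)
      calc _ = (m : ℝ) ^ (1 / 2 - δ) * ((n : ℝ) ^ (-(1 / 2 + δ)) * (1 / m)) := by ring
        _ ≤ (n : ℝ) ^ (1 / 2 - δ) * ((n : ℝ) ^ (-(1 / 2 + δ)) * (1 / m)) := by gcongr
        _ = _ := by ring
    -- The identity n/(m(n-m)) = 1/m + 1/(n-m) brings the bound into the form of `G`.
    calc _ ≤ ((n : ℝ) ^ (-(2 * δ)) * (1 / m)) * (4 / T * (n / (n - m))) :=
          mul_le_mul (h2.trans h3) h1 (by positivity) (by positivity)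
      _ = 4 / T * ((n : ℝ) ^ (-(2 * δ)) * (1 / m + 1 / (n - m : ℝ))) := by
          field_simp; ring

/-! ### Comparison of characteristic functions -/

/-- Coefficients of the trigonometric polynomial `t ↦ ⟪∑_{n<K} e^{2πiλn} (n+α)^{-σ-it}, w⟫`. -/
def lerchCoeff (lam α σ : ℝ) (K : ℕ) (w : ℂ) (n : Fin K) : ℂ :=
  starRingEnd ℂ w * lerchTerm lam α σ n

lemma norm_lerchCoeff {α : ℝ} (hα : 0 < α) (lam σ : ℝ) (K : ℕ) (w : ℂ) (n : Fin K) :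
    ‖lerchCoeff lam α σ K w n‖ = ‖w‖ * ((n : ℕ) + α : ℝ) ^ (-σ) := by
  rw [lerchCoeff, norm_mul, RCLike.norm_conj, norm_lerchTerm hα, Complex.ofReal_re]

lemma torusSum_lerchCoeff {α : ℝ} (hα : 0 < α) (lam σ : ℝ) (K : ℕ) (w : ℂ) (t : ℝ) :
    torusSum (lerchCoeff lam α σ K w) (fun n => t * -Real.log ((n : ℕ) + α))
      = inner ℝ (∑ n ∈ Finset.range K, lerchTerm lam α (σ + t * Complex.I) n) w := by
  rw [real_inner_comm, Complex.inner, torusSum, ← Complex.re_sum, Finset.sum_mul,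
    Finset.sum_range (fun n => lerchTerm lam α (σ + t * Complex.I) n * starRingEnd ℂ w)]
  congr 1
  refine Finset.sum_congr rfl fun n _ => ?_
  rw [lerchTerm_eq_mul_exp hα, lerchCoeff]
  push_cast
  rw [mul_comm (t : ℂ)]
  ring

lemma charFun_lerchValueMeasure (lam α σ T : ℝ) (w : ℂ) : charFun (lerchValueMeasure lam α σ T) w
    = ∫ t, Complex.exp (inner ℝ (lerchLine lam α σ t) w * Complex.I) ∂unifTime T := by
  have : lerchValueMeasure lam α σ T = (unifTime T).map (lerchLine lam α σ) := by
    rw [lerchValueMeasure, unifTime, Measure.map_smul]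
  rw [this, charFun_apply, integral_map (measurable_lerchLine lam α σ).aemeasurable
    (Continuous.aestronglyMeasurable (by fun_prop))]

lemma norm_cexp_sub_cexp_le (a b : ℝ) :
    ‖Complex.exp (a * Complex.I) - Complex.exp (b * Complex.I)‖ ≤ |a - b| := by
  have h := Real.norm_exp_I_mul_ofReal_sub_one_le (x := a - b)
  have e : Complex.exp (a * Complex.I) - Complex.exp (b * Complex.I)
      = Complex.exp (b * Complex.I) * (Complex.exp (Complex.I * (a - b : ℝ)) - 1) := by
    rw [mul_sub, ← Complex.exp_add, mul_one]
    congr 2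
    push_cast; ring
  rw [e, norm_mul, Complex.norm_exp_ofReal_mul_I, one_mul]
  exact h

lemma unifTime_real_Iic_le {T x : ℝ} (hT : 0 < T) (hx : 0 ≤ x) :
    (unifTime T).real (Iic x) ≤ x / T := by
  have h1 : (volume.restrict (Icc 0 T)) (Iic x) ≤ ENNReal.ofReal x := by
    rw [Measure.restrict_apply measurableSet_Iic]
    refine (measure_mono (t := Icc 0 x) fun t ht => ⟨ht.2.1, ht.1⟩).trans ?_
    rw [Real.volume_Icc, sub_zero]
  have h2 : unifTime T (Iic x) ≤ (ENNReal.ofReal T)⁻¹ * ENNReal.ofReal x := by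
    rw [unifTime, Measure.smul_apply, smul_eq_mul]
    gcongr
  rw [measureReal_def]
  refine (ENNReal.toReal_mono (ENNReal.mul_ne_top (by simpa using hT) ENNReal.ofReal_ne_top) h2).trans
    (le_of_eq ?_)
  rw [ENNReal.toReal_mul, ENNReal.toReal_inv, ENNReal.toReal_ofReal hT.le, ENNReal.toReal_ofReal hx]
  field_simp

/-- The exponential is 1-Lipschitz in the phase, so a first-moment bound on L minus the sum over n <
K suffices. It combines the partial-sum approximation at length Q with the mean square over K ≤ n <
Q. -/
theorem exists_norm_charFun_sub_integral_le (lam : ℝ) (k : ℕ) : ∃ C : ℝ, 0 < C ∧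
    ∀ (α σ δ T V : ℝ) (K Q : ℕ) (w : ℂ), 0 < α → α ≤ 1 → 0 < δ → δ ≤ 1 / 2 → 1 / 2 + δ ≤ σ → 1 ≤ T →
      1 ≤ K → K ≤ Q → σ + T + k + 2 ≤ Q → 0 < V →
      zetaSum δ * (K : ℝ) ^ (-δ) + 16 * zetaSum δ * (1 + Real.log Q) * (Q : ℝ) ^ (1 - δ) / T ≤ V ^ 2 →
      ‖charFun (lerchValueMeasure lam α σ T) w
        - ∫ t : ℝ, Complex.exp (torusSum (lerchCoeff lam α σ K w)
            (fun n => t * -Real.log ((n : ℕ) + α)) * Complex.I) ∂unifTime T‖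
      ≤ 2 * T ^ (-(1 / 4) : ℝ) + ‖w‖ * (C * ((2 * Q) ^ (1 / 2 : ℝ) *
        (T ^ (-(3 / 4) : ℝ) + ((σ + T + k + 2) / Q) ^ (k + 1))) + V) := by
  obtain ⟨C, hC, hCL⟩ := exists_norm_lerchZeta_sub_le lam k
  refine ⟨C, hC, fun α σ δ T V K Q w hα hα1 hδ hδ1 hσ hT hK hKQ hQ hV hVV => ?_⟩
  have hT0 : 0 < T := by linarith
  have hP := isProbabilityMeasure_unifTime hT0
  have hQ1 : 1 ≤ Q := hK.trans hKQ
  have hQ1' : (1 : ℝ) ≤ Q := by exact_mod_cast hQ1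
  set A := C * ((2 * Q) ^ (1 / 2 : ℝ) * (T ^ (-(3 / 4) : ℝ) + ((σ + T + k + 2) / Q) ^ (k + 1))) with hA
  set X : ℝ → ℂ := fun t => ∑ n ∈ Finset.Ico K Q, lerchTerm lam α (σ + t * Complex.I) n with hX
  have hXc : Continuous X := by
    have : X = fun t : ℝ => ∑ n ∈ Finset.Ico K Q, lerchTerm lam α σ n
      * Complex.exp ((-Real.log (n + α) : ℝ) * t * Complex.I) := by
      ext t
      exact Finset.sum_congr rfl fun n _ => lerchTerm_eq_mul_exp hα lam σ t n
    rw [this]; fun_prop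
  have hXb : ∀ t, ‖X t‖ ≤ ∑ n ∈ Finset.Ico K Q, ((n : ℝ) + α) ^ (-σ) := fun t => by
    refine norm_sum_le_of_le _ fun n _ => ?_
    rw [norm_lerchTerm hα]; simp
  have hXi : ∀ p : ℕ, Integrable (fun t => ‖X t‖ ^ p) (unifTime T) := fun p =>
    (integrable_const ((∑ n ∈ Finset.Ico K Q, ((n : ℝ) + α) ^ (-σ)) ^ p)).mono'
      (hXc.norm.pow p).aestronglyMeasurable (Eventually.of_forall fun t => by
        rw [norm_pow, norm_norm]; exact pow_le_pow_left₀ (norm_nonneg _) (hXb t) p)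
  have hX1 : ∫ t, ‖X t‖ ∂unifTime T ≤ V := by
    have h2 := (integral_norm_sq_sum_lerchTerm_le hα hα1 hδ hδ1 hσ hT0 lam hK hQ1).trans hVV
    -- The arithmetic–geometric mean inequality does the work of Cauchy–Schwarz.
    have h3 : ∫ t, ‖X t‖ ∂unifTime T ≤ ∫ t, (V + ‖X t‖ ^ 2 / V) / 2 ∂unifTime T := by
      refine integral_mono (by simpa using hXi 1)
        (((integrable_const V).add ((hXi 2).div_const V)).div_const 2) fun t => ?_
      simp only
      rw [le_div_iff₀ two_pos, ← sub_le_iff_le_add', le_div_iff₀ hV]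
      nlinarith [sq_nonneg (‖X t‖ - V)]
    rw [integral_div, integral_add (integrable_const V) ((hXi 2).div_const V), integral_div] at h3
    have h4 : (∫ t, ‖X t‖ ^ 2 ∂unifTime T) / V ≤ V := by
      rw [div_le_iff₀ hV]; linarith [h2, sq V]
    simp only [integral_const, probReal_univ, one_smul] at h3
    linarith
  rw [charFun_lerchValueMeasure]
  simp only [torusSum_lerchCoeff hα]
  have hS : ∀ t : ℝ, ∑ n ∈ Finset.range Q, lerchTerm lam α (σ + t * Complex.I) n
      = ∑ n ∈ Finset.range K, lerchTerm lam α (σ + t * Complex.I) n + X t := fun t =>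
    (Finset.sum_range_add_sum_Ico _ hKQ).symm
  set Y : ℝ → ℂ := fun t => ∑ n ∈ Finset.range K, lerchTerm lam α (σ + t * Complex.I) n with hY
  have hYc : Continuous Y := by
    have : Y = fun t : ℝ => ∑ n ∈ Finset.range K, lerchTerm lam α σ n
      * Complex.exp ((-Real.log (n + α) : ℝ) * t * Complex.I) := by
      ext t
      exact Finset.sum_congr rfl fun n _ => lerchTerm_eq_mul_exp hα lam σ t n
    rw [this]; fun_prop
  have hi1 : Integrable (fun t => Complex.exp (inner ℝ (lerchLine lam α σ t) w * Complex.I))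
      (unifTime T) := by
    refine (integrable_const (1 : ℝ)).mono' ?_ (Eventually.of_forall fun t => by
      rw [Complex.norm_exp_ofReal_mul_I])
    exact ((by fun_prop : Continuous fun z : ℂ => Complex.exp (inner ℝ z w * Complex.I)).measurable.comp
      (measurable_lerchLine lam α σ)).aestronglyMeasurable
  have hi2 : Integrable (fun t => Complex.exp (inner ℝ (Y t) w * Complex.I)) (unifTime T) :=
    (integrable_const (1 : ℝ)).mono' (Continuous.aestronglyMeasurable (by fun_prop))
      (Eventually.of_forall fun t => by rw [Complex.norm_exp_ofReal_mul_I])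
  rw [← integral_sub hi1 hi2]
  have hT34 : (0 : ℝ) ≤ T ^ (3 / 4 : ℝ) := by positivity
  -- Small t are handled trivially, since the approximation error contains 1/t. Up to T^(3/4) they
  -- have proportion at most T^(-1/4); beyond, Q^(1/2)/t is still small when Q is close to T.
  have hind : Integrable ((Iic (T ^ (3 / 4 : ℝ))).indicator fun _ => (2 : ℝ)) (unifTime T) :=
    (integrable_const (2 : ℝ)).indicator measurableSet_Iic
  have hA0 : 0 ≤ A := by
    have : 0 ≤ (σ + T + k + 2) / Q := by
      have : (0 : ℝ) ≤ k := Nat.cast_nonneg k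
      apply div_nonneg <;> linarith
    positivity
  have hmain : ‖∫ t, (Complex.exp (inner ℝ (lerchLine lam α σ t) w * Complex.I)
      - Complex.exp (inner ℝ (Y t) w * Complex.I)) ∂unifTime T‖
      ≤ ∫ t, ((Iic (T ^ (3 / 4 : ℝ))).indicator (fun _ => (2 : ℝ)) t + ‖w‖ * (A + ‖X t‖)) ∂unifTime T := by
    refine norm_integral_le_of_norm_le (hind.add
      (((integrable_const A).add (by simpa using hXi 1)).const_mul ‖w‖)) ?_
    have hae : ∀ᵐ t ∂unifTime T, t ∈ Icc 0 T :=
      Measure.ae_smul_measure (ae_restrict_mem measurableSet_Icc) _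
    filter_upwards [hae] with t ht
    by_cases htT : t ≤ T ^ (3 / 4 : ℝ)
    · rw [indicator_of_mem (show t ∈ Iic (T ^ (3 / 4 : ℝ)) from htT)]
      have h1 := norm_sub_le (Complex.exp (inner ℝ (lerchLine lam α σ t) w * Complex.I))
        (Complex.exp (inner ℝ (Y t) w * Complex.I))
      rw [Complex.norm_exp_ofReal_mul_I, Complex.norm_exp_ofReal_mul_I] at h1
      have h2 : 0 ≤ ‖w‖ * (A + ‖X t‖) := by positivity
      linarith
    · rw [indicator_of_notMem (show t ∉ Iic (T ^ (3 / 4 : ℝ)) from htT), zero_add]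
      refine (norm_cexp_sub_cexp_le _ _).trans ?_
      rw [← inner_sub_left]
      refine (abs_real_inner_le_norm _ _).trans ?_
      rw [mul_comm]
      refine mul_le_mul_of_nonneg_left ?_ (norm_nonneg _)
      have hT1 : 0 < T ^ (3 / 4 : ℝ) := by positivity
      have ht0 : 0 < t := lt_trans hT1 (not_le.1 htT)
      have hre : ((σ : ℂ) + t * Complex.I).re = σ := by simp
      have him : ((σ : ℂ) + t * Complex.I).im = t := by simp
      have hk0 : (0 : ℝ) ≤ k := Nat.cast_nonneg k
      have hns : ‖(σ : ℂ) + t * Complex.I‖ ≤ σ + T := by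
        refine (norm_add_le _ _).trans (add_le_add (le_of_eq ?_) ?_)
        · rw [Complex.norm_real, Real.norm_of_nonneg (by linarith)]
        · rw [norm_mul, Complex.norm_I, mul_one, Complex.norm_real, Real.norm_of_nonneg ht0.le]
          exact ht.2
      have h1 := hCL (σ + t * Complex.I) α (σ + T + k + 2) Q hα hα1 (by rw [hre]; linarith)
        (by rw [him]; exact ht0) hQ1 (by linarith) hQ
      rw [hre, him, hS] at h1
      have h2 : ‖lerchLine lam α σ t - Y t‖
          ≤ ‖lerchZeta lam α (σ + t * Complex.I) - (Y t + X t)‖ + ‖X t‖ := by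
        have e : lerchLine lam α σ t - Y t
          = (lerchZeta lam α (σ + t * Complex.I) - (Y t + X t)) + X t := by rw [lerchLine]; ring
        rw [e]; exact norm_add_le _ _
      refine h2.trans (add_le_add (h1.trans ?_) le_rfl)
      rw [hA]
      refine mul_le_mul_of_nonneg_left ?_ hC.le
      have h3 : ((Q : ℝ) + α) ^ (1 - σ) ≤ (2 * Q) ^ (1 / 2 : ℝ) := by
        calc ((Q : ℝ) + α) ^ (1 - σ) ≤ ((Q : ℝ) + α) ^ (1 / 2 : ℝ) :=
              Real.rpow_le_rpow_of_exponent_le (by linarith) (by linarith)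
          _ ≤ _ := Real.rpow_le_rpow (by linarith) (by linarith) (by norm_num)
      have h4 : 1 / t ≤ T ^ (-(3 / 4) : ℝ) := by
        rw [Real.rpow_neg hT0.le, ← one_div]
        exact one_div_le_one_div_of_le hT1 (not_le.1 htT).le
      have h5 : 0 ≤ ((σ + T + k + 2) / Q) ^ (k + 1) := by
        refine pow_nonneg (div_nonneg ?_ ?_) _ <;> linarith
      refine mul_le_mul h3 (by linarith) ?_ (by positivity)
      have : 0 ≤ 1 / t := by positivity
      linarith
  refine hmain.trans ?_
  have hXn : Integrable (fun t => ‖X t‖) (unifTime T) := by simpa using hXi 1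
  have hAX : Integrable (fun t => ‖w‖ * (A + ‖X t‖)) (unifTime T) :=
    ((integrable_const A).add hXn).const_mul ‖w‖
  rw [integral_add hind hAX, integral_indicator measurableSet_Iic, integral_const_mul,
    integral_add (integrable_const A) hXn]
  simp only [integral_const, probReal_univ, measureReal_restrict_apply_univ, smul_eq_mul]
  have h6 := unifTime_real_Iic_le hT0 hT34
  have h7 : T ^ (3 / 4 : ℝ) / T = T ^ (-(1 / 4) : ℝ) := by
    rw [div_eq_iff hT0.ne', ← Real.rpow_add_one hT0.ne']; norm_num
  rw [h7] at h6
  have h8 := mul_le_mul_of_nonneg_left hX1 (norm_nonneg w)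
  linarith

/-- Linear independence makes a vanishing frequency force a trivial character; otherwise the lower
bound for signed sums applies, with k ≤ N terms. -/
lemma exponentVec_eq_zero_or_le {α X Ω : ℝ} (hX : 1 ≤ X) (hΩ : 0 ≤ Ω)
    (hlin : LinearIndependent ℚ (fun n : ℕ => Real.log (n + α)))
    (hadm : ∀ (N : ℕ) (n : Fin N → ℕ) (e : Fin N → ℝ),
      (∀ j, (n j : ℝ) ≤ X) → (∀ j, e j = 1 ∨ e j = -1) →
      ∑ j, e j * Real.log (n j + α) ≠ 0 →
      X ^ (-(Ω * (N : ℝ) ^ 2)) ≤ |∑ j, e j * Real.log (n j + α)|)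
    {K N k : ℕ} (hK : (K : ℝ) ≤ X) (hk : k ≤ N) (q : Fin k → Fin K × Bool) :
    exponentVec q = 0 ∨ X ^ (-(Ω * (N : ℝ) ^ 2))
      ≤ |∑ n, (exponentVec q n : ℝ) * -Real.log ((n : ℕ) + α)| := by
  have h1 := sum_exponentVec_mul q (fun n : Fin K => Real.log ((n : ℕ) + α))
  simp only [mul_neg, Finset.sum_neg_distrib, abs_neg]
  by_cases h0 : ∑ n, (exponentVec q n : ℝ) * Real.log ((n : ℕ) + α) = 0
  · left
    have h2 := Fintype.linearIndependent_iff.1 (hlin.comp (Fin.val : Fin K → ℕ) Fin.val_injective)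
      (fun n => (exponentVec q n : ℚ)) (by
        rw [← h0]
        refine Finset.sum_congr rfl fun n _ => ?_
        simp only [Function.comp, Rat.smul_def, Rat.cast_intCast])
    ext n
    exact_mod_cast h2 n
  · right
    rw [h1] at h0 ⊢
    refine le_trans ?_ (hadm k (fun j => ((q j).1 : ℕ)) (fun j => (boolSign (q j).2 : ℝ))
      (fun j => ?_) (fun j => ?_) h0)
    · refine Real.rpow_le_rpow_of_exponent_le hX (neg_le_neg ?_)
      have : (k : ℝ) ≤ N := by exact_mod_cast hk
      gcongr
    · refine le_trans ?_ hK
      exact_mod_cast (q j).1.isLt.le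
    · unfold boolSign; split_ifs <;> simp

/-- The term n = 0 is kept apart, here and for the squares below, because α may be small; all the
others are bounded independently of α. -/
lemma sum_rpow_le {α σ δ : ℝ} (hα : 0 < α) (hδ : 0 < δ) (hσ : 1 / 2 + δ ≤ σ) (K : ℕ) :
    ∑ n ∈ Finset.range K, ((n : ℝ) + α) ^ (-σ) ≤ α ^ (-σ) + K := by
  rcases K with _ | K
  · simp; positivity
  · rw [Finset.sum_range_succ', Nat.cast_zero, zero_add, add_comm]
    refine add_le_add le_rfl ?_
    calc ∑ n ∈ Finset.range K, (((n + 1 : ℕ) : ℝ) + α) ^ (-σ) ≤ ∑ n ∈ Finset.range K, (1 : ℝ) := by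
          refine Finset.sum_le_sum fun n _ => ?_
          refine Real.rpow_le_one_of_one_le_of_nonpos ?_ (by linarith)
          push_cast
          linarith [(Nat.cast_nonneg n : (0 : ℝ) ≤ n)]
      _ ≤ _ := by simp

lemma rpow_sq_le_of_one_le {x α σ δ : ℝ} (hα : 0 < α) (hδ : 0 < δ) (hσ : 1 / 2 + δ ≤ σ)
    (hx : 1 ≤ x) : ((x + α) ^ (-σ)) ^ 2 ≤ x ^ (-δ) * x ^ (-(1 + δ)) := by
  have h0 : 0 < x := by linarith
  rw [← Real.rpow_natCast, ← Real.rpow_mul (by linarith), ← Real.rpow_add h0]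
  calc (x + α) ^ (-σ * (2 : ℕ)) ≤ x ^ (-σ * (2 : ℕ)) := by
        refine Real.rpow_le_rpow_of_nonpos h0 (by linarith) ?_
        push_cast; linarith
    _ ≤ _ := Real.rpow_le_rpow_of_exponent_le hx (by push_cast; linarith)

lemma sum_rpow_sq_le {α σ δ : ℝ} (hα : 0 < α) (hδ : 0 < δ) (hσ : 1 / 2 + δ ≤ σ) (K : ℕ) :
    ∑ n ∈ Finset.range K, (((n : ℝ) + α) ^ (-σ)) ^ 2 ≤ (α ^ (-σ)) ^ 2 + zetaSum δ := by
  have hZ := zetaSum_nonneg δ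
  rcases K with _ | K
  · simp; positivity
  · rw [Finset.sum_range_succ', Nat.cast_zero, zero_add, add_comm]
    refine add_le_add le_rfl ?_
    have h1 := (summable_nat_add_iff 1).2 (summable_zetaSum hδ)
    calc ∑ n ∈ Finset.range K, ((((n + 1 : ℕ) : ℝ) + α) ^ (-σ)) ^ 2
        ≤ ∑ n ∈ Finset.range K, ((n + 1 : ℕ) : ℝ) ^ (-(1 + δ)) := by
          refine Finset.sum_le_sum fun n _ => ?_
          have hx : (1 : ℝ) ≤ (n + 1 : ℕ) := by push_cast; linarith [(Nat.cast_nonneg n : (0 : ℝ) ≤ n)]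
          refine (rpow_sq_le_of_one_le hα hδ hσ hx).trans (mul_le_of_le_one_left (by positivity) ?_)
          exact Real.rpow_le_one_of_one_le_of_nonpos hx (by linarith)
      _ = ∑ n ∈ Finset.Ico 1 (K + 1), (n : ℝ) ^ (-(1 + δ)) := by
          rw [Finset.sum_Ico_eq_sum_range]
          simp only [Nat.add_sub_cancel, add_comm 1]
      _ ≤ _ := sum_le_zetaSum hδ _

lemma summable_rpow_sq {α σ δ : ℝ} (hα : 0 < α) (hδ : 0 < δ) (hσ : 1 / 2 + δ ≤ σ) :
    Summable fun n : ℕ => (((n : ℝ) + α) ^ (-σ)) ^ 2 := by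
  refine (summable_nat_add_rpow_neg (a := σ * 2) hα (by linarith)).congr fun n => ?_
  rw [← Real.rpow_natCast, ← Real.rpow_mul (by positivity)]
  congr 1; push_cast; ring

lemma tsum_rpow_sq_le {α σ δ : ℝ} (hα : 0 < α) (hδ : 0 < δ) (hσ : 1 / 2 + δ ≤ σ) {K : ℕ}
    (hK : 1 ≤ K) : ∑' n : ℕ, (((n + K : ℕ) + α : ℝ) ^ (-σ)) ^ 2 ≤ zetaSum δ * (K : ℝ) ^ (-δ) := by
  have h1 := (summable_nat_add_iff K).2 (summable_zetaSum hδ)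
  have hK1 : (1 : ℝ) ≤ K := by exact_mod_cast hK
  have h2 : ∑' n : ℕ, ((n + K : ℕ) : ℝ) ^ (-(1 + δ)) ≤ zetaSum δ := by
    rw [zetaSum, ← (summable_zetaSum hδ).sum_add_tsum_nat_add K]
    have : 0 ≤ ∑ n ∈ Finset.range K, (n : ℝ) ^ (-(1 + δ)) := Finset.sum_nonneg fun n _ => by positivity
    linarith
  calc ∑' n : ℕ, (((n + K : ℕ) + α : ℝ) ^ (-σ)) ^ 2
      ≤ ∑' n : ℕ, (K : ℝ) ^ (-δ) * ((n + K : ℕ) : ℝ) ^ (-(1 + δ)) := by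
        refine Summable.tsum_le_tsum (fun n => ?_)
          ((summable_nat_add_iff K).2 (summable_rpow_sq hα hδ hσ)) (h1.mul_left _)
        have hn : (K : ℝ) ≤ (n + K : ℕ) := by push_cast; linarith [(Nat.cast_nonneg n : (0 : ℝ) ≤ n)]
        refine (rpow_sq_le_of_one_le hα hδ hσ (by linarith)).trans
          (mul_le_mul_of_nonneg_right ?_ (by positivity))
        exact Real.rpow_le_rpow_of_nonpos (by linarith) hn (by linarith)
    _ = (K : ℝ) ^ (-δ) * ∑' n : ℕ, ((n + K : ℕ) : ℝ) ^ (-(1 + δ)) := tsum_mul_left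
    _ ≤ _ := by
        rw [mul_comm]
        exact mul_le_mul_of_nonneg_right h2 (by positivity)

/-- `P` is the law of `∑ (n + α)^{-σ} e^{iθₙ}` with independent uniform angles `θₙ`. -/
def IsLerchLaw (α σ : ℝ) (P : Measure ℂ) : Prop :=
  ∀ (w : ℂ) (K : ℕ),
    ‖charFun P w - ((∏ n ∈ Finset.range K, circleChar (‖w‖ * ((n : ℝ) + α) ^ (-σ)) : ℝ) : ℂ)‖
      ≤ ‖w‖ ^ 2 / 2 * ∑' n : ℕ, (((n + K : ℕ) + α : ℝ) ^ (-σ)) ^ 2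

lemma exists_isLerchLaw {α σ : ℝ} (hα : 0 < α) (hσ : 1 / 2 < σ) :
    ∃ P : ProbabilityMeasure ℂ, IsLerchLaw α σ P :=
  exists_phaseSeriesLaw (r := fun n : ℕ => ((n : ℝ) + α) ^ (-σ)) (fun n => by positivity)
    (summable_rpow_sq hα (sub_pos.2 hσ) (by linarith))

/-- The error budget, in order: early times, approximation by Q terms, mean square of the tail,
moment comparison, Taylor remainder with u = 2, and truncation of the infinite product. -/
theorem exists_norm_charFun_sub_charFun_le (lam : ℝ) (k : ℕ) : ∃ C : ℝ, 0 < C ∧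
    ∀ (α σ δ T V Ω : ℝ) (K Q N : ℕ) (w : ℂ) (P : Measure ℂ), 0 < α → α ≤ 1 → 0 < δ → δ ≤ 1 / 2 →
      1 / 2 + δ ≤ σ → 1 ≤ T → 1 ≤ K → K ≤ Q → σ + T + k + 2 ≤ Q → 0 < V →
      zetaSum δ * (K : ℝ) ^ (-δ) + 16 * zetaSum δ * (1 + Real.log Q) * (Q : ℝ) ^ (1 - δ) / T ≤ V ^ 2 →
      Even N → 0 ≤ Ω → LinearIndependent ℚ (fun n : ℕ => Real.log (n + α)) →
      (∀ (N : ℕ) (n : Fin N → ℕ) (e : Fin N → ℝ),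
        (∀ j, (n j : ℝ) ≤ K) → (∀ j, e j = 1 ∨ e j = -1) →
        ∑ j, e j * Real.log (n j + α) ≠ 0 →
        (K : ℝ) ^ (-(Ω * (N : ℝ) ^ 2)) ≤ |∑ j, e j * Real.log (n j + α)|) →
      IsLerchLaw α σ P →
      ‖charFun (lerchValueMeasure lam α σ T) w - charFun P w‖
      ≤ 2 * T ^ (-(1 / 4) : ℝ) + ‖w‖ * (C * ((2 * Q) ^ (1 / 2 : ℝ) *
          (T ^ (-(3 / 4) : ℝ) + ((σ + T + k + 2) / Q) ^ (k + 1))) + V)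
        + (N + 1) * (2 / T * (K : ℝ) ^ (Ω * (N : ℝ) ^ 2) * (1 + ‖w‖ * (α ^ (-σ) + K)) ^ N)
        + 4 * 2⁻¹ ^ N * Real.exp (2 * (‖w‖ ^ 2 * ((α ^ (-σ)) ^ 2 + zetaSum δ)))
        + ‖w‖ ^ 2 / 2 * (zetaSum δ * (K : ℝ) ^ (-δ)) := by
  obtain ⟨C, hC, h⟩ := exists_norm_charFun_sub_integral_le lam k
  refine ⟨C, hC, fun α σ δ T V Ω K Q N w P hα hα1 hδ hδ1 hσ hT hK hKQ hQ hV hVV hN hΩ hlin hadm hP => ?_⟩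
  have hT0 : 0 < T := by linarith
  have hK1 : (1 : ℝ) ≤ K := by exact_mod_cast hK
  have h1 := h α σ δ T V K Q w hα hα1 hδ hδ1 hσ hT hK hKQ hQ hV hVV
  have hξ : 0 < (K : ℝ) ^ (-(Ω * (N : ℝ) ^ 2)) := by positivity
  have h2 := norm_integral_cexp_torusSum_sub_le (lerchCoeff lam α σ K w)
    (fun n => -Real.log ((n : ℕ) + α)) hT0 hξ hN
    (fun k hk q => exponentVec_eq_zero_or_le hK1 hΩ hlin hadm le_rfl hk q) two_pos
  simp only [norm_lerchCoeff hα] at h2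
  have h3 := (hP w K).trans (mul_le_mul_of_nonneg_left (tsum_rpow_sq_le hα hδ hσ hK) (by positivity))
  have e1 : ∑ n : Fin K, ‖w‖ * ((n : ℕ) + α : ℝ) ^ (-σ) ≤ ‖w‖ * (α ^ (-σ) + K) := by
    rw [← Finset.mul_sum, ← Finset.sum_range fun n : ℕ => ((n : ℝ) + α) ^ (-σ)]
    exact mul_le_mul_of_nonneg_left (sum_rpow_le hα hδ hσ K) (norm_nonneg _)
  have e2 : ∑ n : Fin K, (‖w‖ * ((n : ℕ) + α : ℝ) ^ (-σ)) ^ 2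
      ≤ ‖w‖ ^ 2 * ((α ^ (-σ)) ^ 2 + zetaSum δ) := by
    simp only [mul_pow]
    rw [← Finset.mul_sum, ← Finset.sum_range fun n : ℕ => (((n : ℝ) + α) ^ (-σ)) ^ 2]
    exact mul_le_mul_of_nonneg_left (sum_rpow_sq_le hα hδ hσ K) (by positivity)
  have e0 : 0 ≤ ∑ n : Fin K, ‖w‖ * ((n : ℕ) + α : ℝ) ^ (-σ) := Finset.sum_nonneg fun n _ => by positivity
  have e3 : ∏ n : Fin K, ((circleChar (‖w‖ * ((n : ℕ) + α : ℝ) ^ (-σ)) : ℝ) : ℂ)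
      = ((∏ n ∈ Finset.range K, circleChar (‖w‖ * ((n : ℝ) + α) ^ (-σ)) : ℝ) : ℂ) := by
    rw [Finset.prod_range]; push_cast; rfl
  rw [e3] at h2
  have h4 : (N + 1 : ℝ) * (2 / (T * (K : ℝ) ^ (-(Ω * (N : ℝ) ^ 2)))
      * (1 + ∑ n : Fin K, ‖w‖ * ((n : ℕ) + α : ℝ) ^ (-σ)) ^ N)
      ≤ (N + 1) * (2 / T * (K : ℝ) ^ (Ω * (N : ℝ) ^ 2) * (1 + ‖w‖ * (α ^ (-σ) + K)) ^ N) := by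
    have e4 : 2 / (T * (K : ℝ) ^ (-(Ω * (N : ℝ) ^ 2))) = 2 / T * (K : ℝ) ^ (Ω * (N : ℝ) ^ 2) := by
      rw [Real.rpow_neg (by linarith)]
      have : 0 < (K : ℝ) ^ (Ω * (N : ℝ) ^ 2) := by positivity
      field_simp
    rw [e4]
    gcongr
  have h5 : 4 * (2 : ℝ)⁻¹ ^ N * Real.exp (2 ^ 2 * (∑ n : Fin K, (‖w‖ * ((n : ℕ) + α : ℝ) ^ (-σ)) ^ 2) / 2)
      ≤ 4 * 2⁻¹ ^ N * Real.exp (2 * (‖w‖ ^ 2 * ((α ^ (-σ)) ^ 2 + zetaSum δ))) := by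
    refine mul_le_mul_of_nonneg_left (Real.exp_le_exp.2 ?_) (by positivity)
    linarith
  set I := ∫ t : ℝ, Complex.exp (torusSum (lerchCoeff lam α σ K w)
            (fun n => t * -Real.log ((n : ℕ) + α)) * Complex.I) ∂unifTime T
  set J := ((∏ n ∈ Finset.range K, circleChar (‖w‖ * ((n : ℝ) + α) ^ (-σ)) : ℝ) : ℂ)
  have h6 : ‖charFun (lerchValueMeasure lam α σ T) w - charFun P w‖
      ≤ ‖charFun (lerchValueMeasure lam α σ T) w - I‖ + ‖I - J‖ + ‖charFun P w - J‖ := by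
    have e : charFun (lerchValueMeasure lam α σ T) w - charFun P w
      = (charFun (lerchValueMeasure lam α σ T) w - I) + (I - J) - (charFun P w - J) := by ring
    rw [e]
    exact (norm_sub_le _ _).trans (add_le_add_left (norm_add_le _ _) _)
  linarith

/-! ### Elementary asymptotics -/

lemma eventually_mul_rpow_le {p q : ℝ} (h : p < q) (D : ℝ) : ∀ᶠ x : ℝ in atTop, D * x ^ p ≤ x ^ q := by
  filter_upwards [(tendsto_rpow_atTop (sub_pos.2 h)).eventually_ge_atTop D, eventually_gt_atTop 0]
    with x hx h0
  calc D * x ^ p ≤ x ^ (q - p) * x ^ p := by gcongr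
    _ = x ^ q := by rw [← Real.rpow_add h0]; congr 1; ring

lemma eventually_mul_exp_neg_rpow_le {c q : ℝ} (hc : 0 < c) (hq : 0 < q) (D p s : ℝ) :
    ∀ᶠ x : ℝ in atTop, D * x ^ p * Real.exp (-(c * x ^ q)) ≤ x ^ s := by
  have h1 := ((isLittleO_exp_neg_mul_rpow_atTop hc ((s - p - 1) / q)).comp_tendsto
    (tendsto_rpow_atTop hq)).bound one_pos
  filter_upwards [h1, eventually_gt_atTop 0, eventually_ge_atTop D] with x hx h0 hD
  simp only [Function.comp, one_mul, Real.norm_of_nonneg (Real.exp_pos _).le] at hx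
  rw [Real.norm_of_nonneg (by positivity), ← Real.rpow_mul h0.le, mul_div_cancel₀ _ hq.ne', neg_mul]
    at hx
  calc D * x ^ p * Real.exp (-(c * x ^ q)) ≤ x * x ^ p * x ^ (s - p - 1) := by gcongr
    _ = x ^ s := by
      rw [mul_comm x, ← Real.rpow_add_one h0.ne', ← Real.rpow_add h0]; congr 1; ring

/-- With x = log T and Q ≈ e^((1+δ)x): Q^(1/2) is at most of order e^(5x/8), while 1/t contributes
e^(-3x/4). The condition on k makes (ρ/Q)^(k+1) smaller still. -/
lemma eventually_head_le {δ : ℝ} (hδ1 : δ ≤ 1 / 4) {k : ℕ} (hk : 2 ≤ δ * (k + 1))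
    {C : ℝ} (hC : 0 < C) (σ₁ : ℝ) :
    ∀ᶠ x : ℝ in atTop, ∀ σ Q W : ℝ, 0 ≤ σ → σ ≤ σ₁ → Real.exp ((1 + δ) * x) ≤ Q →
      Q ≤ 2 * Real.exp ((1 + δ) * x) → 0 ≤ W → W ≤ x →
      W * (C * ((2 * Q) ^ (1 / 2 : ℝ) * (Real.exp x ^ (-(3 / 4) : ℝ)
        + ((σ + Real.exp x + k + 2) / Q) ^ (k + 1)))) ≤ 1 / 8 * x ^ (-1 : ℝ) := by
  filter_upwards [eventually_mul_exp_neg_rpow_le (c := 1 / 8) (q := 1) (by norm_num) one_pos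
    (8 * (C * (2 * (1 + 2 ^ (k + 1))))) 1 (-1), Real.tendsto_exp_atTop.eventually_ge_atTop (σ₁ + k + 2),
    eventually_gt_atTop 0] with x h1 h2 hx σ Q W hσ0 hσ hQ hQ' hW0 hW
  have hQ0 : 0 < Q := (Real.exp_pos _).trans_le hQ
  have e1 : (2 * Q) ^ (1 / 2 : ℝ) ≤ 2 * Real.exp (5 / 8 * x) := by
    calc (2 * Q) ^ (1 / 2 : ℝ) ≤ (2 ^ (2 : ℝ) * Real.exp ((1 + δ) * x)) ^ (1 / 2 : ℝ) := by
          refine Real.rpow_le_rpow (by positivity) ?_ (by norm_num)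
          norm_num; linarith
      _ = 2 * Real.exp ((1 + δ) * x * (1 / 2)) := by
          rw [Real.mul_rpow (by positivity) (by positivity), ← Real.rpow_mul (by norm_num),
            ← Real.exp_mul]
          norm_num
      _ ≤ _ := mul_le_mul_of_nonneg_left (Real.exp_le_exp.2 (by nlinarith)) two_pos.le
  have e2 : Real.exp x ^ (-(3 / 4) : ℝ) = Real.exp (-(3 / 4 * x)) := by
    rw [← Real.exp_mul]; congr 1; ring
  have e3 : ((σ + Real.exp x + k + 2) / Q) ^ (k + 1) ≤ 2 ^ (k + 1) * Real.exp (-(3 / 4 * x)) := by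
    calc ((σ + Real.exp x + k + 2) / Q) ^ (k + 1)
        ≤ (2 * Real.exp (-(δ * x))) ^ (k + 1) := by
          refine pow_le_pow_left₀ (by positivity) ?_ _
          rw [div_le_iff₀ hQ0]
          calc σ + Real.exp x + k + 2 ≤ 2 * Real.exp x := by linarith
            _ = 2 * Real.exp (-(δ * x)) * Real.exp ((1 + δ) * x) := by
              rw [mul_assoc, ← Real.exp_add]; congr 2; ring
            _ ≤ _ := by gcongr
      _ = 2 ^ (k + 1) * Real.exp (-((δ * (k + 1)) * x)) := by
          rw [mul_pow, ← Real.exp_nat_mul]; congr 2; push_cast; ring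
      _ ≤ _ := by gcongr; linarith
  rw [e2]
  simp only [Real.rpow_one] at h1
  have e4 : Real.exp (5 / 8 * x) * Real.exp (-(3 / 4 * x)) = Real.exp (-(1 / 8 * x)) := by
    rw [← Real.exp_add]; congr 1; ring
  calc W * (C * ((2 * Q) ^ (1 / 2 : ℝ) * (Real.exp (-(3 / 4 * x))
        + ((σ + Real.exp x + k + 2) / Q) ^ (k + 1))))
      ≤ x * (C * ((2 * Real.exp (5 / 8 * x)) * (Real.exp (-(3 / 4 * x))
        + 2 ^ (k + 1) * Real.exp (-(3 / 4 * x))))) := by gcongr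
    _ = 1 / 8 * (8 * (C * (2 * (1 + 2 ^ (k + 1)))) * x * Real.exp (-(1 / 8 * x))) := by
      rw [← e4]; ring
    _ ≤ _ := by gcongr

lemma eventually_variance_le {κ δ : ℝ} (hκ : 0 < κ) (hδ : 0 < δ) (hδ1 : δ ≤ 1 / 4) {Z : ℝ} (hZ : 0 ≤ Z) :
    ∀ᶠ x : ℝ in atTop, ∀ K Q : ℝ, Real.exp (x ^ κ) ≤ K → Real.exp ((1 + δ) * x) ≤ Q →
      Q ≤ 2 * Real.exp ((1 + δ) * x) →
      Z * K ^ (-δ) + 16 * Z * (1 + Real.log Q) * Q ^ (1 - δ) / Real.exp x ≤ (x ^ (-2 : ℝ)) ^ 2 := by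
  filter_upwards [eventually_mul_exp_neg_rpow_le hδ hκ (2 * Z) 0 (-4),
    eventually_mul_exp_neg_rpow_le (c := δ ^ 2) (q := 1) (by positivity) one_pos (2 * (16 * Z * 4 * 2)) 1
      (-4), eventually_ge_atTop 1] with x h1 h2 hx K Q hK hQ hQ'
  have hQ0 : 0 < Q := (Real.exp_pos _).trans_le hQ
  have e0 : (x ^ (-2 : ℝ)) ^ 2 = x ^ (-4 : ℝ) := by
    rw [← Real.rpow_natCast, ← Real.rpow_mul (by linarith)]; norm_num
  have e1 : K ^ (-δ) ≤ Real.exp (-(δ * x ^ κ)) := by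
    calc K ^ (-δ) ≤ Real.exp (x ^ κ) ^ (-δ) :=
          Real.rpow_le_rpow_of_nonpos (Real.exp_pos _) hK (by linarith)
      _ = _ := by rw [← Real.exp_mul]; congr 1; ring
  have e2 : 1 + Real.log Q ≤ 4 * x := by
    have h3 := Real.log_le_log hQ0 hQ'
    rw [Real.log_mul (by norm_num) (Real.exp_pos _).ne', Real.log_exp] at h3
    have h4 := Real.log_two_lt_d9
    nlinarith
  have e2' : 0 ≤ 1 + Real.log Q := by
    have h3 := Real.log_le_log (Real.exp_pos _) hQ
    rw [Real.log_exp] at h3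
    nlinarith
  have e3 : Q ^ (1 - δ) / Real.exp x ≤ 2 * Real.exp (-(δ ^ 2 * x)) := by
    rw [div_le_iff₀ (Real.exp_pos _)]
    calc Q ^ (1 - δ) ≤ (2 * Real.exp ((1 + δ) * x)) ^ (1 - δ) :=
          Real.rpow_le_rpow hQ0.le hQ' (by linarith)
      _ = 2 ^ (1 - δ) * Real.exp ((1 + δ) * x * (1 - δ)) := by
          rw [Real.mul_rpow (by norm_num) (Real.exp_pos _).le, ← Real.exp_mul]
      _ ≤ 2 ^ (1 : ℝ) * Real.exp ((1 + δ) * x * (1 - δ)) := by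
          gcongr
          · norm_num
          · linarith
      _ = _ := by
          rw [Real.rpow_one, mul_assoc 2 (Real.exp _), ← Real.exp_add]; congr 2; ring
  rw [Real.rpow_zero, mul_one] at h1
  simp only [Real.rpow_one] at h2
  have e4 : 16 * Z * (1 + Real.log Q) * Q ^ (1 - δ) / Real.exp x
      ≤ 16 * Z * (4 * x) * (2 * Real.exp (-(δ ^ 2 * x))) := by
    rw [mul_div_assoc]; gcongr
  have e5 : Z * K ^ (-δ) ≤ Z * Real.exp (-(δ * x ^ κ)) := by gcongr
  rw [e0]
  linarith

lemma eventually_tail_le {κ δ : ℝ} (hκ : 0 < κ) (hδ : 0 < δ) {Z : ℝ} (hZ : 0 ≤ Z) :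
    ∀ᶠ x : ℝ in atTop, ∀ K W : ℝ, Real.exp (x ^ κ) ≤ K → 0 ≤ W → W ≤ x →
      W ^ 2 / 2 * (Z * K ^ (-δ)) ≤ 1 / 8 * x ^ (-1 : ℝ) := by
  filter_upwards [eventually_mul_exp_neg_rpow_le hδ hκ (4 * Z) 2 (-1), eventually_gt_atTop 0]
    with x h1 hx K W hK hW0 hW
  have e1 : K ^ (-δ) ≤ Real.exp (-(δ * x ^ κ)) := by
    calc K ^ (-δ) ≤ Real.exp (x ^ κ) ^ (-δ) :=
          Real.rpow_le_rpow_of_nonpos (Real.exp_pos _) hK (by linarith)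
      _ = _ := by rw [← Real.exp_mul]; congr 1; ring
  rw [Real.rpow_two] at h1
  calc W ^ 2 / 2 * (Z * K ^ (-δ)) ≤ x ^ 2 / 2 * (Z * Real.exp (-(δ * x ^ κ))) := by
        have : 0 ≤ K := (Real.exp_pos _).le.trans hK
        gcongr
    _ = 1 / 8 * (4 * Z * x ^ 2 * Real.exp (-(δ * x ^ κ))) := by ring
    _ ≤ _ := by gcongr

/-- Here N² is limited by the separation: log K · Ω · N² ≤ 32 x^(1-2κ) and N log(1+W(a+K)) ≤ 12
x^(1/2-κ), both at most x/4 eventually, against the factor e^(-x) from the time average. -/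
lemma eventually_moments_le {κ : ℝ} (hκ : 0 < κ) (hκ1 : κ < 1 / 8) :
    ∀ᶠ x : ℝ in atTop, ∀ (K Ω a W : ℝ) (N : ℕ), 1 ≤ K → K ≤ 2 * Real.exp (x ^ κ) →
      (N : ℝ) ≤ 4 * x ^ (1 / 2 - 2 * κ) → 0 ≤ Ω → Ω ≤ x ^ κ → 0 ≤ a → a ≤ x → 0 ≤ W → W ≤ x →
      (N + 1) * (2 / Real.exp x * K ^ (Ω * (N : ℝ) ^ 2) * (1 + W * (a + K)) ^ N)
        ≤ 1 / 8 * x ^ (-1 : ℝ) := by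
  filter_upwards [eventually_mul_exp_neg_rpow_le (c := 1 / 2) (q := 1) (by norm_num) one_pos
      (8 * (5 * 2)) 1 (-1), eventually_ge_atTop 1,
    eventually_mul_rpow_le (show 1 - 2 * κ < 1 by linarith) (4 * 32),
    eventually_mul_rpow_le (show 1 / 2 - κ < 1 by linarith) (4 * 12),
    eventually_mul_exp_neg_rpow_le (c := 1) (q := κ) one_pos hκ 4 2 0,
    eventually_mul_rpow_le hκ 1] with x h1 hx h2 h3 h4 h5 K Ω a W N hK hK' hN hΩ0 hΩ ha0 ha hW0 hW
  have hx0 : 0 < x := by linarith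
  rw [Real.rpow_one] at h2 h3
  rw [Real.rpow_zero] at h4 h5
  simp only [Real.rpow_one] at h1
  have hlogK : Real.log K ≤ 2 * x ^ κ := by
    have h6 := Real.log_le_log (by linarith) hK'
    rw [Real.log_mul (by norm_num) (Real.exp_pos _).ne', Real.log_exp] at h6
    have h7 := Real.log_two_lt_d9
    linarith
  have hlogK0 : 0 ≤ Real.log K := Real.log_nonneg hK
  have e1 : K ^ (Ω * (N : ℝ) ^ 2) ≤ Real.exp (1 / 4 * x) := by
    rw [Real.rpow_def_of_pos (by linarith)]
    refine Real.exp_le_exp.2 ?_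
    calc Real.log K * (Ω * (N : ℝ) ^ 2)
        ≤ 2 * x ^ κ * (x ^ κ * (4 * x ^ (1 / 2 - 2 * κ)) ^ 2) := by gcongr
      _ = 32 * x ^ (1 - 2 * κ) := by
          have : x ^ (1 - 2 * κ) = x ^ κ * x ^ κ * (x ^ (1 / 2 - 2 * κ)) ^ 2 := by
            rw [← Real.rpow_natCast, ← Real.rpow_mul hx0.le, ← Real.rpow_add hx0, ← Real.rpow_add hx0]
            congr 1; push_cast; ring
          rw [this]; ring
      _ ≤ _ := by linarith
  have e2 : 1 + W * (a + K) ≤ Real.exp (3 * x ^ κ) := by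
    have hE1 : 1 ≤ Real.exp (x ^ κ) := Real.one_le_exp (by positivity)
    have hE : 4 * x ^ 2 ≤ Real.exp (x ^ κ) := by
      rw [Real.rpow_two, one_mul, Real.exp_neg, ← div_eq_mul_inv, div_le_one (Real.exp_pos _)] at h4
      exact h4
    have hEx : x ≤ Real.exp (x ^ κ) := by nlinarith
    have h6 : W * (a + K) ≤ x * (x + 2 * Real.exp (x ^ κ)) := by gcongr
    have h7 : Real.exp (3 * x ^ κ) = Real.exp (x ^ κ) * Real.exp (x ^ κ) * Real.exp (x ^ κ) := by
      rw [← Real.exp_add, ← Real.exp_add]; congr 1; ring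
    rw [h7]
    set E := Real.exp (x ^ κ)
    have h8 : 1 + x * (x + 2 * E) ≤ E * E := by nlinarith
    nlinarith
  have e3 : (1 + W * (a + K)) ^ N ≤ Real.exp (1 / 4 * x) := by
    calc (1 + W * (a + K)) ^ N ≤ Real.exp (3 * x ^ κ) ^ N := by gcongr
      _ = Real.exp (N * (3 * x ^ κ)) := by rw [← Real.exp_nat_mul]
      _ ≤ Real.exp (4 * x ^ (1 / 2 - 2 * κ) * (3 * x ^ κ)) := by gcongr
      _ ≤ Real.exp (1 / 4 * x) := by
          refine Real.exp_le_exp.2 ?_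
          have : x ^ (1 / 2 - κ) = x ^ (1 / 2 - 2 * κ) * x ^ κ := by
            rw [← Real.rpow_add hx0]; congr 1; ring
          rw [this] at h3
          linarith
  have e4 : (N : ℝ) + 1 ≤ 5 * x := by
    have : x ^ (1 / 2 - 2 * κ) ≤ x := by
      calc x ^ (1 / 2 - 2 * κ) ≤ x ^ (1 : ℝ) := Real.rpow_le_rpow_of_exponent_le hx (by linarith)
        _ = x := Real.rpow_one x
    linarith
  have e5 : Real.exp (1 / 4 * x) * Real.exp (1 / 4 * x) / Real.exp x = Real.exp (-(1 / 2 * x)) := by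
    rw [← Real.exp_add, ← Real.exp_sub]; congr 1; ring
  calc (N + 1) * (2 / Real.exp x * K ^ (Ω * (N : ℝ) ^ 2) * (1 + W * (a + K)) ^ N)
      ≤ 5 * x * (2 / Real.exp x * Real.exp (1 / 4 * x) * Real.exp (1 / 4 * x)) := by gcongr
    _ = 1 / 8 * (8 * (5 * 2) * x * Real.exp (-(1 / 2 * x))) := by rw [← e5]; ring
    _ ≤ _ := by gcongr

/-- Here W is limited by N: the exponent 2W²(a²+Z) is at most 4x^(1/2-7κ), eventually below half of
x^(1/2-2κ), while 2^(-N) ≤ exp(-x^(1/2-2κ)). -/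
lemma eventually_remainder_le {κ : ℝ} (hκ : 0 < κ) (hκ1 : κ < 1 / 8) (Z : ℝ) :
    ∀ᶠ x : ℝ in atTop, ∀ (a W : ℝ) (N : ℕ), 2 * x ^ (1 / 2 - 2 * κ) ≤ N → 0 ≤ a → a ≤ x ^ (κ / 2) →
      0 ≤ W → W ≤ x ^ (1 / 4 - 4 * κ) →
      4 * 2⁻¹ ^ N * Real.exp (2 * (W ^ 2 * (a ^ 2 + Z))) ≤ 1 / 8 * x ^ (-1 : ℝ) := by
  filter_upwards [eventually_mul_exp_neg_rpow_le (c := 1 / 2) (q := 1 / 2 - 2 * κ) (by norm_num)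
      (by linarith) 32 0 (-1), eventually_gt_atTop 0,
    eventually_mul_rpow_le hκ Z,
    eventually_mul_rpow_le (show 1 / 2 - 7 * κ < 1 / 2 - 2 * κ by linarith) 8] with
    x h1 hx h2 h3 a W N hN ha0 ha hW0 hW
  rw [Real.rpow_zero, mul_one] at h1 h2
  have e1 : (2 : ℝ)⁻¹ ^ N ≤ Real.exp (-(x ^ (1 / 2 - 2 * κ))) := by
    have h4 : (2 : ℝ)⁻¹ = Real.exp (-Real.log 2) := by rw [Real.exp_neg, Real.exp_log two_pos]
    rw [h4, ← Real.exp_nat_mul]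
    refine Real.exp_le_exp.2 ?_
    have h5 := Real.log_two_gt_d9
    have h6 : (0 : ℝ) ≤ N := Nat.cast_nonneg N
    nlinarith
  have e2 : 2 * (W ^ 2 * (a ^ 2 + Z)) ≤ 1 / 2 * x ^ (1 / 2 - 2 * κ) := by
    have h4 : a ^ 2 + Z ≤ 2 * x ^ κ := by
      have : a ^ 2 ≤ (x ^ (κ / 2)) ^ 2 := by gcongr
      rw [← Real.rpow_natCast (x ^ (κ / 2)), ← Real.rpow_mul hx.le] at this
      have e : κ / 2 * (2 : ℕ) = κ := by push_cast; ring
      rw [e] at this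
      linarith
    have h5 : W ^ 2 ≤ x ^ (1 / 2 - 8 * κ) := by
      calc W ^ 2 ≤ (x ^ (1 / 4 - 4 * κ)) ^ 2 := by gcongr
        _ = _ := by rw [← Real.rpow_natCast, ← Real.rpow_mul hx.le]; congr 1; push_cast; ring
    have h6 : x ^ (1 / 2 - 7 * κ) = x ^ (1 / 2 - 8 * κ) * x ^ κ := by
      rw [← Real.rpow_add hx]; congr 1; ring
    have h7 : W ^ 2 * (a ^ 2 + Z) ≤ x ^ (1 / 2 - 8 * κ) * (2 * x ^ κ) :=
      (mul_le_mul_of_nonneg_left h4 (sq_nonneg W)).trans (by gcongr)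
    rw [h6] at h3
    linarith
  calc 4 * 2⁻¹ ^ N * Real.exp (2 * (W ^ 2 * (a ^ 2 + Z)))
      ≤ 4 * Real.exp (-(x ^ (1 / 2 - 2 * κ))) * Real.exp (1 / 2 * x ^ (1 / 2 - 2 * κ)) := by gcongr
    _ = 1 / 8 * (32 * Real.exp (-(1 / 2 * x ^ (1 / 2 - 2 * κ)))) := by
      rw [mul_assoc, ← Real.exp_add]; ring_nf
    _ ≤ _ := by gcongr

/-! ### Comparison of characteristic functions along `T → ∞` -/

/-- All dependence on α goes into T₀: beyond it α⁻¹, Ω and the bound X(α) are dominated by slowly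
growing functions of T. Every later estimate is then uniform in α. Outside the admissible set the
value of T₀ is immaterial. -/
lemma exists_separation_threshold {κ : ℝ} (hκ : 0 < κ) : ∃ T₀ : ℝ → ℝ, (∀ α, Real.exp 1 ≤ T₀ α) ∧
    ∀ α ∈ admissibleSet, ∀ T, T₀ α ≤ T → α⁻¹ ≤ Real.log (Real.log T) ∧
      ∃ Ω : ℝ, 0 ≤ Ω ∧ Ω ≤ Real.log T ^ κ ∧ ∀ X : ℝ, Real.exp (Real.log T ^ κ) ≤ X →
        ∀ (N : ℕ) (n : Fin N → ℕ) (e : Fin N → ℝ),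
        (∀ j, (n j : ℝ) ≤ X) → (∀ j, e j = 1 ∨ e j = -1) →
        ∑ j, e j * Real.log (n j + α) ≠ 0 →
        X ^ (-(Ω * (N : ℝ) ^ 2)) ≤ |∑ j, e j * Real.log (n j + α)| := by
  have key : ∀ α : ℝ, ∃ T₀ : ℝ, Real.exp 1 ≤ T₀ ∧ (α ∈ admissibleSet → ∀ T, T₀ ≤ T →
      α⁻¹ ≤ Real.log (Real.log T) ∧
      ∃ Ω : ℝ, 0 ≤ Ω ∧ Ω ≤ Real.log T ^ κ ∧ ∀ X : ℝ, Real.exp (Real.log T ^ κ) ≤ X →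
        ∀ (N : ℕ) (n : Fin N → ℕ) (e : Fin N → ℝ),
        (∀ j, (n j : ℝ) ≤ X) → (∀ j, e j = 1 ∨ e j = -1) →
        ∑ j, e j * Real.log (n j + α) ≠ 0 →
        X ^ (-(Ω * (N : ℝ) ^ 2)) ≤ |∑ j, e j * Real.log (n j + α)|) := by
    intro α
    by_cases hα : α ∈ admissibleSet
    · obtain ⟨-, -, -, Ω, hΩ, hX⟩ := hα
      obtain ⟨X₀, hX₀⟩ := eventually_atTop.1 hX
      have t1 : Tendsto (fun T : ℝ => Real.log (Real.log T)) atTop atTop :=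
        Real.tendsto_log_atTop.comp Real.tendsto_log_atTop
      have t2 : Tendsto (fun T : ℝ => Real.log T ^ κ) atTop atTop :=
        (tendsto_rpow_atTop hκ).comp Real.tendsto_log_atTop
      have t3 : Tendsto (fun T : ℝ => Real.exp (Real.log T ^ κ)) atTop atTop :=
        Real.tendsto_exp_atTop.comp t2
      obtain ⟨T₀, hT₀⟩ := eventually_atTop.1 ((t1.eventually_ge_atTop α⁻¹).and
        ((t2.eventually_ge_atTop Ω).and (t3.eventually_ge_atTop X₀)))
      refine ⟨max T₀ (Real.exp 1), le_max_right _ _, fun _ T hT => ?_⟩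
      obtain ⟨h1, h2, h3⟩ := hT₀ T ((le_max_left _ _).trans hT)
      exact ⟨h1, Ω, hΩ.le, h2, fun X hX => hX₀ X (h3.trans hX)⟩
    · exact ⟨Real.exp 1, le_rfl, fun h => absurd h hα⟩
  choose T₀ h1 h2 using key
  exact ⟨T₀, h1, h2⟩

-- The choice of parameters, with x = log T and κ = ε/8: K ≈ exp(x^κ), Q ≈ exp((1+δ)x), N of order
-- x^(1/2-2κ), and |w| ≤ x^(1/4-4κ). The threshold T₁ depends on λ and σ₁ but not on α.
set_option maxHeartbeats 1000000 in
theorem exists_norm_charFun_lerchValueMeasure_sub_le {ε ε₁ : ℝ} (hε : 0 < ε) (hε' : ε < 1 / 4)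
    (hε₁ : 0 < ε₁) : ∃ T₀ : ℝ → ℝ, (∀ α, Real.exp 1 ≤ T₀ α) ∧ ∀ lam σ₁ : ℝ, ∃ T₁ : ℝ,
      ∀ α ∈ admissibleSet, ∀ σ, 1 / 2 + ε₁ ≤ σ → σ ≤ σ₁ → ∀ T, T₀ α ≤ T → T₁ ≤ T →
      ∀ w : ℂ, ‖w‖ ≤ Real.log T ^ (1 / 4 - ε / 2) → ∀ P : Measure ℂ, IsLerchLaw α σ P →
      ‖charFun (lerchValueMeasure lam α σ T) w - charFun P w‖ ≤ Real.log T ^ (-1 : ℝ) := by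
  obtain ⟨κ, hκε⟩ : ∃ κ, κ = ε / 8 := ⟨_, rfl⟩
  have hκ : 0 < κ := by linarith
  have hκ1 : κ < 1 / 8 := by linarith
  obtain ⟨δ, hδε⟩ : ∃ δ, δ = min ε₁ (1 / 4) := ⟨_, rfl⟩
  have hδ : 0 < δ := by rw [hδε]; positivity
  have hδ1 : δ ≤ 1 / 4 := by rw [hδε]; exact min_le_right _ _
  have hδ2 : δ ≤ ε₁ := by rw [hδε]; exact min_le_left _ _
  obtain ⟨T₀, hT₀, hsep⟩ := exists_separation_threshold hκ
  refine ⟨T₀, hT₀, fun lam σ₁ => ?_⟩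
  obtain ⟨k, hk⟩ := exists_nat_ge (2 / δ)
  have hk2 : 2 ≤ δ * (k + 1) := by
    rw [div_le_iff₀ hδ] at hk
    nlinarith
  obtain ⟨C, hC, hmain⟩ := exists_norm_charFun_sub_charFun_le lam k
  have hZ := zetaSum_nonneg δ
  have hall := (eventually_head_le hδ1 hk2 hC σ₁).and <| (eventually_variance_le hκ hδ hδ1 hZ).and <|
    (eventually_tail_le hκ hδ hZ).and <| (eventually_moments_le hκ hκ1).and <|
    (eventually_remainder_le hκ hκ1 (zetaSum δ)).and <| (eventually_ge_atTop (1 : ℝ)).and <|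
    (eventually_mul_exp_neg_rpow_le (c := 1 / 4) (q := 1) (by norm_num) one_pos 16 0 (-1)).and <|
    (eventually_mul_rpow_le (show (-7 / 4 : ℝ) < -1 by norm_num) 8).and <|
    ((isLittleO_log_rpow_rpow_atTop σ₁ (half_pos hκ)).bound one_pos).and <|
    (Real.tendsto_log_atTop.eventually_ge_atTop 1).and <|
    (eventually_mul_exp_neg_rpow_le (c := δ) (q := 1) hδ one_pos (max σ₁ 0 + k + 4) 0 0).and <|
    (eventually_mul_rpow_le (show κ < 1 by linarith) 2)
  obtain ⟨x₁, hx₁⟩ := eventually_atTop.1 hall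
  refine ⟨Real.exp x₁, fun α hα σ hσ hσ1 T hT hT1 w hw P hP => ?_⟩
  have hTpos : 0 < T := (Real.exp_pos _).trans_le hT1
  obtain ⟨x, rfl⟩ : ∃ x, T = Real.exp x := ⟨Real.log T, (Real.exp_log hTpos).symm⟩
  obtain ⟨hinv, Ω, hΩ0, hΩ, hX⟩ := hsep α hα _ hT
  obtain ⟨hα0, hα1, hlin, -⟩ := hα
  rw [Real.log_exp] at *
  obtain ⟨p1, p2, p3, p4, p5, hx, p6, p7, p8, hlogx, p9, p10⟩ := hx₁ x (Real.exp_le_exp.1 hT1)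
  have hx0 : 0 < x := by linarith
  have hσ0 : 0 ≤ σ := by linarith
  -- the coefficient at `n = 0`
  have ha : α ^ (-σ) ≤ x ^ (κ / 2) := by
    have hα2 : 1 ≤ α⁻¹ := (one_le_inv₀ hα0).2 hα1
    rw [one_mul, Real.norm_of_nonneg (by positivity), Real.norm_of_nonneg (by positivity)] at p8
    calc α ^ (-σ) = α⁻¹ ^ σ := by rw [Real.rpow_neg hα0.le, Real.inv_rpow hα0.le]
      _ ≤ α⁻¹ ^ σ₁ := Real.rpow_le_rpow_of_exponent_le hα2 hσ1
      _ ≤ Real.log x ^ σ₁ := Real.rpow_le_rpow (by positivity) hinv (by linarith)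
      _ ≤ _ := p8
  have ha' : α ^ (-σ) ≤ x := by
    refine ha.trans ?_
    calc x ^ (κ / 2) ≤ x ^ (1 : ℝ) := Real.rpow_le_rpow_of_exponent_le hx (by linarith)
      _ = x := Real.rpow_one x
  have hwx' : ‖w‖ ≤ x ^ (1 / 4 - 4 * κ) := by rw [hκε]; convert hw using 2; ring
  have hwx4 : ‖w‖ ≤ x ^ (1 / 4 : ℝ) :=
    hwx'.trans (Real.rpow_le_rpow_of_exponent_le hx (by linarith))
  have hwx : ‖w‖ ≤ x := by
    refine hwx4.trans ?_
    calc x ^ (1 / 4 : ℝ) ≤ x ^ (1 : ℝ) := Real.rpow_le_rpow_of_exponent_le hx (by norm_num)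
      _ = x := Real.rpow_one x
  -- the lengths of the sums and the number of moments
  have hceil : ∀ y : ℝ, 1 ≤ y → y ≤ (⌈y⌉₊ : ℝ) ∧ (⌈y⌉₊ : ℝ) ≤ 2 * y := fun y hy =>
    ⟨Nat.le_ceil y, by linarith [Nat.ceil_lt_add_one (show 0 ≤ y by linarith)]⟩
  obtain ⟨hK, hK'⟩ := hceil (Real.exp (x ^ κ)) (Real.one_le_exp (by positivity))
  obtain ⟨hQ, hQ'⟩ := hceil (Real.exp ((1 + δ) * x)) (Real.one_le_exp (by positivity))
  obtain ⟨hM, hM'⟩ := hceil (x ^ (1 / 2 - 2 * κ)) (Real.one_le_rpow hx (by linarith))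
  set K := ⌈Real.exp (x ^ κ)⌉₊
  set Q := ⌈Real.exp ((1 + δ) * x)⌉₊
  set M := ⌈x ^ (1 / 2 - 2 * κ)⌉₊
  have hK1 : (1 : ℝ) ≤ K := (Real.one_le_exp (by positivity)).trans hK
  have hKN : 1 ≤ K := by exact_mod_cast hK1
  have hKQ : K ≤ Q := by
    refine Nat.ceil_le_ceil (Real.exp_le_exp.2 ?_)
    have : 0 ≤ x ^ κ := by positivity
    rw [Real.rpow_one] at p10
    nlinarith
  have hQbig : σ + Real.exp x + k + 2 ≤ Q := by
    refine le_trans ?_ hQ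
    simp only [Real.rpow_zero, mul_one, Real.rpow_one] at p9
    have h1 : max σ₁ 0 + k + 4 ≤ Real.exp (δ * x) := by
      rw [Real.exp_neg, ← div_eq_mul_inv, div_le_one (Real.exp_pos _)] at p9
      exact p9
    have h2 : Real.exp ((1 + δ) * x) = Real.exp x * Real.exp (δ * x) := by
      rw [← Real.exp_add]; congr 1; ring
    have h3 : σ ≤ max σ₁ 0 := hσ1.trans (le_max_left _ _)
    have h4 : 1 ≤ Real.exp x := Real.one_le_exp hx0.le
    have h5 : (0 : ℝ) ≤ k := Nat.cast_nonneg k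
    have h6 : (0 : ℝ) ≤ max σ₁ 0 := le_max_right _ _
    rw [h2]
    calc σ + Real.exp x + k + 2 ≤ Real.exp x + 1 * (max σ₁ 0 + k + 3) := by linarith
      _ ≤ Real.exp x + Real.exp x * (max σ₁ 0 + k + 3) := by gcongr
      _ = Real.exp x * (max σ₁ 0 + k + 4) := by ring
      _ ≤ _ := by gcongr
  have hN : ((2 * M : ℕ) : ℝ) ≤ 4 * x ^ (1 / 2 - 2 * κ) := by push_cast; linarith
  have hN' : 2 * x ^ (1 / 2 - 2 * κ) ≤ ((2 * M : ℕ) : ℝ) := by push_cast; linarith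
  have hV : 0 < x ^ (-2 : ℝ) := by positivity
  have hfin := hmain α σ δ (Real.exp x) (x ^ (-2 : ℝ)) Ω K Q (2 * M) w P hα0 hα1 hδ (by linarith)
    (by linarith) (Real.one_le_exp hx0.le) hKN hKQ hQbig hV (p2 K Q hK hQ hQ') (even_two_mul M) hΩ0
    hlin (hX K hK) hP
  refine hfin.trans ?_
  -- Each of the six error terms is at most 1/8 of the target 1/x.
  have q1 : 2 * Real.exp x ^ (-(1 / 4) : ℝ) ≤ 1 / 8 * x ^ (-1 : ℝ) := by
    rw [← Real.exp_mul]
    simp only [Real.rpow_zero, mul_one, Real.rpow_one] at p6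
    have : Real.exp (x * -(1 / 4)) = Real.exp (-(1 / 4 * x)) := by congr 1; ring
    rw [this]; linarith
  have q2 := p1 σ Q ‖w‖ hσ0 hσ1 hQ hQ' (norm_nonneg w) hwx
  have q3 : ‖w‖ * x ^ (-2 : ℝ) ≤ 1 / 8 * x ^ (-1 : ℝ) := by
    have h1 : ‖w‖ * x ^ (-2 : ℝ) ≤ x ^ (1 / 4 : ℝ) * x ^ (-2 : ℝ) := by gcongr
    rw [← Real.rpow_add hx0] at h1
    norm_num at h1 p7 ⊢
    linarith
  have q4 := p4 K Ω (α ^ (-σ)) ‖w‖ (2 * M) hK1 hK' hN hΩ0 hΩ (by positivity) ha' (norm_nonneg w) hwx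
  have q5 := p5 (α ^ (-σ)) ‖w‖ (2 * M) hN' (by positivity) ha (norm_nonneg w) hwx'
  have q6 := p3 K ‖w‖ hK (norm_nonneg w) hwx
  have q7 : 0 < x ^ (-1 : ℝ) := by positivity
  rw [mul_add ‖w‖]
  linarith

/-! ### The limit law -/

/-- The first six moduli (n+α)^(-σ) are at least 6^(-σ₁), since n + α ≤ 6; hence a decay constant
uniform in α and in σ ≤ σ₁. -/
def lerchDecay (σ₁ : ℝ) : ℝ := 8 * (1 + 729 / ((6 : ℝ) ^ (-σ₁)) ^ 3)

lemma lerchDecay_nonneg (σ₁ : ℝ) : 0 ≤ lerchDecay σ₁ := by unfold lerchDecay; positivity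

lemma IsLerchLaw.norm_charFun_le {α σ σ₁ : ℝ} {P : Measure ℂ} [IsProbabilityMeasure P]
    (hP : IsLerchLaw α σ P) (hα : 0 < α) (hα1 : α ≤ 1) (hσ : 0 ≤ σ) (hσ1 : σ ≤ σ₁) (w : ℂ) :
    ‖charFun P w‖ ≤ lerchDecay σ₁ * (1 + ‖w‖) ^ (-3 : ℝ) := by
  refine norm_charFun_le_of_phaseSeries hP (by positivity) (fun n hn => ?_) w
  have hn' : (n : ℝ) + 1 ≤ 6 := by exact_mod_cast hn
  calc (6 : ℝ) ^ (-σ₁) ≤ 6 ^ (-σ) := Real.rpow_le_rpow_of_exponent_le (by norm_num) (by linarith)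
    _ ≤ _ := Real.rpow_le_rpow_of_nonpos (by positivity) (by linarith) (by linarith)

lemma IsLerchLaw.measureReal_strip_le {α σ σ₁ : ℝ} {P : Measure ℂ} [IsProbabilityMeasure P]
    (hP : IsLerchLaw α σ P) (hα : 0 < α) (hα1 : α ≤ 1) (hσ : 0 ≤ σ) (hσ1 : σ ≤ σ₁) (e : ℂ)
    (he : ‖e‖ = 1) (x r : ℝ) (hr : 0 < r) : P.real {z : ℂ | |inner ℝ z e - x| ≤ r}
      ≤ 3 * lerchDecay σ₁ * decayIntegral * r :=
  _root_.measureReal_strip_le P (hP.norm_charFun_le hα hα1 hσ hσ1) he x hr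

lemma IsLerchLaw.integrable_charFun {α σ : ℝ} {P : Measure ℂ} [IsProbabilityMeasure P]
    (hP : IsLerchLaw α σ P) (hα : 0 < α) (hα1 : α ≤ 1) (hσ : 0 ≤ σ) : Integrable (charFun P) :=
  (integrable_decay_complex.const_mul (lerchDecay σ)).mono' measurable_charFun.aestronglyMeasurable
    (Eventually.of_forall (hP.norm_charFun_le hα hα1 hσ le_rfl))

lemma lerchValueLaw_coe {lam α σ T : ℝ} (hT : 0 < T) :
    (lerchValueLaw lam α σ T : Measure ℂ) = lerchValueMeasure lam α σ T :=
  congrArg (fun P : ProbabilityMeasure ℂ => (P : Measure ℂ)) (dif_pos hT)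

/-- For fixed w the admissible range of |w| grows with T, so the characteristic functions converge
pointwise and Lévy's theorem applies along every sequence. The value ε = 1/8 plays no special role.
-/
theorem IsLerchLaw.tendsto_lerchValueLaw {α σ : ℝ} {P : ProbabilityMeasure ℂ} (hP : IsLerchLaw α σ P)
    (hα : α ∈ admissibleSet) (hσ : 1 / 2 < σ) (lam : ℝ) :
    Tendsto (lerchValueLaw lam α σ) atTop (𝓝 P) := by
  obtain ⟨T₀, -, h⟩ := exists_norm_charFun_lerchValueMeasure_sub_le (ε := 1 / 8) (by norm_num)
    (by norm_num) (sub_pos.2 hσ)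
  obtain ⟨T₁, h⟩ := h lam σ
  have hlim : ∀ w : ℂ, Tendsto (fun T => charFun (lerchValueLaw lam α σ T : Measure ℂ) w) atTop
      (𝓝 (charFun (P : Measure ℂ) w)) := by
    intro w
    rw [tendsto_iff_norm_sub_tendsto_zero]
    refine squeeze_zero' (Eventually.of_forall fun T => norm_nonneg _) ?_
      ((tendsto_rpow_neg_atTop one_pos).comp Real.tendsto_log_atTop)
    have h1 : Tendsto (fun T => Real.log T ^ (1 / 4 - 1 / 8 / 2 : ℝ)) atTop atTop :=
      (tendsto_rpow_atTop (by norm_num)).comp Real.tendsto_log_atTop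
    filter_upwards [eventually_ge_atTop (T₀ α), eventually_ge_atTop T₁, eventually_gt_atTop 0,
      h1.eventually_ge_atTop ‖w‖] with T hT0 hT1 hT hw
    rw [lerchValueLaw_coe hT]
    exact h α hα σ (by linarith) le_rfl T hT0 hT1 w hw P hP
  refine tendsto_of_seq_tendsto fun u hu => ?_
  exact ProbabilityMeasure.tendsto_of_tendsto_charFun fun w => (hlim w).comp hu

lemma isLerchLaw_lerchLimitLaw {α σ : ℝ} (hα : α ∈ admissibleSet) (hσ : 1 / 2 < σ) (lam : ℝ) :
    IsLerchLaw α σ (lerchLimitLaw lam α σ) := by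
  obtain ⟨P, hP⟩ := exists_isLerchLaw hα.1 hσ
  rwa [lerchLimitLaw, (hP.tendsto_lerchValueLaw hα hσ lam).limUnder_eq]

/-- A law satisfying `IsLerchLaw` is the limit for every λ at once, because only the moduli of the
coefficients enter. -/
lemma lerchLimitLaw_eq {α σ : ℝ} (hα : α ∈ admissibleSet) (hσ : 1 / 2 < σ) (lam lam' : ℝ) :
    lerchLimitLaw lam α σ = lerchLimitLaw lam' α σ :=
  ((isLerchLaw_lerchLimitLaw hα hσ lam').tendsto_lerchValueLaw hα hσ lam).limUnder_eq

/-! ### The discrepancy bound -/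

lemma abs_measureReal_sub_le_one {X : Type*} [MeasurableSpace X] (μ ν : Measure X)
    [IsProbabilityMeasure μ] [IsProbabilityMeasure ν] (s : Set X) : |μ.real s - ν.real s| ≤ 1 := by
  have h1 : μ.real s ≤ 1 := measureReal_le_one
  have h2 : ν.real s ≤ 1 := measureReal_le_one
  have h3 : 0 ≤ μ.real s := measureReal_nonneg
  have h4 : 0 ≤ ν.real s := measureReal_nonneg
  rw [abs_le]
  constructor <;> linarith

/-- The smoothing time t = x^(-1/2+3ε/2) is chosen so that, with r = x^(-1/4+ε) and W = x^(1/4-ε/2),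
both r²/t and tW² equal x^(ε/2) and the Gaussian errors are negligible. The remaining term x⁻¹/t =
x^(-1/2-3ε/2) is below r. -/
lemma eventually_smoothing_le {ε : ℝ} (hε : 0 < ε) : ∀ᶠ x : ℝ in atTop, ∀ E v : ℝ, 0 ≤ E → 0 ≤ v →
    8 * E * x ^ (-(1 / 4 : ℝ) + ε)
      + 4 * Real.exp (-(x ^ (-(1 / 4 : ℝ) + ε)) ^ 2 / (8 * x ^ (-(1 / 2 : ℝ) + 3 / 2 * ε)))
      + 9 * ((x ^ (-1 : ℝ) + 4 * Real.exp (-x ^ (-(1 / 2 : ℝ) + 3 / 2 * ε)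
        * (x ^ (1 / 4 - ε / 2)) ^ 2 / 2)) / x ^ (-(1 / 2 : ℝ) + 3 / 2 * ε)) * v
    ≤ (8 * E + 10) * ((v + 1) * x ^ (-(1 / 4 : ℝ) + ε)) := by
  filter_upwards [eventually_ge_atTop 1,
    eventually_mul_exp_neg_rpow_le (c := 1 / 8) (q := ε / 2) (by norm_num) (by linarith) 4 0
      (-(1 / 4 : ℝ) + ε),
    eventually_mul_exp_neg_rpow_le (c := 1 / 2) (q := ε / 2) (by norm_num) (by linarith) (9 * 4)
      (1 / 2 - 3 / 2 * ε) (-(1 / 4 : ℝ) + ε)] with x hx h1 h2 E v hE hv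
  have hx0 : 0 < x := by linarith
  rw [Real.rpow_zero, mul_one] at h1
  have e1 : -(x ^ (-(1 / 4 : ℝ) + ε)) ^ 2 / (8 * x ^ (-(1 / 2 : ℝ) + 3 / 2 * ε))
      = -(1 / 8 * x ^ (ε / 2)) := by
    have : (x ^ (-(1 / 4 : ℝ) + ε)) ^ 2 = x ^ (ε / 2) * x ^ (-(1 / 2 : ℝ) + 3 / 2 * ε) := by
      rw [← Real.rpow_natCast, ← Real.rpow_mul hx0.le, ← Real.rpow_add hx0]
      congr 1; push_cast; ring
    rw [this]
    have h3 : 0 < x ^ (-(1 / 2 : ℝ) + 3 / 2 * ε) := by positivity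
    field_simp
  have e2 : -x ^ (-(1 / 2 : ℝ) + 3 / 2 * ε) * (x ^ (1 / 4 - ε / 2)) ^ 2 / 2
      = -(1 / 2 * x ^ (ε / 2)) := by
    have : x ^ (ε / 2) = x ^ (-(1 / 2 : ℝ) + 3 / 2 * ε) * (x ^ (1 / 4 - ε / 2)) ^ 2 := by
      rw [← Real.rpow_natCast (x ^ (1 / 4 - ε / 2)), ← Real.rpow_mul hx0.le, ← Real.rpow_add hx0]
      congr 1; push_cast; ring
    rw [this]; ring
  have e3 : (x ^ (-(1 / 2 : ℝ) + 3 / 2 * ε))⁻¹ = x ^ (1 / 2 - 3 / 2 * ε) := by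
    rw [← Real.rpow_neg hx0.le]; congr 1; ring
  have e4 : x ^ (-1 : ℝ) * x ^ (1 / 2 - 3 / 2 * ε) ≤ x ^ (-(1 / 4 : ℝ) + ε) := by
    rw [← Real.rpow_add hx0]
    exact Real.rpow_le_rpow_of_exponent_le hx (by linarith)
  rw [e1, e2, div_eq_mul_inv _ (x ^ (-(1 / 2 : ℝ) + 3 / 2 * ε)), e3]
  have hr : 0 ≤ x ^ (-(1 / 4 : ℝ) + ε) := by positivity
  set r := x ^ (-(1 / 4 : ℝ) + ε)
  have e5 : 9 * ((x ^ (-1 : ℝ) + 4 * Real.exp (-(1 / 2 * x ^ (ε / 2)))) * x ^ (1 / 2 - 3 / 2 * ε)) * v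
      ≤ 10 * r * v := by
    refine mul_le_mul_of_nonneg_right ?_ hv
    linarith
  have e6 : 0 ≤ E * (v * r) := by positivity
  linarith

theorem exists_discrepancy_le {ε ε₁ : ℝ} (hε : 0 < ε) (hε' : ε < 1 / 4) (hε₁ : 0 < ε₁) :
    ∃ T₀ : ℝ → ℝ, (∀ α, 0 < T₀ α) ∧ ∀ lam σ₁ : ℝ, ∃ C : ℝ, 0 < C ∧
      ∀ α ∈ admissibleSet, ∀ σ : ℝ, 1 / 2 + ε₁ ≤ σ → σ ≤ σ₁ → ∀ T : ℝ, T₀ α ≤ T →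
      ∀ a b c d : ℝ, (Real.log T) ^ (-(1 / 4 : ℝ) + ε) < b - a →
        (Real.log T) ^ (-(1 / 4 : ℝ) + ε) < d - c →
        |(lerchValueLaw lam α σ T : Measure ℂ).real (closedRect a b c d)
            - (lerchLimitLaw lam α σ : Measure ℂ).real (closedRect a b c d)|
          ≤ C * (((volume : Measure ℂ).real (closedRect a b c d) + 1)
              * (Real.log T) ^ (-(1 / 4 : ℝ) + ε)) := by
  obtain ⟨T₀, hT₀, h⟩ := exists_norm_charFun_lerchValueMeasure_sub_le hε hε' hε₁
  refine ⟨T₀, fun α => (Real.exp_pos _).trans_le (hT₀ α), fun lam σ₁ => ?_⟩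
  obtain ⟨T₁, h⟩ := h lam σ₁
  obtain ⟨x₀, hx₀⟩ := eventually_atTop.1 (eventually_smoothing_le hε)
  set E := 3 * lerchDecay σ₁ * decayIntegral
  have hE0 : 0 ≤ E := mul_nonneg (mul_nonneg (by norm_num) (lerchDecay_nonneg σ₁)) decayIntegral_nonneg
  -- For log T ≤ y the trivial bound 1 is paid for by the summand y^(1/4-ε) of C, so T₀ need not
  -- depend on λ or σ₁. Beyond y, T ≥ log T gives T ≥ T₁.
  obtain ⟨y, hy⟩ : ∃ y, y = max x₀ (max T₁ 1) := ⟨_, rfl⟩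
  have hy0 : x₀ ≤ y := by rw [hy]; exact le_max_left _ _
  have hy1 : T₁ ≤ y := by rw [hy]; exact (le_max_left _ _).trans (le_max_right _ _)
  have hy2 : 1 ≤ y := by rw [hy]; exact (le_max_right _ _).trans (le_max_right _ _)
  have hyp : 0 < y ^ (1 / 4 - ε) := by positivity
  refine ⟨8 * E + 10 + y ^ (1 / 4 - ε), by positivity, fun α hα σ hσ hσ1 T hT a b c d hab hcd => ?_⟩
  have hT' := (hT₀ α).trans hT
  have hT0 : 0 < T := (Real.exp_pos _).trans_le hT'
  have hx1 : 1 ≤ Real.log T := by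
    rw [← Real.log_exp 1]; exact Real.log_le_log (Real.exp_pos _) hT'
  have hTx : T = Real.exp (Real.log T) := (Real.exp_log hT0).symm
  obtain ⟨x, hx⟩ : ∃ x, x = Real.log T := ⟨_, rfl⟩
  rw [← hx] at hx1 hTx hab hcd ⊢
  have hxp : 0 < x := by linarith
  have hP := isLerchLaw_lerchLimitLaw hα (show 1 / 2 < σ by linarith) lam
  have hv : 0 ≤ (volume : Measure ℂ).real (closedRect a b c d) := measureReal_nonneg
  have hr : 0 < x ^ (-(1 / 4 : ℝ) + ε) := by positivity
  rcases le_total x y with hxy | hxy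
  · refine (abs_measureReal_sub_le_one _ _ _).trans ?_
    have h1 : 1 ≤ y ^ (1 / 4 - ε) * x ^ (-(1 / 4 : ℝ) + ε) := by
      calc (1 : ℝ) = x ^ (1 / 4 - ε) * x ^ (-(1 / 4 : ℝ) + ε) := by
            rw [← Real.rpow_add hxp]; norm_num
        _ ≤ _ := by gcongr
    have h2 : 0 ≤ (8 * E + 10) * (((volume : Measure ℂ).real (closedRect a b c d) + 1)
        * x ^ (-(1 / 4 : ℝ) + ε)) := by positivity
    have h3 : 0 ≤ y ^ (1 / 4 - ε) * ((volume : Measure ℂ).real (closedRect a b c d)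
        * x ^ (-(1 / 4 : ℝ) + ε)) := by positivity
    linarith
  · have hT1 : T₁ ≤ T := by
      rw [hTx]; linarith [Real.add_one_le_exp x]
    have h1 := abs_measureReal_closedRect_sub_le (lerchValueLaw lam α σ T : Measure ℂ)
      (lerchLimitLaw lam α σ : Measure ℂ)
      (hP.measureReal_strip_le hα.1 hα.2.1 (by linarith) hσ1)
      (t := x ^ (-(1 / 2 : ℝ) + 3 / 2 * ε)) (η := x ^ (-1 : ℝ)) (W := x ^ (1 / 4 - ε / 2))
      (by positivity) (by positivity) (by positivity)
      (fun w hw => by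
        rw [lerchValueLaw_coe hT0, hx]
        exact h α hα σ hσ hσ1 T hT hT1 w (by rwa [← hx]) _ hP) hr hab hcd
    refine h1.trans ((hx₀ x (hy0.trans hxy) E _ hE0 hv).trans ?_)
    have h3 : 0 ≤ y ^ (1 / 4 - ε) * (((volume : Measure ℂ).real (closedRect a b c d) + 1)
        * x ^ (-(1 / 4 : ℝ) + ε)) := by positivity
    linarith

/-! ### Assembly of the three statements -/

theorem mainTheorem2 :
    -- weak convergence to the limit measure `P_σ`
    (∀ lam : ℝ, ∀ α ∈ admissibleSet, ∀ σ : ℝ, 1 / 2 < σ →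
      Tendsto (lerchValueLaw lam α σ) atTop (𝓝 (lerchLimitLaw lam α σ))) ∧
    -- discrepancy bound: `T₀` depends on `α, ε, ε₁` and `C` depends on `lam, σ₁, ε, ε₁`
    (∀ ε : ℝ, 0 < ε → ∀ ε₁ : ℝ, 0 < ε₁ →
      ∃ T₀ : ℝ → ℝ, (∀ α, 0 < T₀ α) ∧
        ∀ lam σ₁ : ℝ, ∃ C : ℝ, 0 < C ∧
          ∀ α ∈ admissibleSet, ∀ σ : ℝ, 1 / 2 + ε₁ ≤ σ → σ ≤ σ₁ →
          ∀ T : ℝ, T₀ α ≤ T →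
          ∀ a b c d : ℝ,
            (Real.log T) ^ (-(1 / 4 : ℝ) + ε) < b - a →
            (Real.log T) ^ (-(1 / 4 : ℝ) + ε) < d - c →
            |(lerchValueLaw lam α σ T : Measure ℂ).real (closedRect a b c d)
                - (lerchLimitLaw lam α σ : Measure ℂ).real (closedRect a b c d)|
              ≤ C * (((volume : Measure ℂ).real (closedRect a b c d) + 1)
                  * (Real.log T) ^ (-(1 / 4 : ℝ) + ε))) ∧
    -- continuous density `M_σ( · ; α)` with respect to `(2π)⁻¹ dx dy`, the same for all `lam`
    (∀ α ∈ admissibleSet, ∀ σ : ℝ, 1 / 2 < σ →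
      ∃ M : ℂ → ℝ, Continuous M ∧ (∀ z, 0 ≤ M z) ∧
        ∀ lam a b c d : ℝ,
          (lerchLimitLaw lam α σ : Measure ℂ).real (closedRect a b c d)
            = (2 * Real.pi)⁻¹ * ∫ z in closedRect a b c d, M z) := by
  refine ⟨fun lam α hα σ hσ => ?_, fun ε hε ε₁ hε₁ => ?_, fun α hα σ hσ => ?_⟩
  · exact (isLerchLaw_lerchLimitLaw hα hσ lam).tendsto_lerchValueLaw hα hσ lam
  -- For ε ≥ 1/4 the right-hand side is at least 1 as soon as T ≥ e, so only ε < 1/4 has content.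
  · rcases lt_or_ge ε (1 / 4) with h | h
    · exact exists_discrepancy_le hε h hε₁
    · refine ⟨fun _ => Real.exp 1, fun _ => Real.exp_pos 1, fun lam σ₁ => ⟨1, one_pos, ?_⟩⟩
      intro α _ σ _ _ T hT a b c d _ _
      have hx : 1 ≤ Real.log T := by
        rw [← Real.log_exp 1]; exact Real.log_le_log (Real.exp_pos _) hT
      have h1 : 1 ≤ Real.log T ^ (-(1 / 4 : ℝ) + ε) := Real.one_le_rpow hx (by linarith)
      have hv : 0 ≤ (volume : Measure ℂ).real (closedRect a b c d) := measureReal_nonneg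
      refine (abs_measureReal_sub_le_one _ _ _).trans ?_
      nlinarith
  · have hP := isLerchLaw_lerchLimitLaw hα hσ 0
    have hσ0 : 0 ≤ σ := by linarith
    have hi := hP.integrable_charFun hα.1 hα.2.1 hσ0
    refine ⟨fourierDensity (lerchLimitLaw 0 α σ), continuous_fourierDensity _ hi,
      fourierDensity_nonneg _ hi, fun lam a b c d => ?_⟩
    rw [lerchLimitLaw_eq hα hσ lam 0]
    exact measureReal_closedRect_eq_integral_fourierDensity _ hi
      (hP.measureReal_strip_le hα.1 hα.2.1 hσ0 le_rfl) a b c d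

end
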